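/- Let $n\ge 2$ and let $\mathbb{M}^n$ be a complete noncompact $n$-dimensional model manifold with pole $o$, that is, $\mathbb{R}^n$ with the metric $dr^2+\psi(r)^2 g_{\mathbb{S}^{n-1}}$ in polar coordinates about $o$, where $\psi\in C^\infty([0,\infty))$, $\psi>0$ on $(0,\infty)$, $\psi'(0)=1$ and $\psi^{(2k)}(0)=0$ for all integers $k\ge 0$. Let $V$ be its Riemannian volume measure and $B_r$ the geodesic ball of radius $r$ centered at $o$. Let $\mathcal{L}_0$ be the set of measurable $f:\mathbb{M}^n\to\mathbb{R}$ with $\mu_f(t):=V(\{|f|>t\})<\infty$ for all $t>0$. For such $f$ put $f^*(s):=\sup\{t\ge 0:\mu_f(t)>s\}$ and let $f^\star(x):=f^*(V(B_{d(x,o)}))$ be its Schwarz rearrangement. For $f,g\in L^1(\mathbb{M}^n)$ write $f\prec g$ if $\int_{B_r}f^\star\,dV\le\int_{B_r}g^\star\,dV$ for all $r>0$; functions on $B_R$ are extended by zero to $\mathbb{M}^n$ before this definition and the rearrangement are applied. Let $\dot H^1$ be the space of $v\in L^2_{\mathrm{loc}}(\mathbb{M}^n)$ with weak gradient $\nabla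 v\in L^2(\mathbb{M}^n)$ for which there are $\varphi_k\in C_c^\infty(\mathbb{M}^n)$ with $\nabla\varphi_k\to\nabla v$ in $L^2$ and $\varphi_k\to v$ in $L^2_{\mathrm{loc}}$. Assume that $\mathbb{M}^n$ supports the Pólya–Szegő inequality: for every $v\in\dot H^1\cap\mathcal{L}_0$ one has $v^\star\in\dot H^1\cap\mathcal{L}_0$ and $\int|\nabla v^\star|^2\,dV\le\int|\nabla v|^2\,dV$. **Proposition.** Let $R>0$, let $\phi:[0,\infty)\to[0,\infty)$ be a $C^1$ bijection with $\phi(0)=0$ and $\phi'>0$ on $[0,\infty)$, and let $f,\bar f\in L^\infty(B_R)$ be nonnegative, with $\bar f$ (essentially) radially nonincreasing and $f^\star\prec\bar f$. Let $u,\bar u\ge 0$ be the weak solutions of $$-\Delta\phi(u)+u=f\ \text{ in }B_R,\quad \phi(u)=0\ \text{ on }\partial B_R,\qquad\text{and}\qquad -\Delta\phi(\bar u)+\bar u=\bar f\ \text{ in }B_R,\quad \phi(\bar u)=0\ \text{ on }\partial B_R,$$ in the sense that $v=\phi(u)$ is nonnegative, belongs to $H^1_0(B_R)\cap L^\infty(B_R)$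 and satisfies $$\int_{B_R}\langle\nabla v,\nabla w\rangle\,dV+\int_{B_R}\phi^{-1}(v)\,w\,dV=\int_{B_R}f\,w\,dV\qquad\text{for all }w\in H^1_0(B_R),$$ and likewise for $\bar v=\phi(\bar u)$ with $\bar f$ in place of $f$. Then $u^\star\prec\bar u$. -/

import Mathlib

open MeasureTheory Filter Topology
open scoped ENNReal NNReal

noncomputable section

namespace ModelManifold

/-- Model functions: smooth on `[0, ∞)`, positive on `(0, ∞)`, with `ψ'(0) = 1` and
`ψ^(2k)(0) = 0` for all `k ≥ 0` (so that `ψ(0) = 0`). All derivatives at `0` are one-sided. -/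
structure IsModelFunction (ψ : ℝ → ℝ) : Prop where
  smooth : ContDiffOn ℝ (⊤ : ℕ∞) ψ (Set.Ici 0)
  pos : ∀ r : ℝ, 0 < r → 0 < ψ r
  deriv_zero : derivWithin ψ (Set.Ici 0) 0 = 1
  even_deriv_zero : ∀ k : ℕ, iteratedDerivWithin (2 * k) ψ (Set.Ici 0) 0 = 0

/-- The complete noncompact model manifold of dimension `n` is `ℝⁿ` with the metric
`dr² + ψ(r)² g_{𝕊ⁿ⁻¹}`, written in the global chart `x = r θ`. In this chart the pole `o` is the
origin, `d(x, o) = ‖x‖`, and the geodesic ball `B_r` centred at `o` is `Metric.ball 0 r`. -/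
abbrev E (n : ℕ) : Type := EuclideanSpace ℝ (Fin n)

variable {n : ℕ}

/-- The radial unit vector `θ = x / ‖x‖` (which is `0` at the origin). -/
def radialDir (x : E n) : E n := ‖x‖⁻¹ • x

/-- The metric tensor `dr² + ψ(r)² g_{𝕊ⁿ⁻¹}` in the chart: radial components are multiplied as in
`ℝⁿ`, and components orthogonal to `θ` (whose angular part is their Euclidean size divided by `r`)
get the factor `(ψ(r) / r)²`. At the pole it is the Euclidean inner product. -/
def metric (ψ : ℝ → ℝ) (x a b : E n) : ℝ :=
  if x = 0 then inner ℝ a b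
  else inner ℝ a (radialDir x) * inner ℝ b (radialDir x)
    + (ψ ‖x‖ / ‖x‖) ^ 2 *
      (inner ℝ a b - inner ℝ a (radialDir x) * inner ℝ b (radialDir x))

/-- The index raising map of the metric. A covector at `x` is stored as the vector `ω` that
represents it for the Euclidean inner product; `sharp ψ x ω` is the tangent vector that represents
the same covector for the metric (see `metric_sharp`). So if `ω` is the differential of a function
at `x`, then `sharp ψ x ω` is its Riemannian gradient. -/
def sharp (ψ : ℝ → ℝ) (x ω : E n) : E n :=
  if x = 0 then ω
  else inner ℝ ω (radialDir x) • radialDir x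
    + ((‖x‖ / ψ ‖x‖) ^ 2) • (ω - inner ℝ ω (radialDir x) • radialDir x)

theorem metric_sharp {ψ : ℝ → ℝ} (hψ : IsModelFunction ψ) (x ω b : E n) :
    metric ψ x (sharp ψ x ω) b = inner ℝ ω b := by
  unfold metric sharp
  by_cases hx : x = 0
  · simp [hx]
  · have hr : 0 < ‖x‖ := norm_pos_iff.mpr hx
    have hp := hψ.pos _ hr
    have h1 : inner ℝ (radialDir x) (radialDir x) = (1 : ℝ) := by
      rw [real_inner_self_eq_norm_sq]
      simp [radialDir, norm_smul, hr.ne']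
    simp only [hx, if_false, inner_add_left, inner_sub_left, inner_smul_left, h1,
      real_inner_comm b (radialDir x)]
    simp only [conj_trivial]
    field_simp
    ring

/-- The Riemannian volume measure: `ψ(r)ⁿ⁻¹ dr dθ`, that is, `(ψ(r) / r)ⁿ⁻¹ dx` in the chart
(the value of the density at the single point `x = 0` is irrelevant). -/
def vol (n : ℕ) (ψ : ℝ → ℝ) : Measure (E n) :=
  (volume : Measure (E n)).withDensity
    (fun x => ENNReal.ofReal ((ψ ‖x‖ / ‖x‖) ^ (n - 1)))

/-- `ω` is the weak differential of `v` in the open set `Ω` (in the chart, with covectors stored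
as in `sharp`), so that `x ↦ sharp ψ x (ω x)` is the weak Riemannian gradient of `v`. -/
def HasWeakDifferentialOn (Ω : Set (E n)) (v : E n → ℝ) (ω : E n → E n) : Prop :=
  LocallyIntegrableOn v Ω volume ∧ LocallyIntegrableOn ω Ω volume ∧
    ∀ ζ : E n → ℝ, ContDiff ℝ (⊤ : ℕ∞) ζ → HasCompactSupport ζ → tsupport ζ ⊆ Ω →
      ∀ e : E n, ∫ x in Ω, v x * fderiv ℝ ζ x e = - ∫ x in Ω, inner ℝ (ω x) e * ζ x

/-- The pointwise product `⟨∇v, ∇w⟩` of the gradients of two functions with differentials `a`, `b`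
at `x`. -/
def gradInner (ψ : ℝ → ℝ) (x a b : E n) : ℝ := metric ψ x (sharp ψ x a) (sharp ψ x b)

/-- The Dirichlet energy `∫_Ω |∇v|² dV` of a function with differential `ω`. -/
def energy (ψ : ℝ → ℝ) (Ω : Set (E n)) (ω : E n → E n) : ℝ≥0∞ :=
  ∫⁻ x in Ω, ENNReal.ofReal (gradInner ψ x (ω x) (ω x)) ∂(vol n ψ)

/-- `v ∈ Ḣ¹` with weak differential `ω`: `v ∈ L²_loc`, `∇v ∈ L²`, and there are `ζ_k ∈ C_c^∞` with
`∇ζ_k → ∇v` in `L²` and `ζ_k → v` in `L²_loc`. Here `gradient (ζ k)` is the Euclidean gradient, that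
is, the differential of `ζ k` stored as in `sharp`. -/
structure MemDotH1 (ψ : ℝ → ℝ) (v : E n → ℝ) (ω : E n → E n) : Prop where
  memLp_loc : ∀ r : ℝ, 0 < r → MemLp v 2 ((vol n ψ).restrict (Metric.ball 0 r))
  weakDifferential : HasWeakDifferentialOn Set.univ v ω
  energy_lt_top : energy ψ Set.univ ω < ∞
  approx : ∃ ζ : ℕ → E n → ℝ,
    (∀ k, ContDiff ℝ (⊤ : ℕ∞) (ζ k) ∧ HasCompactSupport (ζ k)) ∧
    Tendsto (fun k => energy ψ Set.univ (fun x => gradient (ζ k) x - ω x)) atTop (𝓝 0) ∧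
    ∀ r : ℝ, 0 < r →
      Tendsto (fun k => eLpNorm (fun x => ζ k x - v x) 2
        ((vol n ψ).restrict (Metric.ball 0 r))) atTop (𝓝 0)

/-- `v ∈ H¹₀(B_R)` with weak differential `ω`: `v ∈ L²(B_R)`, `∇v ∈ L²(B_R)`, and `v` is a limit in
`H¹(B_R)` of functions in `C_c^∞(B_R)`. Only the values in `B_R` of `v` and `ω` matter. -/
structure MemH10 (ψ : ℝ → ℝ) (R : ℝ) (v : E n → ℝ) (ω : E n → E n) : Prop where
  memLp : MemLp v 2 ((vol n ψ).restrict (Metric.ball 0 R))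
  weakDifferential : HasWeakDifferentialOn (Metric.ball 0 R) v ω
  energy_lt_top : energy ψ (Metric.ball 0 R) ω < ∞
  approx : ∃ ζ : ℕ → E n → ℝ,
    (∀ k, ContDiff ℝ (⊤ : ℕ∞) (ζ k) ∧ HasCompactSupport (ζ k) ∧ tsupport (ζ k) ⊆ Metric.ball 0 R) ∧
    Tendsto (fun k => energy ψ (Metric.ball 0 R) (fun x => gradient (ζ k) x - ω x))
      atTop (𝓝 0) ∧
    Tendsto (fun k => eLpNorm (fun x => ζ k x - v x) 2
      ((vol n ψ).restrict (Metric.ball 0 R))) atTop (𝓝 0)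

/-- The distribution function `μ_f(t) = V({|f| > t})`. -/
def distribution (ψ : ℝ → ℝ) (f : E n → ℝ) (t : ℝ) : ℝ≥0∞ := vol n ψ {x | t < |f x|}

/-- The class `L₀` of measurable functions all of whose superlevel sets have finite volume. -/
def MemL0 (ψ : ℝ → ℝ) (f : E n → ℝ) : Prop :=
  AEStronglyMeasurable f (vol n ψ) ∧ ∀ t : ℝ, 0 < t → distribution ψ f t < ∞

/-- The one-dimensional rearrangement `f^*(s) = sup {t ≥ 0 : μ_f(t) > s}`, with values in
`[0, ∞]`. -/
def decreasingRearrangement (ψ : ℝ → ℝ) (f : E n → ℝ) (s : ℝ≥0∞) : ℝ≥0∞ :=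
  ⨆ (t : ℝ≥0) (_ : s < distribution ψ f t), (t : ℝ≥0∞)

/-- The Schwarz rearrangement `f^⋆(x) = f^*(V(B_{d(x, o)}))`. For `f` in `L₀` the value is finite
except possibly at the pole. -/
def schwarz (ψ : ℝ → ℝ) (f : E n → ℝ) (x : E n) : ℝ :=
  (decreasingRearrangement ψ f (vol n ψ (Metric.ball 0 ‖x‖))).toReal

/-- The concentration ordering `f ≺ g` between functions in `L¹`. -/
def LessConcentrated (ψ : ℝ → ℝ) (f g : E n → ℝ) : Prop :=
  Integrable f (vol n ψ) ∧ Integrable g (vol n ψ) ∧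
    ∀ r : ℝ, 0 < r →
      ∫ x in Metric.ball 0 r, schwarz ψ f x ∂(vol n ψ) ≤
        ∫ x in Metric.ball 0 r, schwarz ψ g x ∂(vol n ψ)

/-- The Pólya–Szegő inequality: for all `v ∈ Ḣ¹ ∩ L₀` also `v^⋆ ∈ Ḣ¹ ∩ L₀`, and
`∫ |∇v^⋆|² dV ≤ ∫ |∇v|² dV`. -/
def SupportsPolyaSzego (n : ℕ) (ψ : ℝ → ℝ) : Prop :=
  ∀ (v : E n → ℝ) (ω : E n → E n), MemDotH1 ψ v ω → MemL0 ψ v →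
    MemL0 ψ (schwarz ψ v) ∧
      ∃ ω' : E n → E n, MemDotH1 ψ (schwarz ψ v) ω' ∧
        energy ψ Set.univ ω' ≤ energy ψ Set.univ ω

/-- `v` is a (nonnegative, bounded) weak solution of `-Δv + β(v) = f` in `B_R`, `v = 0` on
`∂B_R`. -/
def IsWeakSolution (ψ : ℝ → ℝ) (R : ℝ) (β : ℝ → ℝ) (f v : E n → ℝ) : Prop :=
  (∀ᵐ x ∂((vol n ψ).restrict (Metric.ball 0 R)), 0 ≤ v x) ∧
  MemLp v ∞ ((vol n ψ).restrict (Metric.ball 0 R)) ∧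
  ∃ ω : E n → E n, MemH10 ψ R v ω ∧
    ∀ (w : E n → ℝ) (η : E n → E n), MemH10 ψ R w η →
      ∫ x in Metric.ball 0 R, gradInner ψ x (ω x) (η x) ∂(vol n ψ)
        + ∫ x in Metric.ball 0 R, β (v x) * w x ∂(vol n ψ)
      = ∫ x in Metric.ball 0 R, f x * w x ∂(vol n ψ)

/-- `u ≥ 0` is a weak solution of `-Δφ(u) + u = f` in `B_R`, `φ(u) = 0` on `∂B_R`: the function
`v = φ(u)` is a weak solution of `-Δv + β(v) = f` with `β = φ⁻¹`. -/
def IsFilteredWeakSolution (ψ : ℝ → ℝ) (R : ℝ) (φ : ℝ → ℝ) (f u : E n → ℝ) : Prop :=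
  (∀ᵐ x ∂((vol n ψ).restrict (Metric.ball 0 R)), 0 ≤ u x) ∧
  IsWeakSolution ψ R (Function.invFunOn φ (Set.Ici 0)) f (fun x => φ (u x))

/-- `f` is (essentially) radially nonincreasing in `B_R`. -/
def IsRadiallyNonincreasing (ψ : ℝ → ℝ) (R : ℝ) (f : E n → ℝ) : Prop :=
  ∃ h : ℝ → ℝ, AntitoneOn h (Set.Ioo 0 R) ∧
    ∀ᵐ x ∂((vol n ψ).restrict (Metric.ball 0 R)), f x = h ‖x‖

/-- The extension by zero outside `B_R`. -/
def zeroExtend (R : ℝ) (f : E n → ℝ) : E n → ℝ := (Metric.ball 0 R).indicator f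

end ModelManifold

end

/-!
The classical proof of such comparison results bounds the derivative of the distribution function
by the coarea formula and the isoperimetric inequality. Here the Pólya–Szegő inequality takes the
place of the isoperimetric one, and everything is done with integrated inequalities.

Let `v = φ(u)` and let `z(r)` be the profile of its Schwarz rearrangement. Testing the equation with
`G(v)`, where `G` is a smooth truncation between two levels of `z`, bounds the energy of the
truncated function by a layer-cake integral of `∫_{v > t} (f - u)`. By Hardy–Littlewood the latter
is at most `mass f ρ - mass u ρ`, where `ρ` is the radius of the rearranged level set and `mass` is
the integral of the rearrangement over a ball. By Pólya–Szegő, the rearranged truncation has no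
more energy, and a radial function needs energy at least `(drop)² / resistance` to drop across an
annulus `a < r < b`, the resistance being `∫_a^b dr / |∂B_r|`. With sharp truncations the powers
cancel, and `z(a) - z(b) ≤ M · resistance(a, b)` whenever `z(b) < z(a)` and
`mass f - mass u ≤ M` on `[a, b]` (`IsSolution.drop_le`). In particular `z` tends to `0` at `R`.

If the datum is radially nonincreasing, then so is the solution (`IsSolution.schwarz_ae_eq`):
rearranging `v` increases the pairing with `f - u` and does not increase the energy, so that the
rearrangement of `v` is at distance `0` from `v` in the energy norm, and Poincaré's inequality gives
equality. For such a solution, testing with radial functions gives the reverse inequality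
`c · resistance(a, b) ≤ z(a) - z(b)` if `c ≤ mass f - mass u` on `[a, b]` (`IsSolution.le_drop`).

For the comparison (`IsSolution.mass_le_mass`), let `F = mass u - mass ū`. Where `F > 0`, the excess
`mass f̄ - mass u` is below `mass f̄ - mass ū`, so the two inequalities show that the difference of
the profiles of `φ(u)` and `φ(ū)` is nondecreasing. If this difference is ever positive there, then
`F` keeps growing up to the boundary and the profile of `φ(u)` does not tend to `0`; if it is never
positive, then `F` decreases from a value `≤ 0` and cannot be positive. Both are absurd, so `F ≤ 0`.
-/

namespace ModelManifold

/-! ### Volume of the model manifold -/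

section Volume

variable {n : ℕ} {ψ : ℝ → ℝ}

theorem IsModelFunction.zero (hψ : IsModelFunction ψ) : ψ 0 = 0 := by
  simpa [iteratedDerivWithin_zero] using hψ.even_deriv_zero 0

theorem IsModelFunction.continuousOn (hψ : IsModelFunction ψ) : ContinuousOn ψ (Set.Ici 0) :=
  hψ.smooth.continuousOn

theorem IsModelFunction.continuous_comp_norm (hψ : IsModelFunction ψ) :
    Continuous (fun x : E n => ψ ‖x‖) :=
  hψ.continuousOn.comp_continuous continuous_norm (fun x => norm_nonneg x)

/-- `ψ(r) / r` is bounded above and away from zero on bounded intervals, since it tends to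
`ψ'(0) = 1` at the pole. -/
theorem IsModelFunction.exists_ratio_bounds (hψ : IsModelFunction ψ) (R : ℝ) :
    ∃ c C : ℝ, 0 < c ∧ 0 < C ∧ ∀ r, 0 < r → r ≤ R → c ≤ ψ r / r ∧ ψ r / r ≤ C := by
  rcases le_or_gt R 0 with hR | hR
  · exact ⟨1, 1, one_pos, one_pos, fun r h1 h2 => absurd (h1.trans_le h2) (not_lt.2 hR)⟩
  set q : ℝ → ℝ := Function.update (fun r => ψ r / r) 0 1 with hq
  have hder : HasDerivWithinAt ψ 1 (Set.Ici 0) 0 := by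
    have := (hψ.smooth.differentiableOn (by simp) 0 Set.self_mem_Ici).hasDerivWithinAt
    rwa [hψ.deriv_zero] at this
  have hlim := hasDerivWithinAt_iff_tendsto_slope.1 hder
  have hcont : ContinuousOn q (Set.Icc 0 R) := by
    intro r hr
    rcases hr.1.eq_or_lt with h0 | h0
    · subst h0
      refine continuousWithinAt_update_same.2 ?_
      refine (hlim.mono_left (nhdsWithin_mono _ (Set.sdiff_subset_sdiff_left
        Set.Icc_subset_Ici_self))).congr' ?_
      filter_upwards [self_mem_nhdsWithin] with r hr
      rw [slope_def_field, hψ.zero, sub_zero, sub_zero]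
    · have h1 : ContinuousWithinAt (fun r => ψ r / r) (Set.Icc 0 R) r :=
        ((hψ.continuousOn r h0.le).mono Set.Icc_subset_Ici_self).div continuousWithinAt_id h0.ne'
      refine h1.congr_of_eventuallyEq ?_ (by simp [hq, h0.ne'])
      filter_upwards [mem_nhdsWithin_of_mem_nhds (isOpen_ne.mem_nhds h0.ne')] with s hs
      simp [hq, show s ≠ 0 from hs]
  have hpos : ∀ r ∈ Set.Icc 0 R, 0 < q r := by
    intro r hr
    rcases hr.1.eq_or_lt with h0 | h0
    · simp [hq, ← h0]
    · simpa [hq, h0.ne'] using div_pos (hψ.pos r h0) h0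
  have hne : (Set.Icc 0 R).Nonempty := Set.nonempty_Icc.2 hR.le
  obtain ⟨a, ha, hamin⟩ := isCompact_Icc.exists_isMinOn hne hcont
  obtain ⟨b, hb, hbmax⟩ := isCompact_Icc.exists_isMaxOn hne hcont
  refine ⟨q a, q b, hpos a ha, hpos b hb, fun r h1 h2 => ?_⟩
  have hr : q r = ψ r / r := by simp [hq, h1.ne']
  rw [← hr]
  exact ⟨hamin ⟨h1.le, h2⟩, hbmax ⟨h1.le, h2⟩⟩

/-- The density of the Riemannian volume with respect to Lebesgue measure in the chart. -/
noncomputable def volDensity (n : ℕ) (ψ : ℝ → ℝ) (r : ℝ) : ℝ := (ψ r / r) ^ (n - 1)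

theorem vol_eq : vol n ψ =
    (volume : Measure (E n)).withDensity (fun x => ENNReal.ofReal (volDensity n ψ ‖x‖)) := rfl

theorem measurable_volDensity_norm (hψ : IsModelFunction ψ) :
    Measurable (fun x : E n => volDensity n ψ ‖x‖) :=
  ((hψ.continuous_comp_norm.measurable).div measurable_norm).pow_const _

theorem volDensity_pos (hψ : IsModelFunction ψ) {r : ℝ} (hr : 0 < r) : 0 < volDensity n ψ r :=
  pow_pos (div_pos (hψ.pos r hr) hr) _

theorem volDensity_nonneg (hψ : IsModelFunction ψ) {r : ℝ} (hr : 0 ≤ r) :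
    0 ≤ volDensity n ψ r := by
  rcases hr.eq_or_lt with h | h
  · rw [← h, volDensity, div_zero]; positivity
  · exact (volDensity_pos hψ h).le

theorem vol_absolutelyContinuous : vol n ψ ≪ (volume : Measure (E n)) :=
  withDensity_absolutelyContinuous _ _

theorem ae_ne_zero [Nontrivial (E n)] : ∀ᵐ x : E n, x ≠ 0 := by
  simp [ae_iff]

theorem absolutelyContinuous_vol [Nontrivial (E n)] (hψ : IsModelFunction ψ) :
    (volume : Measure (E n)) ≪ vol n ψ := by
  rw [vol_eq]
  refine withDensity_absolutelyContinuous'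
    (measurable_volDensity_norm hψ).ennreal_ofReal.aemeasurable ?_
  filter_upwards [ae_ne_zero] with x hx
  simpa using volDensity_pos hψ (norm_pos_iff.2 hx)

theorem vol_ae_ne_zero [Nontrivial (E n)] : ∀ᵐ x ∂(vol n ψ), x ≠ (0 : E n) :=
  vol_absolutelyContinuous.ae_le ae_ne_zero

theorem vol_sphere [Nontrivial (E n)] (r : ℝ) : vol n ψ (Metric.sphere (0 : E n) r) = 0 :=
  vol_absolutelyContinuous (Measure.addHaar_sphere _ _ _)

/-- On a geodesic ball the Riemannian volume and Lebesgue measure in the chart are comparable. -/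
theorem exists_vol_restrict_bounds [Nontrivial (E n)] (hψ : IsModelFunction ψ) (R : ℝ) :
    ∃ C : ℝ≥0, (vol n ψ).restrict (Metric.ball 0 R) ≤
        (C : ℝ≥0∞) • (volume : Measure (E n)).restrict (Metric.ball 0 R) ∧
      (volume : Measure (E n)).restrict (Metric.ball 0 R) ≤
        (C : ℝ≥0∞) • (vol n ψ).restrict (Metric.ball 0 R) := by
  obtain ⟨c, C, hc, hC, hb⟩ := hψ.exists_ratio_bounds R
  have hae : ∀ᵐ x : E n ∂(volume.restrict (Metric.ball 0 R)),
      c ^ (n - 1) ≤ volDensity n ψ ‖x‖ ∧ volDensity n ψ ‖x‖ ≤ C ^ (n - 1) := by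
    filter_upwards [ae_restrict_mem Metric.isOpen_ball.measurableSet,
      ae_restrict_of_ae ae_ne_zero] with x hx h0
    have h1 : 0 < ‖x‖ := norm_pos_iff.2 h0
    obtain ⟨h2, h3⟩ := hb ‖x‖ h1 (by simpa using (Metric.mem_ball.1 hx).le)
    exact ⟨pow_le_pow_left₀ hc.le h2 _, pow_le_pow_left₀ (hc.le.trans h2) h3 _⟩
  set A : ℝ≥0 := (C ^ (n - 1)).toNNReal
  set B : ℝ≥0 := (c ^ (n - 1)).toNNReal
  have hB : B ≠ 0 := by
    have : 0 < c ^ (n - 1) := pow_pos hc _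
    simp [B, this]
  refine ⟨max A B⁻¹, ?_, ?_⟩
  · rw [vol_eq, restrict_withDensity Metric.isOpen_ball.measurableSet]
    refine (withDensity_mono (g := fun _ => (A : ℝ≥0∞)) ?_).trans ?_
    · filter_upwards [hae] with x hx
      exact ENNReal.ofReal_le_ofReal hx.2
    · rw [withDensity_const]
      intro s
      simp only [Measure.smul_apply, smul_eq_mul]
      gcongr
      exact le_max_left _ _
  · rw [vol_eq, restrict_withDensity Metric.isOpen_ball.measurableSet]
    have h1 : (B : ℝ≥0∞) • (volume : Measure (E n)).restrict (Metric.ball 0 R) ≤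
        ((volume : Measure (E n)).restrict (Metric.ball 0 R)).withDensity
          (fun x => ENNReal.ofReal (volDensity n ψ ‖x‖)) := by
      rw [← withDensity_const]
      refine withDensity_mono ?_
      filter_upwards [hae] with x hx
      exact ENNReal.ofReal_le_ofReal hx.1
    intro s
    have h2 := h1 s
    simp only [Measure.smul_apply, smul_eq_mul] at h2 ⊢
    calc _ = ((B⁻¹ : ℝ≥0) : ℝ≥0∞) * (B * (volume.restrict (Metric.ball (0 : E n) R)) s) := by
          rw [← mul_assoc, ← ENNReal.coe_mul, inv_mul_cancel₀ hB]; simp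
      _ ≤ _ := by
        gcongr
        exact le_max_right _ _

theorem vol_ball_lt_top [Nontrivial (E n)] (hψ : IsModelFunction ψ) (r : ℝ) :
    vol n ψ (Metric.ball 0 r) < ∞ := by
  obtain ⟨C, h, -⟩ := exists_vol_restrict_bounds (n := n) hψ r
  have h1 := h Set.univ
  simp only [Measure.restrict_apply MeasurableSet.univ, Set.univ_inter, Measure.smul_apply,
    smul_eq_mul] at h1
  exact h1.trans_lt (ENNReal.mul_lt_top ENNReal.coe_lt_top measure_ball_lt_top)

theorem isFiniteMeasure_vol_restrict_ball [Nontrivial (E n)] (hψ : IsModelFunction ψ) (r : ℝ) :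
    IsFiniteMeasure ((vol n ψ).restrict (Metric.ball 0 r)) :=
  ⟨by simpa using vol_ball_lt_top hψ r⟩

theorem continuous_setIntegral_ball [Nontrivial (E n)] {g : E n → ℝ}
    (hg : ∀ r, IntegrableOn g (Metric.ball 0 r) (vol n ψ)) :
    Continuous (fun r : ℝ => ∫ x in Metric.ball 0 r, g x ∂(vol n ψ)) := by
  rw [continuous_iff_continuousAt]
  intro r
  have heq : ∀ s, ∫ x in Metric.ball 0 s, g x ∂(vol n ψ) =
      ∫ x, (Metric.ball 0 s).indicator g x ∂(vol n ψ) := fun s =>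
    (integral_indicator Metric.isOpen_ball.measurableSet).symm
  simp only [heq]
  refine continuousAt_of_dominated
    (bound := (Metric.ball 0 (r + 1)).indicator (fun x => ‖g x‖)) ?_ ?_ ?_ ?_
  · exact Eventually.of_forall fun s =>
      ((hg s).integrable_indicator Metric.isOpen_ball.measurableSet).aestronglyMeasurable
  · filter_upwards [Iio_mem_nhds (lt_add_one r)] with s hs
    refine Eventually.of_forall fun x => ?_
    rw [norm_indicator_eq_indicator_norm]
    exact Set.indicator_le_indicator_of_subset (Metric.ball_subset_ball (le_of_lt hs))
      (fun _ => norm_nonneg _) x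
  · exact (integrable_indicator_iff Metric.isOpen_ball.measurableSet).2 (hg (r + 1)).norm
  · have hs : ∀ᵐ x ∂(vol n ψ), x ∉ Metric.sphere (0 : E n) r :=
      measure_eq_zero_iff_ae_notMem.1 (vol_sphere r)
    filter_upwards [hs] with x hx
    have hx' : ‖x‖ ≠ r := by simpa using hx
    refine ContinuousAt.congr (f := fun _ => (Metric.ball 0 r).indicator g x) continuousAt_const ?_
    rcases lt_or_gt_of_ne hx' with h | h
    · filter_upwards [Ioi_mem_nhds h] with s hs
      rw [Set.indicator_of_mem (by simpa using h), Set.indicator_of_mem (by simpa using hs)]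
    · filter_upwards [Iio_mem_nhds h] with s hs
      rw [Set.indicator_of_notMem (by simpa using h.le),
        Set.indicator_of_notMem (by simpa using le_of_lt hs)]

theorem continuous_vol_ball [Nontrivial (E n)] (hψ : IsModelFunction ψ) :
    Continuous (fun r : ℝ => vol n ψ (Metric.ball (0 : E n) r)) := by
  have h : Continuous (fun r : ℝ => ∫ x in Metric.ball (0 : E n) r, (1 : ℝ) ∂(vol n ψ)) :=
    continuous_setIntegral_ball fun r => by
      rw [IntegrableOn]
      have := isFiniteMeasure_vol_restrict_ball (n := n) hψ r
      exact integrable_const _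
  have h2 := ENNReal.continuous_ofReal.comp h
  convert h2 using 2 with r
  simp [Measure.real, ENNReal.ofReal_toReal (vol_ball_lt_top hψ r).ne]

theorem vol_ball_lt_vol_ball [Nontrivial (E n)] (hψ : IsModelFunction ψ) {r s : ℝ} (hr : 0 ≤ r)
    (hrs : r < s) : vol n ψ (Metric.ball (0 : E n) r) < vol n ψ (Metric.ball 0 s) := by
  set t := (r + s) / 2
  have hrt : r < t := by simp only [t]; linarith
  have hts : t < s := by simp only [t]; linarith
  obtain ⟨e, he⟩ := exists_norm_eq (E n) (c := t) (hr.trans hrt.le)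
  have hsub : Metric.ball e (s - t) ∩ (Metric.closedBall 0 r)ᶜ ⊆
      Metric.ball (0 : E n) s \ Metric.ball 0 r := by
    rintro x ⟨h1, h2⟩
    have h2' : r < ‖x‖ := by simpa using h2
    refine ⟨?_, by simpa using h2'.le⟩
    have := norm_le_norm_add_norm_sub' x e
    rw [mem_ball_iff_norm] at h1
    rw [mem_ball_zero_iff]; linarith
  have hpos : 0 < vol n ψ (Metric.ball (0 : E n) s \ Metric.ball 0 r) := by
    refine lt_of_lt_of_le ?_ (measure_mono hsub)
    rw [pos_iff_ne_zero]
    intro h0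
    have hopen : IsOpen (Metric.ball e (s - t) ∩ (Metric.closedBall (0 : E n) r)ᶜ) :=
      Metric.isOpen_ball.inter Metric.isClosed_closedBall.isOpen_compl
    exact (hopen.measure_pos volume ⟨e, by simpa using hts, by simp [he, hrt]⟩).ne'
      (absolutelyContinuous_vol hψ h0)
  have hadd := measure_sdiff_add_inter (μ := vol n ψ) (Metric.ball (0 : E n) s)
    (Metric.isOpen_ball (x := (0 : E n)) (ε := r)).measurableSet
  rw [Set.inter_eq_right.2 (Metric.ball_subset_ball hrs.le)] at hadd
  rw [← hadd, add_comm]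
  exact ENNReal.lt_add_right (vol_ball_lt_top hψ r).ne hpos.ne'

theorem vol_ball_lt_iff [Nontrivial (E n)] (hψ : IsModelFunction ψ) {r s : ℝ} (hr : 0 ≤ r) :
    vol n ψ (Metric.ball (0 : E n) r) < vol n ψ (Metric.ball 0 s) ↔ r < s := by
  refine ⟨fun h => ?_, vol_ball_lt_vol_ball hψ hr⟩
  by_contra! hle
  exact absurd h (not_lt.2 (measure_mono (Metric.ball_subset_ball hle)))

/-- Every volume up to that of `B_R` is the volume of a ball centred at the pole. -/
theorem exists_vol_ball_eq [Nontrivial (E n)] (hψ : IsModelFunction ψ) {R : ℝ} (hR : 0 ≤ R)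
    {d : ℝ≥0∞} (hd : d ≤ vol n ψ (Metric.ball (0 : E n) R)) :
    ∃ ρ, 0 ≤ ρ ∧ ρ ≤ R ∧ vol n ψ (Metric.ball (0 : E n) ρ) = d := by
  have h := intermediate_value_Icc hR (continuous_vol_ball (n := n) hψ).continuousOn
  obtain ⟨ρ, h1, h2⟩ := h ⟨by simp, hd⟩
  exact ⟨ρ, h1.1, h1.2, h2⟩

end Volume

/-! ### Schwarz rearrangement of bounded functions supported in a ball -/

section Rearrangement

variable {n : ℕ} {ψ : ℝ → ℝ}

theorem distribution_anti (f : E n → ℝ) {s t : ℝ} (h : s ≤ t) :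
    distribution ψ f t ≤ distribution ψ f s :=
  measure_mono fun _ hx => h.trans_lt hx

/-- The Galois-type description of the decreasing rearrangement, by right continuity of the
distribution function. -/
theorem lt_decreasingRearrangement_iff (f : E n → ℝ) (t : ℝ≥0) (s : ℝ≥0∞) :
    (t : ℝ≥0∞) < decreasingRearrangement ψ f s ↔ s < distribution ψ f t := by
  constructor
  · intro h
    simp only [decreasingRearrangement, lt_iSup_iff] at h
    obtain ⟨t', h1, h2⟩ := h
    exact h1.trans_le (distribution_anti f (NNReal.coe_le_coe.2 (ENNReal.coe_le_coe.1 h2.le)))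
  · intro h
    have hU : {x : E n | (t : ℝ) < |f x|} =
        ⋃ k : ℕ, {x : E n | (t : ℝ) + 1 / ((k : ℝ) + 1) < |f x|} := by
      ext x
      simp only [Set.mem_ofPred_eq, Set.mem_iUnion]
      constructor
      · intro hx
        obtain ⟨k, hk⟩ := exists_nat_one_div_lt (sub_pos.2 hx)
        exact ⟨k, by linarith⟩
      · rintro ⟨k, hk⟩
        have : 0 < 1 / ((k : ℝ) + 1) := by positivity
        linarith
    have hmono : Monotone fun k : ℕ => {x : E n | (t : ℝ) + 1 / ((k : ℝ) + 1) < |f x|} := by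
      intro k l hkl x hx
      have : 1 / ((l : ℝ) + 1) ≤ 1 / ((k : ℝ) + 1) :=
        one_div_le_one_div_of_le (by positivity) (by gcongr)
      simp only [Set.mem_ofPred_eq] at hx ⊢
      linarith
    rw [distribution, hU, hmono.directed_le.measure_iUnion, lt_iSup_iff] at h
    obtain ⟨k, hk⟩ := h
    have hlt : t < t + 1 / ((k : ℝ≥0) + 1) := lt_add_of_pos_right _ (by positivity)
    refine (ENNReal.coe_lt_coe.2 hlt).trans_le ?_
    refine le_iSup₂_of_le (t + 1 / ((k : ℝ≥0) + 1)) ?_ le_rfl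
    simpa [distribution] using hk

theorem decreasingRearrangement_congr {f g : E n → ℝ}
    (h : ∀ t : ℝ, 0 ≤ t → distribution ψ f t = distribution ψ g t) :
    decreasingRearrangement ψ f = decreasingRearrangement ψ g := by
  funext s
  simp only [decreasingRearrangement]
  exact iSup_congr fun t => by rw [h t t.2]

theorem schwarz_congr {f g : E n → ℝ}
    (h : ∀ t : ℝ, 0 ≤ t → distribution ψ f t = distribution ψ g t) :
    schwarz ψ f = schwarz ψ g := by
  funext x
  rw [schwarz, schwarz, decreasingRearrangement_congr h]

theorem schwarz_congr_ae {f g : E n → ℝ} (h : f =ᵐ[vol n ψ] g) : schwarz ψ f = schwarz ψ g := by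
  refine schwarz_congr fun t _ => measure_congr ?_
  filter_upwards [h] with x hx
  simp only [eq_iff_iff]
  change t < |f x| ↔ t < |g x|
  rw [hx]

/-- The radial profile of the Schwarz rearrangement: `schwarz ψ f x = profile ψ f ‖x‖`. -/
noncomputable def profile (ψ : ℝ → ℝ) (f : E n → ℝ) (r : ℝ) : ℝ :=
  (decreasingRearrangement ψ f (vol n ψ (Metric.ball 0 r))).toReal

theorem schwarz_apply (f : E n → ℝ) (x : E n) : schwarz ψ f x = profile ψ f ‖x‖ := rfl

theorem profile_nonneg (f : E n → ℝ) (r : ℝ) : 0 ≤ profile ψ f r := ENNReal.toReal_nonneg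

/-- Nonnegative bounded measurable functions vanishing outside `B_R`. Every nonnegative element of
`L^∞(B_R)`, extended by zero, has such a representative. -/
structure BddOnBall (R : ℝ) (f : E n → ℝ) : Prop where
  measurable : Measurable f
  nonneg : ∀ x, 0 ≤ f x
  bdd : ∃ C, ∀ x, f x ≤ C
  zero : ∀ x, x ∉ Metric.ball (0 : E n) R → f x = 0

namespace BddOnBall

variable {R : ℝ} {f : E n → ℝ}

theorem distribution_eq (hf : BddOnBall R f) (t : ℝ) :
    distribution ψ f t = vol n ψ {x | t < f x} := by
  simp only [distribution, abs_of_nonneg (hf.nonneg _)]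

theorem measurableSet_lt (hf : BddOnBall R f) (t : ℝ) : MeasurableSet {x | t < f x} :=
  _root_.measurableSet_lt measurable_const hf.measurable

theorem setOf_lt_subset (hf : BddOnBall R f) {t : ℝ} (ht : 0 ≤ t) :
    {x | t < f x} ⊆ Metric.ball (0 : E n) R := by
  intro x hx
  by_contra h
  have h1 : t < f x := hx
  rw [hf.zero x h] at h1
  linarith

theorem integrable [Nontrivial (E n)] (hψ : IsModelFunction ψ) (hf : BddOnBall R f) :
    Integrable f (vol n ψ) := by
  obtain ⟨C, hC⟩ := hf.bdd
  have := isFiniteMeasure_vol_restrict_ball (n := n) hψ R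
  have h : IntegrableOn f (Metric.ball 0 R) (vol n ψ) :=
    Integrable.of_bound hf.measurable.aestronglyMeasurable C (Eventually.of_forall fun x => by
      rw [Real.norm_of_nonneg (hf.nonneg x)]; exact hC x)
  refine (integrableOn_iff_integrable_of_support_subset ?_).1 h
  intro x hx
  by_contra h'
  exact hx (hf.zero x h')

theorem decreasingRearrangement_ne_top (hf : BddOnBall R f) (s : ℝ≥0∞) :
    decreasingRearrangement ψ f s ≠ ∞ := by
  obtain ⟨C, hC⟩ := hf.bdd
  have : ¬ ((C.toNNReal : ℝ≥0∞) < decreasingRearrangement ψ f s) := by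
    rw [lt_decreasingRearrangement_iff, hf.distribution_eq]
    have : {x | (C.toNNReal : ℝ) < f x} = ∅ := by
      refine Set.eq_empty_of_forall_notMem fun x hx => ?_
      exact absurd ((hC x).trans (Real.le_coe_toNNReal C)) (not_le.2 hx)
    rw [this, measure_empty]
    exact not_lt.2 (zero_le)
  exact ne_top_of_le_ne_top ENNReal.coe_ne_top (not_lt.1 this)

theorem lt_profile_iff (hf : BddOnBall R f) {t : ℝ} (ht : 0 ≤ t) (r : ℝ) :
    t < profile ψ f r ↔ vol n ψ (Metric.ball 0 r) < vol n ψ {x | t < f x} := by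
  rw [← hf.distribution_eq]
  lift t to ℝ≥0 using ht
  rw [← lt_decreasingRearrangement_iff, profile]
  lift decreasingRearrangement ψ f (vol n ψ (Metric.ball 0 r)) to ℝ≥0
    using hf.decreasingRearrangement_ne_top _ with y
  simp

theorem profile_antitone (hf : BddOnBall R f) : Antitone (profile ψ f) := by
  intro r s hrs
  refine le_of_forall_lt fun t ht => ?_
  rcases lt_or_ge t 0 with h | h
  · exact h.trans_le (profile_nonneg _ _)
  · rw [hf.lt_profile_iff h] at ht ⊢
    exact (measure_mono (Metric.ball_subset_ball hrs)).trans_lt ht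

theorem profile_eq_zero (hf : BddOnBall R f) {r : ℝ} (hr : R ≤ r) : profile ψ f r = 0 := by
  refine le_antisymm (not_lt.1 ?_) (profile_nonneg _ _)
  rw [hf.lt_profile_iff le_rfl, not_lt]
  exact measure_mono ((hf.setOf_lt_subset le_rfl).trans (Metric.ball_subset_ball hr))

theorem profile_le (hf : BddOnBall R f) {C : ℝ} (hC0 : 0 ≤ C) (hC : ∀ x, f x ≤ C) (r : ℝ) :
    profile ψ f r ≤ C := by
  refine not_lt.1 ?_
  rw [hf.lt_profile_iff hC0]
  have : {x | C < f x} = ∅ := by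
    ext x
    simpa using hC x
  simp [this]

theorem schwarz (hf : BddOnBall R f) : BddOnBall R (schwarz ψ f) where
  measurable := (hf.profile_antitone.measurable).comp measurable_norm
  nonneg x := profile_nonneg _ _
  bdd := by
    obtain ⟨C, hC⟩ := hf.bdd
    exact ⟨max C 0, fun x => hf.profile_le (le_max_right _ _)
      (fun y => (hC y).trans (le_max_left _ _)) _⟩
  zero x hx := hf.profile_eq_zero (by simpa using hx)

/-- Superlevel sets of the rearrangement are balls with the volume of the original superlevel
set. -/
theorem exists_level_radius [Nontrivial (E n)] (hψ : IsModelFunction ψ) (hR : 0 ≤ R)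
    (hf : BddOnBall R f) {t : ℝ} (ht : 0 ≤ t) :
    ∃ ρ, 0 ≤ ρ ∧ ρ ≤ R ∧ vol n ψ (Metric.ball (0 : E n) ρ) = vol n ψ {x | t < f x} ∧
      (∀ r, 0 ≤ r → (t < profile ψ f r ↔ r < ρ)) ∧
      {x : E n | t < ModelManifold.schwarz ψ f x} = Metric.ball 0 ρ := by
  obtain ⟨ρ, h0, h1, h2⟩ := exists_vol_ball_eq (n := n) hψ hR
    (measure_mono (hf.setOf_lt_subset ht))
  have h3 : ∀ r, 0 ≤ r → (t < profile ψ f r ↔ r < ρ) := fun r hr => by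
    rw [hf.lt_profile_iff ht, ← h2, vol_ball_lt_iff hψ hr]
  refine ⟨ρ, h0, h1, h2, h3, ?_⟩
  ext x
  simpa [schwarz_apply] using h3 ‖x‖ (norm_nonneg x)

theorem vol_lt_schwarz [Nontrivial (E n)] (hψ : IsModelFunction ψ) (hR : 0 ≤ R)
    (hf : BddOnBall R f) {t : ℝ} (ht : 0 ≤ t) :
    vol n ψ {x | t < ModelManifold.schwarz ψ f x} = vol n ψ {x | t < f x} := by
  obtain ⟨ρ, -, -, h2, -, h4⟩ := hf.exists_level_radius hψ hR ht
  rw [h4, h2]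

theorem schwarz_schwarz [Nontrivial (E n)] (hψ : IsModelFunction ψ) (hR : 0 ≤ R)
    (hf : BddOnBall R f) :
    ModelManifold.schwarz ψ (ModelManifold.schwarz ψ f) = ModelManifold.schwarz ψ f :=
  schwarz_congr fun t ht => by
    rw [hf.schwarz.distribution_eq, hf.distribution_eq, hf.vol_lt_schwarz hψ hR ht]

theorem setIntegral_eq [Nontrivial (E n)] (hψ : IsModelFunction ψ)
    (hf : BddOnBall R f) (A : Set (E n)) :
    ENNReal.ofReal (∫ x in A, f x ∂(vol n ψ)) =
      ∫⁻ t in Set.Ioi (0 : ℝ), vol n ψ ({x | t < f x} ∩ A) := by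
  rw [ofReal_integral_eq_lintegral_ofReal (hf.integrable hψ).integrableOn
    (Eventually.of_forall hf.nonneg),
    lintegral_eq_lintegral_meas_lt _ (Eventually.of_forall hf.nonneg) hf.measurable.aemeasurable]
  refine lintegral_congr fun t => ?_
  rw [Measure.restrict_apply (hf.measurableSet_lt t)]

theorem vol_lt_schwarz_inter_ball [Nontrivial (E n)] (hψ : IsModelFunction ψ) (hR : 0 ≤ R)
    (hf : BddOnBall R f) {t : ℝ} (ht : 0 ≤ t) (ρ : ℝ) :
    vol n ψ ({x | t < ModelManifold.schwarz ψ f x} ∩ Metric.ball 0 ρ) =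
      min (vol n ψ {x | t < f x}) (vol n ψ (Metric.ball 0 ρ)) := by
  obtain ⟨σ, -, -, h2, -, h4⟩ := hf.exists_level_radius hψ hR ht
  rw [h4, ← h2]
  rcases le_total σ ρ with h | h
  · have := Metric.ball_subset_ball (x := (0 : E n)) h
    rw [Set.inter_eq_left.2 this, min_eq_left (measure_mono this)]
  · have := Metric.ball_subset_ball (x := (0 : E n)) h
    rw [Set.inter_eq_right.2 this, min_eq_right (measure_mono this)]

/-- Hardy–Littlewood inequality for sets. -/
theorem setIntegral_le_schwarz [Nontrivial (E n)] (hψ : IsModelFunction ψ) (hR : 0 ≤ R)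
    (hf : BddOnBall R f) {A : Set (E n)} {ρ : ℝ}
    (hA : vol n ψ A ≤ vol n ψ (Metric.ball (0 : E n) ρ)) :
    ∫ x in A, f x ∂(vol n ψ) ≤
      ∫ x in Metric.ball 0 ρ, ModelManifold.schwarz ψ f x ∂(vol n ψ) := by
  rw [← ENNReal.ofReal_le_ofReal_iff (integral_nonneg hf.schwarz.nonneg), hf.setIntegral_eq hψ,
    hf.schwarz.setIntegral_eq hψ]
  refine setLIntegral_mono' measurableSet_Ioi fun t ht => ?_
  rw [hf.vol_lt_schwarz_inter_ball hψ hR (le_of_lt ht)]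
  exact le_min (measure_mono Set.inter_subset_left)
    ((measure_mono Set.inter_subset_right).trans hA)

/-- On a superlevel set the Hardy–Littlewood inequality is an equality. -/
theorem setIntegral_superlevel_eq [Nontrivial (E n)] (hψ : IsModelFunction ψ) (hR : 0 ≤ R)
    (hf : BddOnBall R f) {s ρ : ℝ}
    (hρ : vol n ψ (Metric.ball (0 : E n) ρ) = vol n ψ {x | s < f x}) :
    ∫ x in {x | s < f x}, f x ∂(vol n ψ) =
      ∫ x in Metric.ball 0 ρ, ModelManifold.schwarz ψ f x ∂(vol n ψ) := by
  refine le_antisymm (hf.setIntegral_le_schwarz hψ hR hρ.ge) ?_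
  rw [← ENNReal.ofReal_le_ofReal_iff (integral_nonneg hf.nonneg), hf.setIntegral_eq hψ,
    hf.schwarz.setIntegral_eq hψ]
  refine setLIntegral_mono' measurableSet_Ioi fun t ht => ?_
  rw [hf.vol_lt_schwarz_inter_ball hψ hR (le_of_lt ht), hρ]
  rcases le_total s t with h | h
  · rw [Set.inter_eq_left.2 (show {x | t < f x} ⊆ {x | s < f x} from fun x hx => h.trans_lt hx)]
    exact min_le_left _ _
  · rw [Set.inter_eq_right.2 (show {x | s < f x} ⊆ {x | t < f x} from fun x hx => h.trans_lt hx)]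
    exact min_le_right _ _

theorem comp {G : ℝ → ℝ} (hf : BddOnBall R f) (hmono : MonotoneOn G (Set.Ici 0))
    (hcont : ContinuousOn G (Set.Ici 0)) (h0 : G 0 = 0) : BddOnBall R (fun x => G (f x)) where
  measurable := by
    have h1 : Continuous (fun s : ℝ => G (max s 0)) :=
      hcont.comp_continuous (by fun_prop) (fun s => le_max_right s 0)
    have h2 : (fun x => G (f x)) = fun x => G (max (f x) 0) := by
      funext x
      rw [max_eq_left (hf.nonneg x)]
    rw [h2]
    exact h1.measurable.comp hf.measurable
  nonneg x := by
    rw [← h0]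
    exact hmono Set.self_mem_Ici (hf.nonneg x) (hf.nonneg x)
  bdd := by
    obtain ⟨C, hC⟩ := hf.bdd
    exact ⟨G (max C 0), fun x => hmono (hf.nonneg x) (Set.mem_Ici.2 (le_max_right _ _))
      ((hC x).trans (le_max_left _ _))⟩
  zero x hx := by rw [hf.zero x hx, h0]

/-- Rearrangement commutes with continuous nondecreasing functions vanishing at `0`. -/
theorem profile_comp {G : ℝ → ℝ} (hf : BddOnBall R f) (hmono : MonotoneOn G (Set.Ici 0))
    (hcont : ContinuousOn G (Set.Ici 0)) (h0 : G 0 = 0) (r : ℝ) :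
    profile ψ (fun x => G (f x)) r = G (profile ψ f r) := by
  have hGf := hf.comp hmono hcont h0
  have hy0 := profile_nonneg (ψ := ψ) f r
  have hG0 : 0 ≤ G (profile ψ f r) := by
    rw [← h0]
    exact hmono Set.self_mem_Ici hy0 hy0
  apply le_antisymm
  · refine not_lt.1 fun hlt => ?_
    rw [hGf.lt_profile_iff hG0] at hlt
    have hsub : {x | G (profile ψ f r) < G (f x)} ⊆ {x | profile ψ f r < f x} := by
      intro x hx
      by_contra h
      exact absurd (hmono (hf.nonneg x) hy0 (not_lt.1 h)) (not_le.2 hx)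
    exact lt_irrefl _ ((hf.lt_profile_iff hy0 r).2 (hlt.trans_le (measure_mono hsub)))
  · refine le_of_forall_lt fun t ht => ?_
    rcases lt_or_ge t 0 with h | h
    · exact h.trans_le (profile_nonneg _ _)
    have hypos : 0 < profile ψ f r := by
      refine hy0.lt_of_ne fun he => ?_
      rw [← he, h0] at ht
      linarith
    have hev : ∀ᶠ s in 𝓝[Set.Ico 0 (profile ψ f r)] (profile ψ f r), t < G s :=
      ((hcont _ hy0).mono (fun s hs => hs.1)).eventually (lt_mem_nhds ht)
    have hne : (𝓝[Set.Ico 0 (profile ψ f r)] (profile ψ f r)).NeBot := by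
      rw [← mem_closure_iff_nhdsWithin_neBot, closure_Ico hypos.ne]
      exact Set.right_mem_Icc.2 hy0
    obtain ⟨s, hs1, hs2⟩ := (hev.and self_mem_nhdsWithin).exists
    have h1 := (hf.lt_profile_iff hs2.1 r).1 hs2.2
    rw [hGf.lt_profile_iff h]
    refine h1.trans_le (measure_mono fun x hx => ?_)
    exact hs1.trans_le (hmono hs2.1 (hf.nonneg x) (le_of_lt hx))

/-- A radially nonincreasing function coincides almost everywhere with its rearrangement. -/
theorem schwarz_ae_eq [Nontrivial (E n)] (hψ : IsModelFunction ψ) (hf : BddOnBall R f)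
    (hrad : IsRadiallyNonincreasing ψ R f) : ModelManifold.schwarz ψ f =ᵐ[vol n ψ] f := by
  obtain ⟨h₀, hanti₀, hae₀⟩ := hrad
  -- Replacing the profile by its positive part makes it nonnegative everywhere.
  set h : ℝ → ℝ := fun r => max (h₀ r) 0
  have hanti : AntitoneOn h (Set.Ioo 0 R) := fun r hr s hs hrs =>
    max_le_max (hanti₀ hr hs hrs) le_rfl
  have hae : ∀ᵐ x ∂(vol n ψ), x ∈ Metric.ball (0 : E n) R → f x = h ‖x‖ := by
    rw [ae_restrict_iff' Metric.isOpen_ball.measurableSet] at hae₀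
    filter_upwards [hae₀] with x hx hxR
    simp only [h]
    rw [← hx hxR, max_eq_left (hf.nonneg x)]
  have hlow : ∀ r s, 0 < r → r < s → s < R → h s ≤ profile ψ f r := by
    intro r s hr hrs hs
    refine not_lt.1 fun hlt => lt_irrefl (profile ψ f r) ?_
    rw [hf.lt_profile_iff (profile_nonneg _ _)]
    refine (vol_ball_lt_vol_ball hψ hr.le hrs).trans_le (measure_mono_ae ?_)
    filter_upwards [hae, vol_ae_ne_zero] with x hx hx0 hxs
    have hxs' : ‖x‖ < s := mem_ball_zero_iff.1 hxs
    change profile ψ f r < f x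
    rw [hx (mem_ball_zero_iff.2 (hxs'.trans hs))]
    exact hlt.trans_le (hanti ⟨norm_pos_iff.2 hx0, hxs'.trans hs⟩ ⟨hr.trans hrs, hs⟩ hxs'.le)
  have hupp : ∀ r, 0 < r → r < R → profile ψ f r ≤ h r := by
    intro r hr hrR
    refine not_lt.1 fun hlt => ?_
    rw [hf.lt_profile_iff (le_max_right _ _)] at hlt
    refine absurd hlt (not_lt.2 (measure_mono_ae ?_))
    filter_upwards [hae] with x hx hxl
    by_contra hxr
    have hxr' : r ≤ ‖x‖ := not_lt.1 fun h => hxr (mem_ball_zero_iff.2 h)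
    have hl : h r < f x := hxl
    have hxR := hf.setOf_lt_subset (le_max_right (h₀ r) 0) hxl
    rw [hx hxR] at hl
    exact absurd (hanti ⟨hr, hrR⟩ ⟨hr.trans_le hxr', mem_ball_zero_iff.1 hxR⟩ hxr') (not_le.2 hl)
  have hD := hanti.countable_not_continuousWithinAt
  have hnull : ∀ᵐ x ∂(vol n ψ),
      ‖x‖ ∉ {r ∈ Set.Ioo 0 R | ¬ ContinuousWithinAt h (Set.Ioo 0 R) r} := by
    refine (measure_eq_zero_iff_ae_notMem (s := {x : E n | ‖x‖ ∈
      {r ∈ Set.Ioo 0 R | ¬ ContinuousWithinAt h (Set.Ioo 0 R) r}})).1 ?_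
    have : {x : E n | ‖x‖ ∈ {r ∈ Set.Ioo 0 R | ¬ ContinuousWithinAt h (Set.Ioo 0 R) r}} =
        ⋃ r ∈ {r ∈ Set.Ioo 0 R | ¬ ContinuousWithinAt h (Set.Ioo 0 R) r},
          Metric.sphere (0 : E n) r := by
      ext x
      simp
    rw [this, measure_biUnion_null_iff hD]
    exact fun r _ => vol_sphere r
  filter_upwards [hae, vol_ae_ne_zero, hnull] with x hx hx0 hxD
  by_cases hxR : x ∈ Metric.ball (0 : E n) R
  · rw [hx hxR, schwarz_apply]
    have hx1 : 0 < ‖x‖ := norm_pos_iff.2 hx0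
    have hx2 : ‖x‖ < R := mem_ball_zero_iff.1 hxR
    refine le_antisymm (hupp _ hx1 hx2) ?_
    have hc : ContinuousWithinAt h (Set.Ioo ‖x‖ R) ‖x‖ := by
      by_contra hcon
      exact hxD ⟨⟨hx1, hx2⟩, fun h' => hcon (h'.mono (Set.Ioo_subset_Ioo_left hx1.le))⟩
    have hne : (𝓝[Set.Ioo ‖x‖ R] ‖x‖).NeBot := by
      rw [← mem_closure_iff_nhdsWithin_neBot, closure_Ioo hx2.ne]
      exact Set.left_mem_Icc.2 hx2.le
    refine le_of_tendsto hc ?_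
    filter_upwards [self_mem_nhdsWithin] with s hs
    exact hlow _ _ hx1 hs.1 hs.2
  · rw [hf.zero x hxR, hf.schwarz.zero x hxR]

end BddOnBall

end Rearrangement

/-! ### Orthonormal coframes and the Dirichlet energy as an `L²` norm -/

section Coframe

variable {n : ℕ} {ψ : ℝ → ℝ}

/-- A square root of the cometric: `coframe ψ x` maps a covector at `x` (stored as in `sharp`) to
its components in an orthonormal coframe, so that `⟨∇v, ∇w⟩` becomes a Euclidean inner product
(see `gradInner_eq`). -/
noncomputable def coframe (ψ : ℝ → ℝ) (x : E n) : E n →L[ℝ] E n :=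
  if x = 0 then ContinuousLinearMap.id ℝ (E n)
  else (‖x‖ / ψ ‖x‖) • ContinuousLinearMap.id ℝ (E n) +
    (1 - ‖x‖ / ψ ‖x‖) • (innerSL ℝ (radialDir x)).smulRight (radialDir x)

theorem norm_radialDir {x : E n} (hx : x ≠ 0) : ‖radialDir x‖ = 1 := by
  simp [radialDir, norm_smul, hx]

theorem coframe_apply {x : E n} (hx : x ≠ 0) (a : E n) :
    coframe ψ x a = (‖x‖ / ψ ‖x‖) • a +
      (1 - ‖x‖ / ψ ‖x‖) • (inner ℝ (radialDir x) a • radialDir x) := by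
  simp [coframe, hx]

theorem gradInner_eq (hψ : IsModelFunction ψ) (x a b : E n) :
    gradInner ψ x a b = inner ℝ (coframe ψ x a) (coframe ψ x b) := by
  rw [gradInner, metric_sharp hψ, sharp]
  by_cases hx : x = 0
  · simp [hx, coframe]
  · have h1 : inner ℝ (radialDir x) (radialDir x) = (1 : ℝ) := by
      rw [real_inner_self_eq_norm_sq, norm_radialDir hx]; norm_num
    rw [if_neg hx, coframe_apply hx, coframe_apply hx]
    simp only [inner_add_left, inner_add_right, inner_sub_right, inner_smul_left,
      inner_smul_right, h1, conj_trivial, real_inner_comm (radialDir x)]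
    ring

theorem norm_coframe_sq {x : E n} (hx : x ≠ 0) (a : E n) :
    ‖coframe ψ x a‖ ^ 2 = (inner ℝ (radialDir x) a) ^ 2 +
      (‖x‖ / ψ ‖x‖) ^ 2 * (‖a‖ ^ 2 - (inner ℝ (radialDir x) a) ^ 2) := by
  have h1 : inner ℝ (radialDir x) (radialDir x) = (1 : ℝ) := by
    rw [real_inner_self_eq_norm_sq, norm_radialDir hx]; norm_num
  rw [← real_inner_self_eq_norm_sq, coframe_apply hx]
  simp only [inner_add_left, inner_add_right, inner_smul_left,
    inner_smul_right, h1, conj_trivial]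
  rw [real_inner_comm (radialDir x) a, real_inner_self_eq_norm_sq]
  ring

theorem inner_radialDir_sq_le {x : E n} (hx : x ≠ 0) (a : E n) :
    (inner ℝ (radialDir x) a) ^ 2 ≤ ‖a‖ ^ 2 := by
  have h := abs_real_inner_le_norm (radialDir x) a
  rw [norm_radialDir hx, one_mul] at h
  exact sq_le_sq' (by linarith [neg_abs_le (inner ℝ (radialDir x) a : ℝ)])
    ((le_abs_self _).trans h)

/-- The radial derivative is bounded by the norm of the gradient. -/
theorem abs_inner_radialDir_le {x : E n} (hx : x ≠ 0) (a : E n) :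
    |inner ℝ (radialDir x) a| ≤ ‖coframe ψ x a‖ := by
  refine abs_le_of_sq_le_sq ?_ (norm_nonneg _)
  rw [norm_coframe_sq hx]
  have := inner_radialDir_sq_le hx a
  have h2 : 0 ≤ (‖x‖ / ψ ‖x‖) ^ 2 * (‖a‖ ^ 2 - (inner ℝ (radialDir x) a) ^ 2) :=
    mul_nonneg (sq_nonneg _) (by linarith)
  linarith

theorem exists_coframe_bounds (hψ : IsModelFunction ψ) (R : ℝ) :
    ∃ C : ℝ, 0 < C ∧ ∀ x ∈ Metric.ball (0 : E n) R, ∀ a : E n,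
      ‖coframe ψ x a‖ ≤ C * ‖a‖ ∧ ‖a‖ ≤ C * ‖coframe ψ x a‖ := by
  obtain ⟨c, C, hc, hC, hb⟩ := hψ.exists_ratio_bounds R
  refine ⟨1 + C + c⁻¹, by positivity, fun x hx a => ?_⟩
  set D := 1 + C + c⁻¹
  have hci : 0 < c⁻¹ := by positivity
  have hD1 : 1 ≤ D := by simp only [D]; linarith
  by_cases hx0 : x = 0
  · have : coframe ψ x a = a := by simp [coframe, hx0]
    rw [this]
    exact ⟨le_mul_of_one_le_left (norm_nonneg _) hD1, le_mul_of_one_le_left (norm_nonneg _) hD1⟩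
  have hr := norm_pos_iff.2 hx0
  obtain ⟨h1, h2⟩ := hb ‖x‖ hr (mem_ball_zero_iff.1 hx).le
  set k := ‖x‖ / ψ ‖x‖ with hk
  have hkinv : k⁻¹ = ψ ‖x‖ / ‖x‖ := by rw [hk, inv_div]
  have hkpos : 0 < k := div_pos hr (hψ.pos _ hr)
  have hkD : k ≤ D := by
    have : k ≤ c⁻¹ := by
      rw [← inv_inv k, hkinv]
      exact inv_anti₀ hc h1
    simp only [D]; linarith
  have hkD' : 1 ≤ D * k := by
    have h3 : k⁻¹ ≤ D := by rw [hkinv]; simp only [D]; linarith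
    calc (1 : ℝ) = k⁻¹ * k := (inv_mul_cancel₀ hkpos.ne').symm
      _ ≤ D * k := by gcongr
  have hsq := norm_coframe_sq (ψ := ψ) hx0 a
  rw [← hk] at hsq
  set i := (inner ℝ (radialDir x) a : ℝ)
  have hi : i ^ 2 ≤ ‖a‖ ^ 2 := inner_radialDir_sq_le hx0 a
  have hD0 : 0 ≤ D := by linarith
  constructor
  · refine le_of_sq_le_sq ?_ (by positivity)
    rw [hsq, mul_pow]
    have e1 : k ^ 2 ≤ D ^ 2 := by gcongr
    have e2 : (1 : ℝ) ≤ D ^ 2 := one_le_pow₀ hD1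
    nlinarith [mul_le_mul_of_nonneg_right e1 (sub_nonneg.2 hi),
      mul_le_mul_of_nonneg_right e2 (sq_nonneg i)]
  · refine le_of_sq_le_sq ?_ (by positivity)
    rw [mul_pow, hsq]
    have e1 : 1 ≤ (D * k) ^ 2 := one_le_pow₀ hkD'
    have e2 : (1 : ℝ) ≤ D ^ 2 := one_le_pow₀ hD1
    nlinarith [mul_le_mul_of_nonneg_right e1 (sub_nonneg.2 hi),
      mul_le_mul_of_nonneg_right e2 (sq_nonneg i)]

theorem aestronglyMeasurable_coframe [Nontrivial (E n)] (hψ : IsModelFunction ψ) {ω : E n → E n}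
    {Ω : Set (E n)} (hω : AEStronglyMeasurable ω ((vol n ψ).restrict Ω)) :
    AEStronglyMeasurable (fun x => coframe ψ x (ω x)) ((vol n ψ).restrict Ω) := by
  have hk : Measurable (fun x : E n => ‖x‖ / ψ ‖x‖) :=
    measurable_norm.div hψ.continuous_comp_norm.measurable
  have hθ : Measurable (fun x : E n => radialDir x) :=
    (measurable_norm.inv).smul measurable_id
  have h : AEStronglyMeasurable (fun x => (‖x‖ / ψ ‖x‖) • ω x +
      (1 - ‖x‖ / ψ ‖x‖) • (inner ℝ (radialDir x) (ω x) • radialDir x))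
      ((vol n ψ).restrict Ω) :=
    (hk.aestronglyMeasurable.smul hω).add
      ((measurable_const.sub hk).aestronglyMeasurable.smul
        ((hθ.aestronglyMeasurable.inner (𝕜 := ℝ) hω).smul hθ.aestronglyMeasurable))
  refine h.congr ?_
  filter_upwards [ae_restrict_of_ae vol_ae_ne_zero] with x hx
  rw [coframe_apply hx]

/-- The `L²(Ω)` norm of the gradient of a function with differential `ω`. -/
noncomputable def gradNorm (ψ : ℝ → ℝ) (Ω : Set (E n)) (ω : E n → E n) : ℝ≥0∞ :=
  eLpNorm (fun x => coframe ψ x (ω x)) 2 ((vol n ψ).restrict Ω)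

theorem energy_eq (hψ : IsModelFunction ψ) (Ω : Set (E n)) (ω : E n → E n) :
    energy ψ Ω ω = gradNorm ψ Ω ω ^ 2 := by
  have h := eLpNorm_nnreal_pow_eq_lintegral (f := fun x => coframe ψ x (ω x))
    (μ := (vol n ψ).restrict Ω) (p := 2) two_ne_zero
  simp only [NNReal.coe_ofNat, ENNReal.rpow_ofNat] at h
  rw [gradNorm]
  refine Eq.trans ?_ h.symm
  refine lintegral_congr fun x => ?_
  rw [gradInner_eq hψ, real_inner_self_eq_norm_sq, ENNReal.ofReal_pow (norm_nonneg _),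
    ofReal_norm]

theorem energy_lt_top_iff (hψ : IsModelFunction ψ) {Ω : Set (E n)} {ω : E n → E n} :
    energy ψ Ω ω < ∞ ↔ gradNorm ψ Ω ω < ∞ := by
  rw [energy_eq hψ]
  simp [ENNReal.pow_lt_top_iff]

theorem tendsto_energy_iff (hψ : IsModelFunction ψ) {Ω : Set (E n)} {ω : ℕ → E n → E n} :
    Tendsto (fun k => energy ψ Ω (ω k)) atTop (𝓝 0) ↔
      Tendsto (fun k => gradNorm ψ Ω (ω k)) atTop (𝓝 0) := by
  simp only [energy_eq hψ]
  constructor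
  · intro h
    have h2 := (ENNReal.continuous_rpow_const (y := (1 / 2 : ℝ))).continuousAt.tendsto.comp h
    rw [ENNReal.zero_rpow_of_pos (by norm_num)] at h2
    refine h2.congr fun k => ?_
    simp only [Function.comp]
    rw [← ENNReal.rpow_natCast, ← ENNReal.rpow_mul]
    norm_num
  · intro h
    have h2 := (ENNReal.continuous_pow 2).continuousAt.tendsto.comp h
    simpa [Function.comp_def] using h2

/-- On a geodesic ball, the `L²` norms of functions and of differentials in the chart are
equivalent to the Riemannian ones. -/
theorem exists_norm_equiv [Nontrivial (E n)] (hψ : IsModelFunction ψ) (R : ℝ) :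
    ∃ C : ℝ≥0∞, C ≠ ∞ ∧
      (∀ v : E n → ℝ, eLpNorm v 2 (volume.restrict (Metric.ball 0 R)) ≤
        C * eLpNorm v 2 ((vol n ψ).restrict (Metric.ball 0 R))) ∧
      (∀ v : E n → ℝ, eLpNorm v 2 ((vol n ψ).restrict (Metric.ball 0 R)) ≤
        C * eLpNorm v 2 (volume.restrict (Metric.ball 0 R))) ∧
      (∀ ω : E n → E n, eLpNorm ω 2 (volume.restrict (Metric.ball 0 R)) ≤
        C * gradNorm ψ (Metric.ball 0 R) ω) ∧
      (∀ ω : E n → E n, gradNorm ψ (Metric.ball 0 R) ω ≤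
        C * eLpNorm ω 2 (volume.restrict (Metric.ball 0 R))) := by
  obtain ⟨A, hA1, hA2⟩ := exists_vol_restrict_bounds (n := n) hψ R
  obtain ⟨B, hB, hB2⟩ := exists_coframe_bounds (n := n) hψ R
  set a : ℝ≥0∞ := (A : ℝ≥0∞) ^ (1 / (2 : ℝ≥0∞)).toReal
  have ha : a ≠ ∞ := ENNReal.rpow_ne_top_of_nonneg (by positivity) ENNReal.coe_ne_top
  have h1 : ∀ {F : Type} [NormedAddCommGroup F] (v : E n → F),
      eLpNorm v 2 (volume.restrict (Metric.ball 0 R)) ≤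
        a * eLpNorm v 2 ((vol n ψ).restrict (Metric.ball 0 R)) := fun v => by
    refine (eLpNorm_mono_measure v hA2).trans ?_
    rw [eLpNorm_smul_measure_of_ne_top (by simp), smul_eq_mul]
  have h2 : ∀ {F : Type} [NormedAddCommGroup F] (v : E n → F),
      eLpNorm v 2 ((vol n ψ).restrict (Metric.ball 0 R)) ≤
        a * eLpNorm v 2 (volume.restrict (Metric.ball 0 R)) := fun v => by
    refine (eLpNorm_mono_measure v hA1).trans ?_
    rw [eLpNorm_smul_measure_of_ne_top (by simp), smul_eq_mul]
  set b := ENNReal.ofReal B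
  have hb0 : a ≤ a + a * b := le_self_add
  have hb1 : a * b ≤ a + a * b := le_add_self
  refine ⟨a + a * b, by simp [ha, b, ENNReal.mul_eq_top], fun v => (h1 v).trans (by gcongr),
    fun v => (h2 v).trans (by gcongr), fun ω => ?_, fun ω => ?_⟩
  · have h3 : eLpNorm ω 2 ((vol n ψ).restrict (Metric.ball 0 R)) ≤
        b * gradNorm ψ (Metric.ball 0 R) ω :=
      eLpNorm_le_mul_eLpNorm_of_ae_le_mul (by
        filter_upwards [ae_restrict_mem Metric.isOpen_ball.measurableSet] with x hx
        exact (hB2 x hx (ω x)).2) 2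
    calc _ ≤ a * eLpNorm ω 2 ((vol n ψ).restrict (Metric.ball 0 R)) := h1 ω
      _ ≤ a * (b * gradNorm ψ (Metric.ball 0 R) ω) := by gcongr
      _ ≤ _ := by rw [← mul_assoc]; gcongr
  · have h3 : gradNorm ψ (Metric.ball 0 R) ω ≤
        b * eLpNorm ω 2 ((vol n ψ).restrict (Metric.ball 0 R)) :=
      eLpNorm_le_mul_eLpNorm_of_ae_le_mul (by
        filter_upwards [ae_restrict_mem Metric.isOpen_ball.measurableSet] with x hx
        exact (hB2 x hx (ω x)).1) 2
    calc _ ≤ b * eLpNorm ω 2 ((vol n ψ).restrict (Metric.ball 0 R)) := h3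
      _ ≤ b * (a * eLpNorm ω 2 (volume.restrict (Metric.ball 0 R))) := by gcongr; exact h2 ω
      _ ≤ _ := by rw [← mul_assoc, mul_comm b a]; gcongr

theorem aestronglyMeasurable_restrict_vol {F : Type*} [TopologicalSpace F]
    {f : E n → F} {Ω : Set (E n)} (h : AEStronglyMeasurable f (volume.restrict Ω)) :
    AEStronglyMeasurable f ((vol n ψ).restrict Ω) :=
  h.mono_ac (vol_absolutelyContinuous.restrict Ω)

theorem aestronglyMeasurable_restrict_volume [Nontrivial (E n)] (hψ : IsModelFunction ψ)
    {F : Type*} [TopologicalSpace F]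
    {f : E n → F} {Ω : Set (E n)} (h : AEStronglyMeasurable f ((vol n ψ).restrict Ω)) :
    AEStronglyMeasurable f (volume.restrict Ω) :=
  h.mono_ac ((absolutelyContinuous_vol hψ).restrict Ω)

end Coframe

/-! ### Weak differentials of limits of smooth functions -/

section L2

variable {α F : Type*} [MeasurableSpace α] {ν : Measure α} [NormedAddCommGroup F]
  [InnerProductSpace ℝ F]

theorem integral_inner_eq_inner_toLp {f g : α → F} (hf : MemLp f 2 ν) (hg : MemLp g 2 ν) :
    ∫ x, inner ℝ (f x) (g x) ∂ν = inner ℝ (hf.toLp f) (hg.toLp g) := by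
  rw [L2.inner_def]
  refine integral_congr_ae ?_
  filter_upwards [hf.coeFn_toLp, hg.coeFn_toLp] with x h1 h2
  rw [h1, h2]

theorem integrable_inner {f g : α → F} (hf : MemLp f 2 ν) (hg : MemLp g 2 ν) :
    Integrable (fun x => (inner ℝ (f x) (g x) : ℝ)) ν := by
  refine (L2.integrable_inner (𝕜 := ℝ) (hf.toLp f) (hg.toLp g)).congr ?_
  filter_upwards [hf.coeFn_toLp, hg.coeFn_toLp] with x h1 h2
  rw [h1, h2]

theorem tendsto_integral_inner {f : ℕ → α → F} {f₀ g : α → F} (hf : ∀ k, MemLp (f k) 2 ν)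
    (hf₀ : MemLp f₀ 2 ν) (hg : MemLp g 2 ν)
    (h : Tendsto (fun k => eLpNorm (fun x => f k x - f₀ x) 2 ν) atTop (𝓝 0)) :
    Tendsto (fun k => ∫ x, inner ℝ (f k x) (g x) ∂ν) atTop (𝓝 (∫ x, inner ℝ (f₀ x) (g x) ∂ν)) := by
  have h1 : Tendsto (fun k => (hf k).toLp (f k)) atTop (𝓝 (hf₀.toLp f₀)) :=
    (Lp.tendsto_Lp_iff_tendsto_eLpNorm'' f hf f₀ hf₀).2 h
  simp only [fun k => integral_inner_eq_inner_toLp (hf k) hg, integral_inner_eq_inner_toLp hf₀ hg]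
  exact h1.inner tendsto_const_nhds

end L2

section WeakLimit

variable {n : ℕ}

theorem tsupport_fderiv_apply_subset (η : E n → ℝ) (e : E n) :
    Function.support (fun x => fderiv ℝ η x e) ⊆ tsupport η := by
  intro x hx
  refine support_fderiv_subset ℝ (f := η) ?_
  intro h0
  apply hx
  simp [h0]

theorem continuous_gradient {ζ : E n → ℝ} (hζ : ContDiff ℝ (⊤ : ℕ∞) ζ) :
    Continuous (gradient ζ) :=
  (InnerProductSpace.toDual ℝ (E n)).symm.continuous.comp (hζ.continuous_fderiv (by simp))

theorem inner_gradient (ζ : E n → ℝ) (x e : E n) : inner ℝ (gradient ζ x) e = fderiv ℝ ζ x e :=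
  inner_gradient_left

theorem integral_mul_fderiv_of_smooth {ζ η : E n → ℝ} (hζ : ContDiff ℝ (⊤ : ℕ∞) ζ)
    (hη : ContDiff ℝ (⊤ : ℕ∞) η) (hc : HasCompactSupport η) (e : E n) :
    ∫ x, ζ x * fderiv ℝ η x e = - ∫ x, fderiv ℝ ζ x e * η x := by
  have c1 : Continuous (fun x => fderiv ℝ η x e) :=
    (hη.continuous_fderiv (by simp)).clm_apply continuous_const
  have c2 : Continuous (fun x => fderiv ℝ ζ x e) :=
    (hζ.continuous_fderiv (by simp)).clm_apply continuous_const
  have s1 : HasCompactSupport (fun x => fderiv ℝ η x e) :=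
    HasCompactSupport.intro' hc (isClosed_tsupport η) fun x hx => by
      by_contra h
      exact hx (tsupport_fderiv_apply_subset η e h)
  refine integral_mul_fderiv_eq_neg_fderiv_mul_of_integrable ?_ ?_ ?_ ?_ ?_
  · exact (c2.mul hη.continuous).integrable_of_hasCompactSupport hc.mul_left
  · exact (hζ.continuous.mul c1).integrable_of_hasCompactSupport s1.mul_left
  · exact (hζ.continuous.mul hη.continuous).integrable_of_hasCompactSupport hc.mul_left
  · exact fun x _ => (hζ.differentiable (by simp)).differentiableAt
  · exact fun x _ => (hη.differentiable (by simp)).differentiableAt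

theorem memLp_two_of_continuous_ball {F : Type*} [NormedAddCommGroup F] {f : E n → F}
    (hf : Continuous f) (Ω : Set (E n)) (r : ℝ) :
    MemLp f 2 (volume.restrict (Ω ∩ Metric.ball 0 r)) := by
  obtain ⟨C, hC⟩ := (isCompact_closedBall (0 : E n) r).exists_bound_of_continuousOn hf.continuousOn
  have : IsFiniteMeasure ((volume : Measure (E n)).restrict (Ω ∩ Metric.ball 0 r)) :=
    ⟨by
      rw [Measure.restrict_apply_univ]
      exact (measure_mono Set.inter_subset_right).trans_lt measure_ball_lt_top⟩
  refine MemLp.of_bound hf.aestronglyMeasurable C ?_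
  have h1 : (volume : Measure (E n)).restrict (Ω ∩ Metric.ball 0 r) ≤
      volume.restrict (Metric.ball 0 r) := Measure.restrict_mono Set.inter_subset_right le_rfl
  filter_upwards [ae_mono h1 (ae_restrict_mem Metric.isOpen_ball.measurableSet)] with x hx
  exact hC x (Metric.ball_subset_closedBall hx)

/-- If smooth functions converge in `L²_loc` together with their gradients, then the limit of the
gradients is the weak differential of the limit. -/
theorem hasWeakDifferentialOn_of_tendsto {Ω : Set (E n)} (hΩ : IsOpen Ω) {v : E n → ℝ}
    {ω : E n → E n}
    (hv : ∀ r, MemLp v 2 (volume.restrict (Ω ∩ Metric.ball 0 r)))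
    (hω : ∀ r, MemLp ω 2 (volume.restrict (Ω ∩ Metric.ball 0 r)))
    {ζ : ℕ → E n → ℝ} (hζ : ∀ k, ContDiff ℝ (⊤ : ℕ∞) (ζ k))
    (h1 : ∀ r, Tendsto (fun k => eLpNorm (fun x => ζ k x - v x) 2
      (volume.restrict (Ω ∩ Metric.ball 0 r))) atTop (𝓝 0))
    (h2 : ∀ r, Tendsto (fun k => eLpNorm (fun x => gradient (ζ k) x - ω x) 2
      (volume.restrict (Ω ∩ Metric.ball 0 r))) atTop (𝓝 0)) :
    HasWeakDifferentialOn Ω v ω := by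
  have hfin : ∀ r, IsFiniteMeasure ((volume : Measure (E n)).restrict (Ω ∩ Metric.ball 0 r)) :=
    fun r => ⟨by
      rw [Measure.restrict_apply_univ]
      exact (measure_mono Set.inter_subset_right).trans_lt measure_ball_lt_top⟩
  have hloc : ∀ {F : Type} [NormedAddCommGroup F] (f : E n → F),
      (∀ r, MemLp f 2 (volume.restrict (Ω ∩ Metric.ball 0 r))) → LocallyIntegrableOn f Ω := by
    intro F _ f hf x hx
    have := hfin (‖x‖ + 1)
    refine ⟨Ω ∩ Metric.ball 0 (‖x‖ + 1), ?_, (hf (‖x‖ + 1)).integrable (by norm_num)⟩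
    exact inter_mem_nhdsWithin _ (Metric.isOpen_ball.mem_nhds (by simp))
  refine ⟨hloc v hv, hloc ω hω, fun η hη hc hsupp e => ?_⟩
  obtain ⟨r, hr⟩ := hc.isBounded.subset_ball (0 : E n)
  have hA : MeasurableSet (Ω ∩ Metric.ball (0 : E n) r) :=
    (hΩ.inter Metric.isOpen_ball).measurableSet
  have hsubA : tsupport η ⊆ Ω ∩ Metric.ball 0 r := Set.subset_inter hsupp hr
  have z1 : ∀ x, x ∉ tsupport η → fderiv ℝ η x e = 0 := fun x hx => by
    by_contra h
    exact hx (tsupport_fderiv_apply_subset η e h)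
  have z2 : ∀ x, x ∉ tsupport η → η x = 0 := fun x hx => image_eq_zero_of_notMem_tsupport hx
  have hred : ∀ (f : E n → ℝ), (∀ x, x ∉ tsupport η → f x = 0) →
      ∫ x in Ω, f x = ∫ x in Ω ∩ Metric.ball 0 r, f x := fun f hf =>
    setIntegral_eq_of_subset_of_forall_sdiff_eq_zero hΩ.measurableSet Set.inter_subset_left
      fun x hx => hf x fun h => hx.2 (hsubA h)
  have hred' : ∀ (f : E n → ℝ), (∀ x, x ∉ tsupport η → f x = 0) →
      ∫ x, f x = ∫ x in Ω ∩ Metric.ball 0 r, f x := fun f hf => by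
    rw [← setIntegral_univ]
    exact setIntegral_eq_of_subset_of_forall_sdiff_eq_zero MeasurableSet.univ (Set.subset_univ _)
      fun x hx => hf x fun h => hx.2 (hsubA h)
  have c1 : Continuous (fun x => fderiv ℝ η x e) :=
    (hη.continuous_fderiv (by simp)).clm_apply continuous_const
  have t1 := tendsto_integral_inner (fun k => memLp_two_of_continuous_ball (hζ k).continuous Ω r)
    (hv r) (memLp_two_of_continuous_ball c1 Ω r) (h1 r)
  have t2 := tendsto_integral_inner
    (fun k => memLp_two_of_continuous_ball (continuous_gradient (hζ k)) Ω r)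
    (hω r) (memLp_two_of_continuous_ball (hη.continuous.smul continuous_const) Ω r) (h2 r)
    (g := fun x => η x • e)
  have heq : ∀ k, ∫ x in Ω ∩ Metric.ball 0 r, inner ℝ (ζ k x) (fderiv ℝ η x e) =
      - ∫ x in Ω ∩ Metric.ball 0 r, inner ℝ (gradient (ζ k) x) (η x • e) := fun k => by
    simp only [inner_smul_right, inner_gradient]
    rw [← hred', ← hred']
    · have := integral_mul_fderiv_of_smooth (hζ k) hη hc e
      simpa [mul_comm] using this
    · intro x hx; simp [z2 x hx]
    · intro x hx; simp [z1 x hx]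
  simp only [heq] at t1
  have := tendsto_nhds_unique t1 t2.neg
  rw [hred _ (fun x hx => by simp [z1 x hx]), hred _ (fun x hx => by simp [z2 x hx])]
  simpa [inner_smul_right, mul_comm] using this

end WeakLimit

/-! ### Operations on `H¹₀(B_R)` -/

section Sobolev

variable {n : ℕ} {ψ : ℝ → ℝ} {R : ℝ}

theorem tendsto_eLpNorm_two_of_dominated {α F : Type*} [MeasurableSpace α] {ν : Measure α}
    [NormedAddCommGroup F] {f : ℕ → α → F} {g : α → F} (hf : ∀ k, AEStronglyMeasurable (f k) ν)
    (hg : MemLp g 2 ν) (hle : ∀ k, ∀ᵐ x ∂ν, ‖f k x‖ ≤ ‖g x‖)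
    (hlim : ∀ᵐ x ∂ν, Tendsto (fun k => f k x) atTop (𝓝 0)) :
    Tendsto (fun k => eLpNorm (f k) 2 ν) atTop (𝓝 0) := by
  have hsq : ∀ h : α → F, ∫⁻ x, ‖h x‖ₑ ^ 2 ∂ν = eLpNorm h 2 ν ^ 2 := fun h => by
    have := eLpNorm_nnreal_pow_eq_lintegral (f := h) (μ := ν) (p := 2) two_ne_zero
    simp only [NNReal.coe_ofNat, ENNReal.rpow_ofNat] at this
    exact this.symm
  have h1 : Tendsto (fun k => ∫⁻ x, ‖f k x‖ₑ ^ 2 ∂ν) atTop (𝓝 (∫⁻ _, 0 ∂ν)) := by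
    refine tendsto_lintegral_of_dominated_convergence' (fun x => ‖g x‖ₑ ^ 2)
      (fun k => (hf k).enorm.pow_const 2) (fun k => ?_) ?_ ?_
    · filter_upwards [hle k] with x hx
      gcongr
      exact enorm_le_iff_norm_le.2 hx
    · rw [hsq]
      exact ENNReal.pow_ne_top hg.2.ne
    · filter_upwards [hlim] with x hx
      have h2 : Tendsto (fun k => ‖f k x‖ₑ) atTop (𝓝 0) := by simpa using hx.enorm
      simpa [Function.comp_def] using ((ENNReal.continuous_pow 2).tendsto 0).comp h2
  rw [lintegral_zero] at h1
  simp only [hsq] at h1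
  have h2 := (ENNReal.continuous_rpow_const (y := (1 / 2 : ℝ))).continuousAt.tendsto.comp h1
  rw [ENNReal.zero_rpow_of_pos (by norm_num)] at h2
  refine h2.congr fun k => ?_
  simp only [Function.comp]
  rw [← ENNReal.rpow_natCast, ← ENNReal.rpow_mul]
  norm_num

theorem tendsto_zero_of_le_const_mul {C : ℝ≥0∞} (hC : C ≠ ∞) {a b : ℕ → ℝ≥0∞}
    (hb : Tendsto b atTop (𝓝 0)) (h : ∀ k, a k ≤ C * b k) : Tendsto a atTop (𝓝 0) := by
  have h1 : Tendsto (fun k => C * b k) atTop (𝓝 0) := by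
    simpa using ENNReal.Tendsto.const_mul hb (Or.inr hC)
  exact tendsto_of_tendsto_of_tendsto_of_le_of_le tendsto_const_nhds h1 (fun _ => zero_le) h

theorem gradient_eq_zero_of_notMem_tsupport {ζ : E n → ℝ} {x : E n} (hx : x ∉ tsupport ζ) :
    gradient ζ x = 0 := by
  have : fderiv ℝ ζ x = 0 := by
    by_contra h
    exact hx (support_fderiv_subset ℝ h)
  simp [gradient, this]

theorem memLp_vol_of_continuous [Nontrivial (E n)] (hψ : IsModelFunction ψ) {F : Type*}
    [NormedAddCommGroup F] {f : E n → F} (hf : Continuous f) (r : ℝ) (p : ℝ≥0∞) :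
    MemLp f p ((vol n ψ).restrict (Metric.ball 0 r)) := by
  obtain ⟨C, hC⟩ := (isCompact_closedBall (0 : E n) r).exists_bound_of_continuousOn hf.continuousOn
  have := isFiniteMeasure_vol_restrict_ball (n := n) hψ r
  refine MemLp.of_bound hf.aestronglyMeasurable C ?_
  filter_upwards [ae_restrict_mem Metric.isOpen_ball.measurableSet] with x hx
  exact hC x (Metric.ball_subset_closedBall hx)

theorem gradNorm_gradient_lt_top [Nontrivial (E n)] (hψ : IsModelFunction ψ)
    {ζ : E n → ℝ} (hζ : ContDiff ℝ (⊤ : ℕ∞) ζ) (r : ℝ) :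
    gradNorm ψ (Metric.ball 0 r) (gradient ζ) < ∞ := by
  obtain ⟨C, hC, -, -, -, h⟩ := exists_norm_equiv (n := n) hψ r
  refine (h _).trans_lt (ENNReal.mul_lt_top hC.lt_top ?_)
  have := memLp_two_of_continuous_ball (continuous_gradient hζ) Set.univ r
  rw [Set.univ_inter] at this
  exact this.2

/-- Membership in `H¹₀(B_R)` follows from the approximation property alone; the weak differential
is obtained in the limit. -/
theorem MemH10.of_approx [Nontrivial (E n)] (hψ : IsModelFunction ψ) {v : E n → ℝ} {ω : E n → E n}
    (hv : MemLp v 2 ((vol n ψ).restrict (Metric.ball 0 R)))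
    (hω : AEStronglyMeasurable ω ((vol n ψ).restrict (Metric.ball 0 R)))
    (hfin : gradNorm ψ (Metric.ball 0 R) ω < ∞) {ζ : ℕ → E n → ℝ}
    (hζ : ∀ k, ContDiff ℝ (⊤ : ℕ∞) (ζ k) ∧ HasCompactSupport (ζ k) ∧
      tsupport (ζ k) ⊆ Metric.ball 0 R)
    (h1 : Tendsto (fun k => gradNorm ψ (Metric.ball 0 R) (fun x => gradient (ζ k) x - ω x))
      atTop (𝓝 0))
    (h2 : Tendsto (fun k => eLpNorm (fun x => ζ k x - v x) 2
      ((vol n ψ).restrict (Metric.ball 0 R))) atTop (𝓝 0)) :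
    MemH10 ψ R v ω := by
  obtain ⟨C, hC, e1, -, e3, -⟩ := exists_norm_equiv (n := n) hψ R
  have hmono : ∀ r, (volume : Measure (E n)).restrict (Metric.ball 0 R ∩ Metric.ball 0 r) ≤
      volume.restrict (Metric.ball 0 R) := fun r =>
    Measure.restrict_mono Set.inter_subset_left le_rfl
  have hv' : MemLp v 2 (volume.restrict (Metric.ball 0 R)) :=
    ⟨aestronglyMeasurable_restrict_volume hψ hv.1,
      (e1 v).trans_lt (ENNReal.mul_lt_top hC.lt_top hv.2)⟩
  have hω' : MemLp ω 2 (volume.restrict (Metric.ball 0 R)) :=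
    ⟨aestronglyMeasurable_restrict_volume hψ hω,
      (e3 ω).trans_lt (ENNReal.mul_lt_top hC.lt_top hfin)⟩
  refine ⟨hv, ?_, (energy_lt_top_iff hψ).2 hfin, ζ, hζ, (tendsto_energy_iff hψ).2 h1, h2⟩
  refine hasWeakDifferentialOn_of_tendsto Metric.isOpen_ball (fun r => hv'.mono_measure (hmono r))
    (fun r => hω'.mono_measure (hmono r)) (fun k => (hζ k).1) (fun r => ?_) (fun r => ?_)
  · exact tendsto_zero_of_le_const_mul hC h2 fun k =>
      (eLpNorm_mono_measure _ (hmono r)).trans (e1 _)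
  · exact tendsto_zero_of_le_const_mul hC h1 fun k =>
      (eLpNorm_mono_measure _ (hmono r)).trans (e3 _)

namespace MemH10

variable {v w : E n → ℝ} {ω η : E n → E n}

theorem gradNorm_lt_top (hψ : IsModelFunction ψ) (hv : MemH10 ψ R v ω) :
    gradNorm ψ (Metric.ball 0 R) ω < ∞ := (energy_lt_top_iff hψ).1 hv.energy_lt_top

theorem aestronglyMeasurable [Nontrivial (E n)] (hv : MemH10 ψ R v ω) :
    AEStronglyMeasurable ω ((vol n ψ).restrict (Metric.ball 0 R)) :=
  aestronglyMeasurable_restrict_vol hv.weakDifferential.2.1.aestronglyMeasurable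

theorem memLp_coframe [Nontrivial (E n)] (hψ : IsModelFunction ψ) (hv : MemH10 ψ R v ω) :
    MemLp (fun x => coframe ψ x (ω x)) 2 ((vol n ψ).restrict (Metric.ball 0 R)) :=
  ⟨aestronglyMeasurable_coframe hψ hv.aestronglyMeasurable, hv.gradNorm_lt_top hψ⟩

theorem congr [Nontrivial (E n)] (hψ : IsModelFunction ψ) (hv : MemH10 ψ R v ω)
    (hvw : v =ᵐ[(vol n ψ).restrict (Metric.ball 0 R)] w) : MemH10 ψ R w ω := by
  obtain ⟨ζ, hζ, h1, h2⟩ := hv.approx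
  refine of_approx hψ (hv.memLp.ae_eq hvw) hv.aestronglyMeasurable (hv.gradNorm_lt_top hψ) hζ
    ((tendsto_energy_iff hψ).1 h1) (h2.congr fun k => eLpNorm_congr_ae ?_)
  filter_upwards [hvw] with x hx
  rw [hx]

theorem of_smooth [Nontrivial (E n)] (hψ : IsModelFunction ψ) {ζ : E n → ℝ}
    (hζ : ContDiff ℝ (⊤ : ℕ∞) ζ) (hc : HasCompactSupport ζ) (hs : tsupport ζ ⊆ Metric.ball 0 R) :
    MemH10 ψ R ζ (gradient ζ) :=
  of_approx hψ (memLp_vol_of_continuous hψ hζ.continuous R 2)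
    (continuous_gradient hζ).aestronglyMeasurable (gradNorm_gradient_lt_top hψ hζ R)
    (ζ := fun _ => ζ) (fun _ => ⟨hζ, hc, hs⟩) (by simp [gradNorm]) (by simp)

theorem sub [Nontrivial (E n)] (hψ : IsModelFunction ψ) (hv : MemH10 ψ R v ω)
    (hw : MemH10 ψ R w η) : MemH10 ψ R (fun x => v x - w x) (fun x => ω x - η x) := by
  obtain ⟨ζ, hζ, h1, h2⟩ := hv.approx
  obtain ⟨ξ, hξ, h3, h4⟩ := hw.approx
  rw [tendsto_energy_iff hψ] at h1 h3
  have hm := hv.aestronglyMeasurable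
  have hm' := hw.aestronglyMeasurable
  refine of_approx hψ (hv.memLp.sub hw.memLp) (hm.sub hm') ?_
    (ζ := fun k x => ζ k x - ξ k x) (fun k => ⟨(hζ k).1.sub (hξ k).1, (hζ k).2.1.sub (hξ k).2.1,
      (tsupport_sub _ _).trans (Set.union_subset (hζ k).2.2 (hξ k).2.2)⟩) ?_ ?_
  · have := (hv.memLp_coframe hψ).sub (hw.memLp_coframe hψ)
    refine lt_of_eq_of_lt (eLpNorm_congr_ae ?_) this.2
    exact Eventually.of_forall fun x => map_sub _ _ _
  · have hlim := h1.add h3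
    rw [add_zero] at hlim
    refine tendsto_of_tendsto_of_tendsto_of_le_of_le tendsto_const_nhds hlim (fun _ => zero_le)
      fun k => ?_
    refine le_trans (le_of_eq ?_) (eLpNorm_sub_le
      (aestronglyMeasurable_coframe hψ
        ((continuous_gradient (hζ k).1).aestronglyMeasurable.sub hm))
      (aestronglyMeasurable_coframe hψ
        ((continuous_gradient (hξ k).1).aestronglyMeasurable.sub hm')) (by norm_num))
    refine eLpNorm_congr_ae (Eventually.of_forall fun x => ?_)
    have hg : gradient (fun y => ζ k y - ξ k y) x = gradient (ζ k) x - gradient (ξ k) x := by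
      simp only [gradient]
      rw [fderiv_fun_sub ((hζ k).1.differentiable (by simp)).differentiableAt
        ((hξ k).1.differentiable (by simp)).differentiableAt, map_sub]
    simp only [Pi.sub_apply, hg, ← map_sub]
    congr 1
    abel
  · have hlim := h2.add h4
    rw [add_zero] at hlim
    refine tendsto_of_tendsto_of_tendsto_of_le_of_le tendsto_const_nhds hlim (fun _ => zero_le)
      fun k => ?_
    refine le_trans (le_of_eq ?_) (eLpNorm_sub_le
      ((hζ k).1.continuous.aestronglyMeasurable.sub hv.memLp.1)
      ((hξ k).1.continuous.aestronglyMeasurable.sub hw.memLp.1) (by norm_num))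
    refine eLpNorm_congr_ae (Eventually.of_forall fun x => ?_)
    simp only [Pi.sub_apply]
    ring

/-- Chain rule for smooth nondecreasing functions of slope at most one. -/
theorem comp [Nontrivial (E n)] (hψ : IsModelFunction ψ) (hv : MemH10 ψ R v ω) {G : ℝ → ℝ}
    (hG : ContDiff ℝ (⊤ : ℕ∞) G) (hG0 : G 0 = 0) (hd0 : ∀ s, 0 ≤ deriv G s)
    (hd1 : ∀ s, deriv G s ≤ 1) :
    MemH10 ψ R (fun x => G (v x)) (fun x => deriv G (v x) • ω x) := by
  obtain ⟨ζ₀, hζ₀, h1₀, h2₀⟩ := hv.approx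
  rw [tendsto_energy_iff hψ] at h1₀
  -- Along a subsequence the approximations also converge almost everywhere.
  obtain ⟨ns, hns, hae⟩ := (tendstoInMeasure_of_tendsto_eLpNorm (p := 2) (by norm_num)
    (fun k => (hζ₀ k).1.continuous.aestronglyMeasurable) hv.memLp.1 h2₀).exists_seq_tendsto_ae
  set ζ := fun k => ζ₀ (ns k)
  have hζ := fun k => hζ₀ (ns k)
  have h1 := h1₀.comp hns.tendsto_atTop
  have h2 := h2₀.comp hns.tendsto_atTop
  have hgc : Continuous (deriv G) := hG.continuous_deriv (by simp)
  have hlip : LipschitzWith 1 G := lipschitzWith_of_nnnorm_deriv_le (hG.differentiable (by simp))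
    fun s => by
      rw [← NNReal.coe_le_coe, coe_nnnorm, Real.norm_of_nonneg (hd0 s)]
      exact hd1 s
  have hlip' : ∀ a b, ‖G a - G b‖ ≤ ‖a - b‖ := fun a b => by
    simpa [dist_eq_norm] using hlip.dist_le_mul a b
  have habs : ∀ a b, |deriv G a - deriv G b| ≤ 1 := fun a b => by
    rw [abs_le]
    constructor <;> linarith [hd0 a, hd0 b, hd1 a, hd1 b]
  have hmω := hv.aestronglyMeasurable
  have hLω := hv.memLp_coframe hψ
  have hgv : AEStronglyMeasurable (fun x => deriv G (v x))
      ((vol n ψ).restrict (Metric.ball 0 R)) := hgc.comp_aestronglyMeasurable hv.memLp.1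
  refine of_approx hψ (ζ := fun k x => G (ζ k x)) ?_ (hgv.smul hmω) ?_ (fun k => ?_) ?_ ?_
  · refine hv.memLp.of_le (hG.continuous.comp_aestronglyMeasurable hv.memLp.1)
      (Eventually.of_forall fun x => ?_)
    simpa [hG0] using hlip' (v x) 0
  · refine (eLpNorm_mono fun x => ?_).trans_lt hLω.2
    rw [map_smul, norm_smul, Real.norm_of_nonneg (hd0 _)]
    exact mul_le_of_le_one_left (norm_nonneg _) (hd1 _)
  · have hsub : tsupport (fun x => G (ζ k x)) ⊆ tsupport (ζ k) :=
      closure_mono fun x hx h0 => hx (by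
        have : ζ k x = 0 := by simpa using h0
        simp [this, hG0])
    exact ⟨hG.comp (hζ k).1, HasCompactSupport.comp_left (hζ k).2.1 hG0,
      hsub.trans (hζ k).2.2⟩
  · have hdom : Tendsto (fun k => eLpNorm
        (fun x => (deriv G (ζ k x) - deriv G (v x)) • coframe ψ x (ω x)) 2
        ((vol n ψ).restrict (Metric.ball 0 R))) atTop (𝓝 0) := by
      refine tendsto_eLpNorm_two_of_dominated (fun k => ?_) hLω (fun k => ?_) ?_
      · exact ((hgc.comp (hζ k).1.continuous).aestronglyMeasurable.sub hgv).smul hLω.1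
      · refine Eventually.of_forall fun x => ?_
        rw [norm_smul]
        exact mul_le_of_le_one_left (norm_nonneg _) (habs _ _)
      · filter_upwards [hae] with x hx
        have h3 : Tendsto (fun k => deriv G (ζ k x) - deriv G (v x)) atTop (𝓝 0) := by
          have := ((hgc.tendsto (v x)).comp hx).sub_const (deriv G (v x))
          simpa [Function.comp_def] using this
        simpa using h3.smul_const (coframe ψ x (ω x))
    have hlim := h1.add hdom
    rw [add_zero] at hlim
    refine tendsto_of_tendsto_of_tendsto_of_le_of_le tendsto_const_nhds hlim (fun _ => zero_le)
      fun k => ?_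
    have hmk : AEStronglyMeasurable (fun x => coframe ψ x (gradient (ζ k) x - ω x))
        ((vol n ψ).restrict (Metric.ball 0 R)) := aestronglyMeasurable_coframe hψ
      ((continuous_gradient (hζ k).1).aestronglyMeasurable.sub hmω)
    have hle : eLpNorm (fun x => deriv G (ζ k x) • coframe ψ x (gradient (ζ k) x - ω x)) 2
        ((vol n ψ).restrict (Metric.ball 0 R)) ≤
        gradNorm ψ (Metric.ball 0 R) (fun x => gradient (ζ k) x - ω x) := by
      refine eLpNorm_mono fun x => ?_
      rw [norm_smul, Real.norm_of_nonneg (hd0 _)]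
      exact mul_le_of_le_one_left (norm_nonneg _) (hd1 _)
    refine le_trans ?_ ((eLpNorm_add_le
      ((hgc.comp (hζ k).1.continuous).aestronglyMeasurable.smul hmk)
      (((hgc.comp (hζ k).1.continuous).aestronglyMeasurable.sub hgv).smul hLω.1)
      (by norm_num)).trans (add_le_add hle le_rfl))
    refine le_of_eq (eLpNorm_congr_ae (Eventually.of_forall fun x => ?_))
    have hg : gradient (fun y => G (ζ k y)) x = deriv G (ζ k x) • gradient (ζ k) x := by
      have hd := (hG.differentiable (by simp) (ζ k x)).hasDerivAt.comp_hasFDerivAt x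
        ((hζ k).1.differentiable (by simp) x).hasFDerivAt
      simp only [gradient]
      rw [show (fun y => G (ζ k y)) = G ∘ ζ k from rfl, hd.fderiv, map_smul]
    simp only [Pi.add_apply, Pi.smul_apply', Pi.sub_apply, Function.comp_apply, hg,
      ← map_smul, ← map_add]
    congr 1
    module
  · refine tendsto_of_tendsto_of_tendsto_of_le_of_le tendsto_const_nhds h2 (fun _ => zero_le)
      fun k => ?_
    exact eLpNorm_mono fun x => hlip' _ _

end MemH10

end Sobolev

/-! ### Passage between `H¹₀(B_R)` and `Ḣ¹`, and the Poincaré inequality -/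

section Extension

variable {n : ℕ} {ψ : ℝ → ℝ} {R : ℝ} {v W : E n → ℝ} {ω ω' : E n → E n}

theorem gradNorm_univ_indicator (ω : E n → E n) :
    gradNorm ψ Set.univ ((Metric.ball 0 R).indicator ω) = gradNorm ψ (Metric.ball 0 R) ω := by
  rw [gradNorm, gradNorm, Measure.restrict_univ,
    ← eLpNorm_indicator_eq_eLpNorm_restrict Metric.isOpen_ball.measurableSet]
  congr 1
  funext x
  by_cases hx : x ∈ Metric.ball (0 : E n) R
  · simp only [Set.indicator_of_mem hx]
  · simp only [Set.indicator_of_notMem hx, map_zero]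

theorem MemH10.memDotH1_zeroExtend [Nontrivial (E n)] (hψ : IsModelFunction ψ)
    (hv : MemH10 ψ R v ω) :
    MemDotH1 ψ (zeroExtend R v) ((Metric.ball 0 R).indicator ω) := by
  obtain ⟨C, hC, e1, -, e3, -⟩ := exists_norm_equiv (n := n) hψ R
  obtain ⟨ζ, hζ, h1, h2⟩ := hv.approx
  rw [tendsto_energy_iff hψ] at h1
  have hB : MeasurableSet (Metric.ball (0 : E n) R) := Metric.isOpen_ball.measurableSet
  have hdiff : ∀ k, (fun x => ζ k x - zeroExtend R v x) =
      (Metric.ball 0 R).indicator (fun x => ζ k x - v x) := fun k => by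
    funext x
    by_cases hx : x ∈ Metric.ball (0 : E n) R
    · simp only [zeroExtend, Set.indicator_of_mem hx]
    · rw [zeroExtend, Set.indicator_of_notMem hx, Set.indicator_of_notMem hx,
        image_eq_zero_of_notMem_tsupport (fun h => hx ((hζ k).2.2 h)), sub_zero]
  have hdiffg : ∀ k, (fun x => gradient (ζ k) x - (Metric.ball 0 R).indicator ω x) =
      (Metric.ball 0 R).indicator (fun x => gradient (ζ k) x - ω x) := fun k => by
    funext x
    by_cases hx : x ∈ Metric.ball (0 : E n) R
    · simp only [Set.indicator_of_mem hx]
    · rw [Set.indicator_of_notMem hx, Set.indicator_of_notMem hx,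
        gradient_eq_zero_of_notMem_tsupport (fun h => hx ((hζ k).2.2 h)), sub_zero]
  have hle : ∀ {F : Type} [NormedAddCommGroup F] (ν : Measure (E n)) (f : E n → F) (A : Set (E n)),
      eLpNorm ((Metric.ball 0 R).indicator f) 2 (ν.restrict A) ≤
        eLpNorm f 2 (ν.restrict (Metric.ball 0 R)) := fun ν f A => by
    rw [← eLpNorm_indicator_eq_eLpNorm_restrict hB]
    exact eLpNorm_mono_measure _ Measure.restrict_le_self
  have hv' : MemLp v 2 (volume.restrict (Metric.ball 0 R)) :=
    ⟨aestronglyMeasurable_restrict_volume hψ hv.memLp.1,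
      (e1 v).trans_lt (ENNReal.mul_lt_top hC.lt_top hv.memLp.2)⟩
  have hω' : MemLp ω 2 (volume.restrict (Metric.ball 0 R)) :=
    ⟨aestronglyMeasurable_restrict_volume hψ hv.aestronglyMeasurable,
      (e3 ω).trans_lt (ENNReal.mul_lt_top hC.lt_top (hv.gradNorm_lt_top hψ))⟩
  refine ⟨fun r _ => ?_, ?_, ?_, ζ, fun k => ⟨(hζ k).1, (hζ k).2.1⟩, ?_, fun r _ => ?_⟩
  · exact ((memLp_indicator_iff_restrict hB).2 hv.memLp).mono_measure Measure.restrict_le_self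
  · refine hasWeakDifferentialOn_of_tendsto isOpen_univ (fun r => ?_) (fun r => ?_)
      (fun k => (hζ k).1) (fun r => ?_) (fun r => ?_)
    · exact ((memLp_indicator_iff_restrict hB).2 hv').mono_measure Measure.restrict_le_self
    · exact ((memLp_indicator_iff_restrict hB).2 hω').mono_measure Measure.restrict_le_self
    · simp only [hdiff]
      exact tendsto_zero_of_le_const_mul hC h2 fun k => (hle _ _ _).trans (e1 _)
    · simp only [hdiffg]
      exact tendsto_zero_of_le_const_mul hC h1 fun k => (hle _ _ _).trans (e3 _)
  · rw [energy_lt_top_iff hψ, gradNorm_univ_indicator]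
    exact hv.gradNorm_lt_top hψ
  · rw [tendsto_energy_iff hψ]
    simp only [hdiffg, gradNorm_univ_indicator]
    exact h1
  · simp only [hdiff]
    exact tendsto_of_tendsto_of_tendsto_of_le_of_le tendsto_const_nhds h2 (fun _ => zero_le)
      fun k => hle _ _ _

theorem HasWeakDifferentialOn.mono {Ω Ω' : Set (E n)} (h : HasWeakDifferentialOn Ω' v ω)
    (hΩ' : MeasurableSet Ω') (hsub : Ω ⊆ Ω') :
    HasWeakDifferentialOn Ω v ω := by
  refine ⟨h.1.mono_set hsub, h.2.1.mono_set hsub, fun η hη hc hs e => ?_⟩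
  have h0 := h.2.2 η hη hc (hs.trans hsub) e
  have e1 : ∀ f : E n → ℝ, (∀ x, x ∉ tsupport η → f x = 0) → ∫ x in Ω', f x = ∫ x in Ω, f x :=
    fun f hf => setIntegral_eq_of_subset_of_forall_sdiff_eq_zero hΩ' hsub
      fun x hx => hf x fun h => hx.2 (hs h)
  rw [e1, e1] at h0
  · exact h0
  · intro x hx
    simp [image_eq_zero_of_notMem_tsupport hx]
  · intro x hx
    have : fderiv ℝ η x e = 0 := by
      by_contra h
      exact hx (tsupport_fderiv_apply_subset η e h)
    simp [this]

/-- The weak differential vanishes on open sets where the function vanishes. -/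
theorem HasWeakDifferentialOn.ae_eq_zero {U : Set (E n)} (hU : IsOpen U)
    (h : HasWeakDifferentialOn U v ω) (h0 : ∀ x ∈ U, v x = 0) :
    ∀ᵐ x, x ∈ U → ω x = 0 := by
  refine hU.ae_eq_zero_of_integral_contDiff_smul_eq_zero h.2.1 fun η hη hc hs => ?_
  have hint : Integrable (fun x => η x • ω x) := by
    have hloc : IntegrableOn ω (tsupport η) :=
      h.2.1.integrableOn_compact_subset hs hc
    have h2 := hloc.continuousOn_smul (K := tsupport η) hη.continuous.continuousOn hc
    refine (integrableOn_iff_integrable_of_support_subset ?_).1 h2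
    intro x hx
    by_contra hxs
    exact hx (by simp [image_eq_zero_of_notMem_tsupport hxs])
  refine ext_inner_right ℝ fun e => ?_
  rw [inner_zero_left, real_inner_comm, ← integral_inner hint]
  have h1 := h.2.2 η hη hc hs e
  rw [setIntegral_congr_fun hU.measurableSet (g := fun _ => (0 : ℝ))
    (fun x hx => by simp [h0 x hx])] at h1
  rw [integral_zero] at h1
  have h3 : ∫ x in U, inner ℝ (ω x) e * η x = ∫ x, inner ℝ e (η x • ω x) := by
    rw [← setIntegral_univ (f := fun x => inner ℝ e (η x • ω x)),
      setIntegral_eq_of_subset_of_forall_sdiff_eq_zero MeasurableSet.univ (Set.subset_univ U)]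
    · refine setIntegral_congr_fun hU.measurableSet fun x _ => ?_
      simp only [inner_smul_right, real_inner_comm e]
      ring
    · intro x hx
      simp [image_eq_zero_of_notMem_tsupport fun h => hx.2 (hs h)]
  rw [← h3]
  linarith

/-- A function in `Ḣ¹` that vanishes outside a strictly smaller ball belongs to `H¹₀(B_R)`: its
approximations can be cut off. -/
theorem MemDotH1.memH10 [Nontrivial (E n)] (hψ : IsModelFunction ψ) (hW : MemDotH1 ψ W ω')
    {R' : ℝ} (hR' : 0 < R') (hR : R' < R) (h0 : ∀ x, x ∉ Metric.ball (0 : E n) R' → W x = 0) :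
    MemH10 ψ R W ω' := by
  obtain ⟨ζ, hζ, h1, h2⟩ := hW.approx
  rw [tendsto_energy_iff hψ] at h1
  have hB : MeasurableSet (Metric.ball (0 : E n) R) := Metric.isOpen_ball.measurableSet
  have hRpos : 0 < R := hR'.trans hR
  let χ : ContDiffBump (0 : E n) :=
    ⟨(2 * R' + R) / 3, (R' + 2 * R) / 3, by linarith, by linarith⟩
  have hχ : ContDiff ℝ (⊤ : ℕ∞) χ := χ.contDiff
  have hχs : tsupport χ ⊆ Metric.ball 0 R := by
    rw [χ.tsupport_eq]
    exact Metric.closedBall_subset_ball (by change (R' + 2 * R) / 3 < R; linarith)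
  have hχ1 : ∀ x ∈ Metric.ball (0 : E n) ((2 * R' + R) / 3), χ x = 1 := fun x hx =>
    χ.one_of_mem_closedBall (Metric.ball_subset_closedBall hx)
  have hχle : ∀ x, ‖χ x‖ ≤ 1 := fun x => by
    rw [Real.norm_of_nonneg χ.nonneg]; exact χ.le_one
  have hω0 : ∀ᵐ x, x ∈ (Metric.closedBall (0 : E n) R')ᶜ → ω' x = 0 := by
    have hU : IsOpen (Metric.closedBall (0 : E n) R')ᶜ := Metric.isClosed_closedBall.isOpen_compl
    refine (hW.weakDifferential.mono MeasurableSet.univ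
      (Set.subset_univ _)).ae_eq_zero hU fun x hx => h0 x fun h => hx ?_
    exact Metric.ball_subset_closedBall h
  have hmω : AEStronglyMeasurable ω' ((vol n ψ).restrict (Metric.ball 0 R)) :=
    aestronglyMeasurable_restrict_vol
      (hW.weakDifferential.mono MeasurableSet.univ (Set.subset_univ _)).2.1.aestronglyMeasurable
  have hgm : ∀ ω : E n → E n, gradNorm ψ (Metric.ball 0 R) ω ≤ gradNorm ψ Set.univ ω := fun ω =>
    eLpNorm_mono_measure _ (Measure.restrict_mono (Set.subset_univ _) le_rfl)
  have hWm := hW.memLp_loc R hRpos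
  obtain ⟨D, hD⟩ := (isCompact_closedBall (0 : E n) R).exists_bound_of_continuousOn
    (continuous_gradient hχ).continuousOn
  refine MemH10.of_approx hψ hWm hmω
    ((hgm _).trans_lt ((energy_lt_top_iff hψ).1 hW.energy_lt_top))
    (ζ := fun k x => χ x * ζ k x) (fun k => ?_) ?_ ?_
  · refine ⟨hχ.mul (hζ k).1, χ.hasCompactSupport.mul_right, ?_⟩
    exact (closure_mono (Function.support_mul_subset_left _ _)).trans hχs
  · -- `∇(χ ζ) - ∇W = χ (∇ζ - ∇W) + (ζ - W) ∇χ`, since `χ = 1` near the support of `W`.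
    obtain ⟨B, hB0, hB1⟩ := exists_coframe_bounds (n := n) hψ R
    have hlim := (h1).add (ENNReal.Tendsto.const_mul (a := ENNReal.ofReal (B * D))
      (h2 R hRpos) (Or.inr ENNReal.ofReal_ne_top))
    rw [mul_zero, add_zero] at hlim
    refine tendsto_of_tendsto_of_tendsto_of_le_of_le tendsto_const_nhds hlim (fun _ => zero_le)
      fun k => ?_
    have m1 : AEStronglyMeasurable (fun x => coframe ψ x (χ x • (gradient (ζ k) x - ω' x)))
        ((vol n ψ).restrict (Metric.ball 0 R)) := aestronglyMeasurable_coframe hψ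
      (hχ.continuous.aestronglyMeasurable.smul
        ((continuous_gradient (hζ k).1).aestronglyMeasurable.sub hmω))
    have m2 : AEStronglyMeasurable (fun x => coframe ψ x ((ζ k x - W x) • gradient χ x))
        ((vol n ψ).restrict (Metric.ball 0 R)) := aestronglyMeasurable_coframe hψ
      (((hζ k).1.continuous.aestronglyMeasurable.sub hWm.1).smul
        (continuous_gradient hχ).aestronglyMeasurable)
    have l1 : eLpNorm (fun x => coframe ψ x (χ x • (gradient (ζ k) x - ω' x))) 2
        ((vol n ψ).restrict (Metric.ball 0 R)) ≤
        gradNorm ψ Set.univ (fun x => gradient (ζ k) x - ω' x) := by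
      refine le_trans (eLpNorm_mono fun x => ?_) (hgm _)
      rw [map_smul, norm_smul]
      exact mul_le_of_le_one_left (norm_nonneg _) (hχle x)
    have l2 : eLpNorm (fun x => coframe ψ x ((ζ k x - W x) • gradient χ x)) 2
        ((vol n ψ).restrict (Metric.ball 0 R)) ≤
        ENNReal.ofReal (B * D) * eLpNorm (fun x => ζ k x - W x) 2
          ((vol n ψ).restrict (Metric.ball 0 R)) := by
      refine eLpNorm_le_mul_eLpNorm_of_ae_le_mul ?_ 2
      filter_upwards [ae_restrict_mem hB] with x hx
      rw [map_smul, norm_smul, mul_comm]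
      gcongr
      exact ((hB1 x hx _).1).trans (by gcongr; exact hD x (Metric.ball_subset_closedBall hx))
    refine le_trans (le_of_eq ?_) ((eLpNorm_add_le m1 m2 (by norm_num)).trans (add_le_add l1 l2))
    refine eLpNorm_congr_ae ?_
    filter_upwards [ae_restrict_of_ae (vol_absolutelyContinuous.ae_le hω0)] with x hx
    have hg : gradient (fun y => χ y * ζ k y) x =
        χ x • gradient (ζ k) x + ζ k x • gradient χ x := by
      simp only [gradient]
      rw [fderiv_fun_mul (hχ.differentiable (by simp)).differentiableAt
        ((hζ k).1.differentiable (by simp)).differentiableAt, map_add, map_smul, map_smul]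
    simp only [Pi.add_apply, hg, ← map_add]
    congr 1
    by_cases hxR : x ∈ Metric.ball (0 : E n) ((2 * R' + R) / 3)
    · have hg0 : gradient χ x = 0 := by
        have : (χ : E n → ℝ) =ᶠ[𝓝 x] fun _ => 1 := by
          filter_upwards [Metric.isOpen_ball.mem_nhds hxR] with y hy using hχ1 y hy
        rw [this.gradient_eq]
        exact gradient_fun_const x _
      rw [hg0, hχ1 x hxR]
      simp
    · have hxR' : x ∉ Metric.closedBall (0 : E n) R' := fun h => hxR
        (Metric.closedBall_subset_ball (by linarith) h)
      rw [hx hxR', h0 x fun h => hxR' (Metric.ball_subset_closedBall h)]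
      simp
  · refine tendsto_of_tendsto_of_tendsto_of_le_of_le tendsto_const_nhds (h2 R hRpos)
      (fun _ => zero_le) fun k => eLpNorm_mono fun x => ?_
    by_cases hxR : x ∈ Metric.ball (0 : E n) ((2 * R' + R) / 3)
    · rw [hχ1 x hxR, one_mul]
    · have hxR' : x ∉ Metric.ball (0 : E n) R' := fun h => hxR
        (Metric.ball_subset_ball (by linarith) h)
      rw [h0 x hxR', sub_zero, sub_zero, norm_mul]
      exact mul_le_of_le_one_left (norm_nonneg _) (hχle x)

theorem integral_sq_le_of_tsupport_subset [Nontrivial (E n)] {ζ : E n → ℝ}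
    (hζ : ContDiff ℝ (⊤ : ℕ∞) ζ) (hc : HasCompactSupport ζ)
    (hs : tsupport ζ ⊆ Metric.ball 0 R) :
    ∫ x, ζ x ^ 2 ≤ 4 * R ^ 2 * ∫ x, ‖gradient ζ x‖ ^ 2 := by
  obtain ⟨e, he⟩ := exists_norm_eq (E n) (c := 1) zero_le_one
  -- Integrate `∂ₑ(ζ²)` by parts against the coordinate `⟨x, e⟩`, which is bounded by `R`.
  have hlin : ContDiff ℝ (⊤ : ℕ∞) (fun x : E n => (inner ℝ e x : ℝ)) :=
    (innerSL ℝ e).contDiff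
  have hc2 : HasCompactSupport (fun x => ζ x ^ 2) :=
    HasCompactSupport.intro' hc (isClosed_tsupport ζ) fun x hx => by
      simp [image_eq_zero_of_notMem_tsupport hx]
  have h1 := integral_mul_fderiv_of_smooth (η := fun x => ζ x ^ 2) hlin (hζ.pow 2) hc2 e
  have hd1 : ∀ x, fderiv ℝ (fun x : E n => (inner ℝ e x : ℝ)) x e = 1 := fun x => by
    have : (fun x : E n => (inner ℝ e x : ℝ)) = innerSL ℝ e := rfl
    rw [this, ContinuousLinearMap.fderiv, innerSL_apply_apply, real_inner_self_eq_norm_sq, he]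
    norm_num
  have hd2 : ∀ x, fderiv ℝ (fun x => ζ x ^ 2) x e = 2 * ζ x * inner ℝ (gradient ζ x) e :=
    fun x => by
      rw [inner_gradient, fderiv_fun_pow _ (hζ.differentiable (by simp)).differentiableAt]
      simp
  simp only [hd1, hd2, one_mul] at h1
  have i1 : Integrable (fun x => ζ x ^ 2) :=
    (hζ.continuous.pow 2).integrable_of_hasCompactSupport hc2
  have i2 : Integrable (fun x => ‖gradient ζ x‖ ^ 2) := by
    refine Continuous.integrable_of_hasCompactSupport ?_ ?_
    · have := continuous_gradient hζ
      fun_prop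
    · exact HasCompactSupport.intro' hc (isClosed_tsupport ζ) fun x hx => by
        simp [gradient_eq_zero_of_notMem_tsupport hx]
  have i3 : Integrable (fun x => (inner ℝ e x : ℝ) * (2 * ζ x * inner ℝ (gradient ζ x) e)) := by
    refine Continuous.integrable_of_hasCompactSupport ?_ ?_
    · have := continuous_gradient hζ
      have := hζ.continuous
      fun_prop
    · exact HasCompactSupport.intro' hc (isClosed_tsupport ζ) fun x hx => by
        simp [image_eq_zero_of_notMem_tsupport hx]
  have h2 : ∫ x, ζ x ^ 2 ≤ ∫ x, (1 / 2 * ζ x ^ 2 + 2 * R ^ 2 * ‖gradient ζ x‖ ^ 2) := by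
    have h3 : ∫ x, ζ x ^ 2 = ∫ x, -((inner ℝ e x : ℝ) * (2 * ζ x * inner ℝ (gradient ζ x) e)) := by
      rw [integral_neg, h1, neg_neg]
    rw [h3]
    refine integral_mono i3.neg ((i1.const_mul _).add (i2.const_mul _)) fun x => ?_
    by_cases hx : x ∈ tsupport ζ
    · have hxR : ‖x‖ < R := mem_ball_zero_iff.1 (hs hx)
      have a1 : |(inner ℝ e x : ℝ)| ≤ R := by
        refine (abs_real_inner_le_norm e x).trans ?_
        rw [he, one_mul]; exact hxR.le
      have a2 : |(inner ℝ (gradient ζ x) e : ℝ)| ≤ ‖gradient ζ x‖ := by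
        refine (abs_real_inner_le_norm _ e).trans ?_
        rw [he, mul_one]
      set p := (inner ℝ e x : ℝ)
      set q := (inner ℝ (gradient ζ x) e : ℝ)
      have a3 : (p * q) ^ 2 ≤ R ^ 2 * ‖gradient ζ x‖ ^ 2 := by
        rw [mul_pow]
        have b1 : p ^ 2 ≤ R ^ 2 := sq_le_sq' (by linarith [neg_abs_le p]) ((le_abs_self p).trans a1)
        have b2 : q ^ 2 ≤ ‖gradient ζ x‖ ^ 2 :=
          sq_le_sq' (by linarith [neg_abs_le q]) ((le_abs_self q).trans a2)
        gcongr
      change -(p * (2 * ζ x * q)) ≤ _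
      nlinarith [sq_nonneg (ζ x + 2 * (p * q))]
    · simp [image_eq_zero_of_notMem_tsupport hx, gradient_eq_zero_of_notMem_tsupport hx]
  rw [integral_add (i1.const_mul _) (i2.const_mul _), integral_const_mul, integral_const_mul] at h2
  linarith

theorem eLpNorm_two_sq_eq_ofReal_integral {F : Type*} [NormedAddCommGroup F] {f : E n → F}
    (hf : Continuous f) (hc : HasCompactSupport f) :
    eLpNorm f 2 volume ^ 2 = ENNReal.ofReal (∫ x, ‖f x‖ ^ 2) := by
  have := eLpNorm_nnreal_pow_eq_lintegral (f := f) (μ := (volume : Measure (E n))) (p := 2)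
    two_ne_zero
  simp only [NNReal.coe_ofNat, ENNReal.rpow_ofNat] at this
  refine Eq.trans this ?_
  have hcont : Continuous (fun x => ‖f x‖ ^ 2) := by fun_prop
  have hsupp : HasCompactSupport (fun x => ‖f x‖ ^ 2) :=
    HasCompactSupport.intro' hc (isClosed_tsupport f) fun x hx => by
      simp [image_eq_zero_of_notMem_tsupport hx]
  rw [ofReal_integral_eq_lintegral_ofReal (hcont.integrable_of_hasCompactSupport hsupp)
    (Eventually.of_forall fun x => by positivity)]
  exact lintegral_congr fun x => by rw [ENNReal.ofReal_pow (norm_nonneg _), ofReal_norm]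

/-- Poincaré inequality on `H¹₀(B_R)`. -/
theorem exists_poincare [Nontrivial (E n)] (hψ : IsModelFunction ψ) (hR : 0 < R) :
    ∃ C : ℝ≥0∞, C ≠ ∞ ∧ ∀ (v : E n → ℝ) (ω : E n → E n), MemH10 ψ R v ω →
      eLpNorm v 2 ((vol n ψ).restrict (Metric.ball 0 R)) ≤ C * gradNorm ψ (Metric.ball 0 R) ω := by
  obtain ⟨C, hC, -, e2, e3, -⟩ := exists_norm_equiv (n := n) hψ R
  have hB : MeasurableSet (Metric.ball (0 : E n) R) := Metric.isOpen_ball.measurableSet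
  set D := C * (ENNReal.ofReal (2 * R) * C)
  have hDtop : D ≠ ∞ := ENNReal.mul_ne_top hC (ENNReal.mul_ne_top ENNReal.ofReal_ne_top hC)
  have hsm : ∀ ζ : E n → ℝ, ContDiff ℝ (⊤ : ℕ∞) ζ → HasCompactSupport ζ →
      tsupport ζ ⊆ Metric.ball 0 R → eLpNorm ζ 2 ((vol n ψ).restrict (Metric.ball 0 R)) ≤
        D * gradNorm ψ (Metric.ball 0 R) (gradient ζ) := by
    intro ζ hζ hc hs
    have hgc : HasCompactSupport (gradient ζ) :=
      HasCompactSupport.intro' hc (isClosed_tsupport ζ) fun x hx =>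
        gradient_eq_zero_of_notMem_tsupport hx
    have h1 : eLpNorm ζ 2 volume ≤ ENNReal.ofReal (2 * R) * eLpNorm (gradient ζ) 2 volume := by
      refine (ENNReal.pow_le_pow_left_iff two_ne_zero).1 ?_
      rw [mul_pow, eLpNorm_two_sq_eq_ofReal_integral hζ.continuous hc,
        eLpNorm_two_sq_eq_ofReal_integral (continuous_gradient hζ) hgc,
        ← ENNReal.ofReal_pow (by positivity), ← ENNReal.ofReal_mul (by positivity)]
      refine ENNReal.ofReal_le_ofReal ?_
      have := integral_sq_le_of_tsupport_subset hζ hc hs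
      simp only [Real.norm_eq_abs, sq_abs]
      calc _ ≤ _ := this
        _ = _ := by ring
    have h2 : eLpNorm (gradient ζ) 2 volume =
        eLpNorm (gradient ζ) 2 (volume.restrict (Metric.ball 0 R)) := by
      rw [← eLpNorm_indicator_eq_eLpNorm_restrict hB, Set.indicator_eq_self.2]
      intro x hx
      by_contra h
      exact hx (gradient_eq_zero_of_notMem_tsupport fun h' => h (hs h'))
    calc _ ≤ C * eLpNorm ζ 2 (volume.restrict (Metric.ball 0 R)) := e2 ζ
      _ ≤ C * eLpNorm ζ 2 volume := by gcongr; exact Measure.restrict_le_self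
      _ ≤ C * (ENNReal.ofReal (2 * R) * (C * gradNorm ψ (Metric.ball 0 R) (gradient ζ))) := by
          gcongr
          refine h1.trans ?_
          rw [h2]
          gcongr
          exact e3 _
      _ = _ := by simp only [D]; ring
  refine ⟨D, hDtop, fun v ω hv => ?_⟩
  obtain ⟨ζ, hζ, h1, h2⟩ := hv.approx
  rw [tendsto_energy_iff hψ] at h1
  have hlim := h2.add (ENNReal.Tendsto.const_mul (a := D)
    (h1.add_const (gradNorm ψ (Metric.ball 0 R) ω)) (Or.inr hDtop))
  rw [zero_add, zero_add] at hlim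
  refine ge_of_tendsto' hlim fun k => ?_
  have hm := hv.aestronglyMeasurable
  have hmζ : AEStronglyMeasurable (ζ k) ((vol n ψ).restrict (Metric.ball 0 R)) :=
    (hζ k).1.continuous.aestronglyMeasurable
  have a1 : eLpNorm v 2 ((vol n ψ).restrict (Metric.ball 0 R)) ≤
      eLpNorm (fun x => ζ k x - v x) 2 ((vol n ψ).restrict (Metric.ball 0 R)) +
        eLpNorm (ζ k) 2 ((vol n ψ).restrict (Metric.ball 0 R)) := by
    have := eLpNorm_sub_le hmζ (hmζ.sub hv.memLp.1) (p := 2) (by norm_num)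
    rw [sub_sub_cancel, add_comm] at this
    exact this
  have a2 : gradNorm ψ (Metric.ball 0 R) (gradient (ζ k)) ≤
      gradNorm ψ (Metric.ball 0 R) (fun x => gradient (ζ k) x - ω x) +
        gradNorm ψ (Metric.ball 0 R) ω := by
    refine le_trans (le_of_eq ?_) (eLpNorm_add_le (aestronglyMeasurable_coframe hψ
      ((continuous_gradient (hζ k).1).aestronglyMeasurable.sub hm))
      (hv.memLp_coframe hψ).1 (by norm_num))
    refine eLpNorm_congr_ae (Eventually.of_forall fun x => ?_)
    simp only [Pi.add_apply, ← map_add, sub_add_cancel]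
  refine a1.trans ?_
  gcongr
  exact (hsm _ (hζ k).1 (hζ k).2.1 (hζ k).2.2).trans (by gcongr)

end Extension

/-! ### Radial test fields -/

section Radial

variable {n : ℕ} {ψ : ℝ → ℝ}

theorem contDiff_comp_norm {q : ℝ → ℝ} (hq : ContDiff ℝ (⊤ : ℕ∞) q) {r₀ c : ℝ} (hr₀ : 0 < r₀)
    (h0 : ∀ r, r ≤ r₀ → q r = c) : ContDiff ℝ (⊤ : ℕ∞) (fun x : E n => q ‖x‖) := by
  rw [contDiff_iff_contDiffAt]
  intro x
  by_cases hx : x = 0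
  · refine (contDiffAt_const (c := c)).congr_of_eventuallyEq ?_
    filter_upwards [Metric.isOpen_ball.mem_nhds
      (show x ∈ Metric.ball (0 : E n) r₀ by simpa [hx] using hr₀)] with y hy
    exact h0 _ (mem_ball_zero_iff.1 hy).le
  · exact hq.contDiffAt.comp x (contDiffAt_norm ℝ hx)

theorem fderiv_comp_norm {q : ℝ → ℝ} (hq : Differentiable ℝ q) {x : E n} (hx : x ≠ 0) (e : E n) :
    fderiv ℝ (fun x : E n => q ‖x‖) x e = deriv q ‖x‖ * inner ℝ (radialDir x) e := by
  have h1 : HasFDerivAt (fun x : E n => ‖x‖) (innerSL ℝ (radialDir x)) x := by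
    have hd : DifferentiableAt ℝ (fun x : E n => ‖x‖) x :=
      (contDiffAt_norm ℝ hx (n := 1)).differentiableAt (by simp)
    have h2 := (hasStrictFDerivAt_norm_sq x).hasFDerivAt
    have h3 := hd.hasFDerivAt.pow 2
    have h4 := h3.unique h2
    have hx0 : ‖x‖ ≠ 0 := norm_ne_zero_iff.2 hx
    have h6 : fderiv ℝ (fun x : E n => ‖x‖) x = innerSL ℝ (radialDir x) := by
      refine ContinuousLinearMap.ext fun y => ?_
      have h5 := congrArg (fun L : E n →L[ℝ] ℝ => L y) h4
      simp only [radialDir, innerSL_apply_apply, inner_smul_left, conj_trivial] at h5 ⊢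
      simp at h5
      field_simp
      linarith
    rw [← h6]
    exact hd.hasFDerivAt
  have h2 := (hq ‖x‖).hasDerivAt.comp_hasFDerivAt x h1
  have h3 : fderiv ℝ (fun x : E n => q ‖x‖) x = deriv q ‖x‖ • innerSL ℝ (radialDir x) := h2.fderiv
  rw [h3]
  simp

theorem gradient_comp_norm {q : ℝ → ℝ} (hq : Differentiable ℝ q) {x : E n} (hx : x ≠ 0) :
    gradient (fun x : E n => q ‖x‖) x = deriv q ‖x‖ • radialDir x := by
  refine ext_inner_right ℝ fun e => ?_
  rw [inner_gradient, fderiv_comp_norm hq hx, inner_smul_left]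
  simp

theorem integrableOn_mul_of_tsupport {F : Type*} [NormedAddCommGroup F] [NormedSpace ℝ F]
    {Ω : Set (E n)} {f : E n → F}
    (hf : LocallyIntegrableOn f Ω) {g : E n → ℝ} (hg : Continuous g) {K : Set (E n)}
    (hK : IsCompact K) (hKΩ : K ⊆ Ω) (h0 : ∀ x, x ∉ K → g x = 0) :
    Integrable (fun x => g x • f x) (volume.restrict Ω) := by
  have h2 := (hf.integrableOn_compact_subset hKΩ hK).continuousOn_smul hg.continuousOn hK
  refine ((integrableOn_iff_integrable_of_support_subset ?_).1 h2).integrableOn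
  intro x hx
  by_contra hxs
  exact hx (by simp [h0 x hxs])

/-- The weak differential tested against the radial vector field `p(r) r^{1-n} θ`, whose Euclidean
divergence is `p'(r) r^{1-n}`. -/
theorem HasWeakDifferentialOn.integral_radial [Nontrivial (E n)] {Ω : Set (E n)} {W : E n → ℝ}
    {ω : E n → E n} (h : HasWeakDifferentialOn Ω W ω) {p : ℝ → ℝ} (hp : ContDiff ℝ (⊤ : ℕ∞) p)
    {r₀ r₁ : ℝ} (hr₀ : 0 < r₀) (hp0 : ∀ r, r ≤ r₀ → p r = 0) (hp1 : ∀ r, r₁ ≤ r → p r = 0)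
    (hΩ : Metric.closedBall 0 r₁ ⊆ Ω) :
    ∫ x in Ω, W x * (deriv p ‖x‖ / ‖x‖ ^ (n - 1)) =
      - ∫ x in Ω, inner ℝ (ω x) (radialDir x) * (p ‖x‖ / ‖x‖ ^ (n - 1)) := by
  have hn : n ≠ 0 := by
    rintro rfl
    exact not_subsingleton (E 0) inferInstance
  set P : ℝ → ℝ := fun r => p r / r ^ n with hP
  have hPsm : ContDiff ℝ (⊤ : ℕ∞) P := by
    rw [contDiff_iff_contDiffAt]
    intro r
    rcases lt_or_ge 0 r with hr | hr
    · exact hp.contDiffAt.div (contDiffAt_id.pow n) (pow_ne_zero _ hr.ne')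
    · refine (contDiffAt_const (c := (0 : ℝ))).congr_of_eventuallyEq ?_
      filter_upwards [Iio_mem_nhds (hr.trans_lt hr₀)] with s hs
      simp [hP, hp0 s (le_of_lt hs)]
  have hP0 : ∀ r, r ≤ r₀ → P r = 0 := fun r hr => by simp [hP, hp0 r hr]
  have hP1 : ∀ r, r₁ ≤ r → P r = 0 := fun r hr => by simp [hP, hp1 r hr]
  have hPn : ContDiff ℝ (⊤ : ℕ∞) (fun x : E n => P ‖x‖) := contDiff_comp_norm hPsm hr₀ hP0
  set X : Fin n → E n → ℝ := fun i x => P ‖x‖ * x i with hX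
  set e : Fin n → E n := fun i => EuclideanSpace.single i 1 with he
  have hcoord : ∀ i, ContDiff ℝ (⊤ : ℕ∞) (fun x : E n => x i) := fun i =>
    (EuclideanSpace.proj (𝕜 := ℝ) i).contDiff
  have hXsm : ∀ i, ContDiff ℝ (⊤ : ℕ∞) (X i) := fun i => hPn.mul (hcoord i)
  have hK : IsCompact (Metric.closedBall (0 : E n) r₁) := isCompact_closedBall _ _
  have hX0 : ∀ i x, x ∉ Metric.closedBall (0 : E n) r₁ → X i x = 0 := fun i x hx => by
    have : r₁ ≤ ‖x‖ := by simpa using (not_le.1 (fun h => hx (mem_closedBall_zero_iff.2 h))).le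
    simp [hX, hP1 _ this]
  have hXc : ∀ i, HasCompactSupport (X i) := fun i =>
    HasCompactSupport.intro' hK Metric.isClosed_closedBall (hX0 i)
  have hXs : ∀ i, tsupport (X i) ⊆ Metric.closedBall 0 r₁ := fun i =>
    closure_minimal (fun x hx => by
      by_contra hxs
      exact hx (hX0 i x hxs)) Metric.isClosed_closedBall
  have hdX0 : ∀ i x, x ∉ Metric.closedBall (0 : E n) r₁ → fderiv ℝ (X i) x (e i) = 0 :=
    fun i x hx => by
      by_contra hne
      exact hx (hXs i (tsupport_fderiv_apply_subset (X i) (e i) hne))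
  have hcX : ∀ i, Continuous (fun x => fderiv ℝ (X i) x (e i)) := fun i =>
    ((hXsm i).continuous_fderiv (by simp)).clm_apply continuous_const
  have hdiv : ∀ x : E n, ∑ i, fderiv ℝ (X i) x (e i) = deriv p ‖x‖ / ‖x‖ ^ (n - 1) := by
    intro x
    by_cases hx : x = 0
    · have h1 : ∀ i, fderiv ℝ (X i) x (e i) = 0 := fun i => by
        have : X i =ᶠ[𝓝 x] fun _ => 0 := by
          filter_upwards [Metric.isOpen_ball.mem_nhds
            (show x ∈ Metric.ball (0 : E n) r₀ by simpa [hx] using hr₀)] with y hy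
          simp [hX, hP0 _ (mem_ball_zero_iff.1 hy).le]
        rw [this.fderiv_eq]
        simp
      have h2 : deriv p ‖x‖ = 0 := by
        have : p =ᶠ[𝓝 ‖x‖] fun _ => 0 := by
          filter_upwards [Iio_mem_nhds (show ‖x‖ < r₀ by simpa [hx] using hr₀)] with s hs
          exact hp0 s (le_of_lt hs)
        rw [this.deriv_eq]
        simp
      simp [h1, h2]
    · have hr : 0 < ‖x‖ := norm_pos_iff.2 hx
      have h1 : ∀ i, fderiv ℝ (X i) x (e i) =
          P ‖x‖ + deriv P ‖x‖ * ‖x‖⁻¹ * (x i) ^ 2 := fun i => by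
        have hc : fderiv ℝ (fun x : E n => x i) x (e i) = 1 := by
          have : (fun x : E n => x i) = EuclideanSpace.proj (𝕜 := ℝ) i := rfl
          rw [this, ContinuousLinearMap.fderiv]
          simp [he]
        have hin : inner ℝ (radialDir x) (e i) = ‖x‖⁻¹ * x i := by
          simp [he, radialDir, inner_smul_left, EuclideanSpace.inner_single_right]
        rw [hX, fderiv_fun_mul (hPn.differentiable (by simp)).differentiableAt
          ((hcoord i).differentiable (by simp)).differentiableAt]
        simp only [add_apply, smul_apply, smul_eq_mul, hc,
          fderiv_comp_norm (hPsm.differentiable (by simp)) hx, hin]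
        ring
      have h2 : ∑ i, (x i) ^ 2 = ‖x‖ ^ 2 := by
        rw [EuclideanSpace.norm_sq_eq]; simp
      have h3 : deriv P ‖x‖ = (deriv p ‖x‖ * ‖x‖ ^ n - p ‖x‖ * (n * ‖x‖ ^ (n - 1))) /
          (‖x‖ ^ n) ^ 2 := by
        have := ((hp.differentiable (by simp) ‖x‖).hasDerivAt.div (hasDerivAt_pow n ‖x‖)
          (pow_ne_zero _ hr.ne')).deriv
        exact this
      simp only [h1, Finset.sum_add_distrib, ← Finset.mul_sum, h2, h3]
      simp only [hP]
      obtain ⟨m, rfl⟩ := Nat.exists_eq_succ_of_ne_zero hn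
      simp only [Nat.succ_eq_add_one, Nat.add_sub_cancel, Finset.sum_const, Finset.card_univ,
        Fintype.card_fin, nsmul_eq_mul, pow_succ]
      push_cast
      field_simp
      ring
  have hdot : ∀ x : E n, ∑ i, inner ℝ (ω x) (e i) * X i x =
      inner ℝ (ω x) (radialDir x) * (p ‖x‖ / ‖x‖ ^ (n - 1)) := by
    intro x
    have h1 : ∑ i, inner ℝ (ω x) (e i) * X i x = P ‖x‖ * inner ℝ (ω x) x := by
      rw [PiLp.inner_apply, Finset.mul_sum]
      refine Finset.sum_congr rfl fun i _ => ?_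
      simp [he, hX, EuclideanSpace.inner_single_right]
      ring
    rw [h1, radialDir, inner_smul_right, hP]
    by_cases hx : x = 0
    · simp [hx]
    have hr : ‖x‖ ≠ 0 := norm_ne_zero_iff.2 hx
    obtain ⟨m, rfl⟩ := Nat.exists_eq_succ_of_ne_zero hn
    simp only [Nat.succ_eq_add_one, Nat.add_sub_cancel, pow_succ]
    field_simp
  simp only [← hdiv, ← hdot, Finset.mul_sum]
  rw [integral_finsetSum, integral_finsetSum, ← Finset.sum_neg_distrib]
  · exact Finset.sum_congr rfl fun i _ => h.2.2 (X i) (hXsm i) (hXc i) ((hXs i).trans hΩ) (e i)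
  · intro i _
    have hl : LocallyIntegrableOn (fun x => (inner ℝ (ω x) (e i) : ℝ)) Ω := fun x hx => by
      obtain ⟨t, ht, hti⟩ := h.2.1 x hx
      exact ⟨t, ht, hti.inner_const _⟩
    simpa [mul_comm] using integrableOn_mul_of_tsupport hl (hXsm i).continuous hK hΩ (hX0 i)
  · intro i _
    simpa [mul_comm] using integrableOn_mul_of_tsupport h.1 (hcX i) hK hΩ (hdX0 i)

end Radial

/-! ### Radial functions with finite energy -/

section RadialEnergy

variable {n : ℕ} {ψ : ℝ → ℝ}

/-- The area of the Euclidean unit sphere in dimension `n`. -/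
noncomputable def unitSphereArea (n : ℕ) : ℝ :=
  n * (volume : Measure (E n)).real (Metric.ball 0 1)

/-- The Riemannian area of the geodesic sphere of radius `r` about the pole. -/
noncomputable def sphereArea (n : ℕ) (ψ : ℝ → ℝ) (r : ℝ) : ℝ := unitSphereArea n * ψ r ^ (n - 1)

theorem pos_of_nontrivial [Nontrivial (E n)] : 0 < n := by
  rcases Nat.eq_zero_or_pos n with rfl | h
  · exact absurd ‹Nontrivial (E 0)› (not_nontrivial (E 0))
  · exact h

theorem unitSphereArea_pos [Nontrivial (E n)] : 0 < unitSphereArea n := by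
  have h1 : (0 : ℝ) < n := Nat.cast_pos.2 pos_of_nontrivial
  have h2 : 0 < (volume : Measure (E n)).real (Metric.ball 0 1) :=
    ENNReal.toReal_pos (Metric.measure_ball_pos _ _ one_pos).ne' measure_ball_lt_top.ne
  exact mul_pos h1 h2

theorem sphereArea_pos [Nontrivial (E n)] (hψ : IsModelFunction ψ) {r : ℝ} (hr : 0 < r) :
    0 < sphereArea n ψ r := mul_pos unitSphereArea_pos (pow_pos (hψ.pos r hr) _)

theorem integral_radial_div [Nontrivial (E n)] (f : ℝ → ℝ) :
    ∫ x : E n, f ‖x‖ / ‖x‖ ^ (n - 1) = unitSphereArea n * ∫ r in Set.Ioi (0 : ℝ), f r := by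
  rw [integral_fun_norm_addHaar volume (fun r => f r / r ^ (n - 1))]
  simp only [finrank_euclideanSpace, Fintype.card_fin, nsmul_eq_mul, smul_eq_mul, unitSphereArea,
    mul_assoc]
  congr 2
  refine setIntegral_congr_fun measurableSet_Ioi fun r hr => ?_
  have : r ≠ 0 := ne_of_gt hr
  field_simp

theorem setIntegral_vol (hψ : IsModelFunction ψ) {Ω : Set (E n)} (hΩ : MeasurableSet Ω)
    (g : E n → ℝ) :
    ∫ x in Ω, g x ∂(vol n ψ) = ∫ x in Ω, volDensity n ψ ‖x‖ * g x := by
  rw [vol_eq, restrict_withDensity hΩ, integral_withDensity_eq_integral_toReal_smul₀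
    (measurable_volDensity_norm hψ).ennreal_ofReal.aemeasurable (by simp)]
  refine integral_congr_ae (Eventually.of_forall fun x => ?_)
  simp only [smul_eq_mul]
  rw [ENNReal.toReal_ofReal (volDensity_nonneg hψ (norm_nonneg x))]

theorem contDiff_div_pow (hψ : IsModelFunction ψ) {p : ℝ → ℝ} (hp : ContDiff ℝ (⊤ : ℕ∞) p)
    {r₀ : ℝ} (hr₀ : 0 < r₀) (hp0 : ∀ r, r ≤ r₀ → p r = 0) (k : ℕ) :
    ContDiff ℝ (⊤ : ℕ∞) (fun r => p r / ψ r ^ k) := by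
  rw [contDiff_iff_contDiffAt]
  intro r
  rcases lt_or_ge 0 r with hr | hr
  · exact hp.contDiffAt.div ((hψ.smooth.contDiffAt (Ici_mem_nhds hr)).pow k)
      (pow_ne_zero _ (hψ.pos r hr).ne')
  · refine (contDiffAt_const (c := (0 : ℝ))).congr_of_eventuallyEq ?_
    filter_upwards [Iio_mem_nhds (hr.trans_lt hr₀)] with s hs
    simp [hp0 s (le_of_lt hs)]

theorem integral_radial_vol [Nontrivial (E n)] (hψ : IsModelFunction ψ) {Ω : Set (E n)}
    (hΩ : MeasurableSet Ω) (ω : E n → E n) (p : ℝ → ℝ) :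
    ∫ x in Ω, inner ℝ (ω x) (radialDir x) * (p ‖x‖ / ‖x‖ ^ (n - 1)) =
      ∫ x in Ω, inner ℝ (ω x) (radialDir x) * (p ‖x‖ / ψ ‖x‖ ^ (n - 1)) ∂(vol n ψ) := by
  rw [setIntegral_vol hψ hΩ]
  refine integral_congr_ae ?_
  filter_upwards [ae_restrict_of_ae ae_ne_zero] with x hx
  have hr := norm_pos_iff.2 hx
  have := (hψ.pos _ hr).ne'
  simp only [volDensity, div_pow]
  field_simp

/-- One-dimensional form of the Cauchy–Schwarz inequality for a radial function of finite
energy. -/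
theorem sq_integral_mul_deriv_le [Nontrivial (E n)] (hψ : IsModelFunction ψ) {q : ℝ → ℝ}
    {ω : E n → E n} (hW : HasWeakDifferentialOn Set.univ (fun x : E n => q ‖x‖) ω)
    (hfin : gradNorm ψ Set.univ ω < ∞) {p : ℝ → ℝ} (hp : ContDiff ℝ (⊤ : ℕ∞) p)
    {r₀ r₁ : ℝ} (hr₀ : 0 < r₀) (hp0 : ∀ r, r ≤ r₀ → p r = 0) (hp1 : ∀ r, r₁ ≤ r → p r = 0) :
    (∫ r in Set.Ioi (0 : ℝ), q r * deriv p r) ^ 2 ≤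
      (gradNorm ψ Set.univ ω).toReal ^ 2 *
        ∫ r in Set.Ioi (0 : ℝ), p r ^ 2 / sphereArea n ψ r := by
  have hκ := unitSphereArea_pos (n := n)
  have h1 := hW.integral_radial hp hr₀ hp0 hp1 (Set.subset_univ _)
  rw [integral_radial_vol hψ MeasurableSet.univ] at h1
  simp only [Measure.restrict_univ] at h1
  have h2 : ∫ x : E n, q ‖x‖ * (deriv p ‖x‖ / ‖x‖ ^ (n - 1)) =
      unitSphereArea n * ∫ r in Set.Ioi (0 : ℝ), q r * deriv p r := by
    rw [← integral_radial_div]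
    simp only [mul_div_assoc]
  rw [h2] at h1
  have hθ : Measurable (fun x : E n => radialDir x) := (measurable_norm.inv).smul measurable_id
  have hmω : AEStronglyMeasurable ω (vol n ψ) := by
    have := aestronglyMeasurable_restrict_vol (ψ := ψ) hW.2.1.aestronglyMeasurable
    rwa [Measure.restrict_univ] at this
  have hle : eLpNorm (fun x => (inner ℝ (ω x) (radialDir x) : ℝ)) 2 (vol n ψ) ≤
      gradNorm ψ Set.univ ω := by
    rw [gradNorm, Measure.restrict_univ]
    refine eLpNorm_mono_ae ?_
    filter_upwards [vol_ae_ne_zero] with x hx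
    rw [real_inner_comm, Real.norm_eq_abs]
    exact abs_inner_radialDir_le hx _
  have m1 : MemLp (fun x => (inner ℝ (ω x) (radialDir x) : ℝ)) 2 (vol n ψ) :=
    ⟨hmω.inner hθ.aestronglyMeasurable, hle.trans_lt hfin⟩
  have hq2 : Continuous (fun x : E n => p ‖x‖ / ψ ‖x‖ ^ (n - 1)) :=
    (contDiff_div_pow hψ hp hr₀ hp0 (n - 1)).continuous.comp continuous_norm
  have m2 : MemLp (fun x : E n => p ‖x‖ / ψ ‖x‖ ^ (n - 1)) 2 (vol n ψ) := by
    have h := (memLp_indicator_iff_restrict (Metric.isOpen_ball.measurableSet)).2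
      (memLp_vol_of_continuous hψ hq2 r₁ 2)
    rwa [Set.indicator_eq_self.2] at h
    intro x hx
    by_contra hxr
    exact hx (by simp [hp1 ‖x‖ (by simpa using hxr)])
  have h3 := integral_inner_eq_inner_toLp m1 m2
  have h4 : ∫ x, inner ℝ (inner ℝ (ω x) (radialDir x) : ℝ) (p ‖x‖ / ψ ‖x‖ ^ (n - 1)) ∂(vol n ψ) =
      ∫ x, inner ℝ (ω x) (radialDir x) * (p ‖x‖ / ψ ‖x‖ ^ (n - 1)) ∂(vol n ψ) :=
    integral_congr_ae (Eventually.of_forall fun x => by simp [mul_comm])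
  have h5 := abs_real_inner_le_norm (m1.toLp _) (m2.toLp _)
  rw [← h3, h4] at h5
  have h6 : ‖m1.toLp _‖ ≤ (gradNorm ψ Set.univ ω).toReal := by
    rw [Lp.norm_toLp]
    exact ENNReal.toReal_mono hfin.ne hle
  have h7 : ‖m2.toLp _‖ ^ 2 = unitSphereArea n ^ 2 *
      ∫ r in Set.Ioi (0 : ℝ), p r ^ 2 / sphereArea n ψ r := by
    rw [← real_inner_self_eq_norm_sq, ← integral_inner_eq_inner_toLp m2 m2, ← setIntegral_univ,
      setIntegral_vol hψ MeasurableSet.univ, Measure.restrict_univ]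
    have h8 : ∫ x : E n, volDensity n ψ ‖x‖ * inner ℝ (p ‖x‖ / ψ ‖x‖ ^ (n - 1))
        (p ‖x‖ / ψ ‖x‖ ^ (n - 1)) = ∫ x : E n,
        (unitSphereArea n * (p ‖x‖ ^ 2 / sphereArea n ψ ‖x‖)) / ‖x‖ ^ (n - 1) := by
      refine integral_congr_ae ?_
      filter_upwards [ae_ne_zero] with x hx
      have hr := norm_pos_iff.2 hx
      have := (hψ.pos _ hr).ne'
      simp only [volDensity, div_pow, sphereArea, RCLike.inner_apply,
        conj_trivial]
      field_simp
    rw [h8, integral_radial_div (fun r => unitSphereArea n * (p r ^ 2 / sphereArea n ψ r)),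
      integral_const_mul]
    ring
  set I := ∫ x, inner ℝ (ω x) (radialDir x) * (p ‖x‖ / ψ ‖x‖ ^ (n - 1)) ∂(vol n ψ)
  have h9 : I ^ 2 ≤ (gradNorm ψ Set.univ ω).toReal ^ 2 * ‖m2.toLp _‖ ^ 2 := by
    rw [← sq_abs I, ← mul_pow]
    refine pow_le_pow_left₀ (abs_nonneg _) (h5.trans ?_) 2
    gcongr
  rw [h7] at h9
  have h10 : unitSphereArea n ^ 2 * (∫ r in Set.Ioi (0 : ℝ), q r * deriv p r) ^ 2 = I ^ 2 := by
    rw [← mul_pow, h1, neg_sq]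
  have h11 : 0 < unitSphereArea n ^ 2 := by positivity
  refine le_of_mul_le_mul_left ?_ h11
  rw [h10]
  linarith

end RadialEnergy

section Plateau

/-- A smooth plateau function: `0` outside `[a', b']`, `1` on `[a, b]`. -/
noncomputable def plateau (a' a b b' r : ℝ) : ℝ :=
  Real.smoothTransition ((r - a') / (a - a')) * Real.smoothTransition ((b' - r) / (b' - b))

variable {a' a b b' : ℝ}

theorem contDiff_plateau : ContDiff ℝ (⊤ : ℕ∞) (plateau a' a b b') := by
  have h : ContDiff ℝ (⊤ : ℕ∞) Real.smoothTransition := Real.smoothTransition.contDiff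
  unfold plateau
  exact (h.comp (by fun_prop)).mul (h.comp (by fun_prop))

theorem plateau_nonneg (r : ℝ) : 0 ≤ plateau a' a b b' r :=
  mul_nonneg (Real.smoothTransition.nonneg _) (Real.smoothTransition.nonneg _)

theorem plateau_le_one (r : ℝ) : plateau a' a b b' r ≤ 1 :=
  mul_le_one₀ (Real.smoothTransition.le_one _) (Real.smoothTransition.nonneg _)
    (Real.smoothTransition.le_one _)

theorem plateau_of_le (ha : a' < a) {r : ℝ} (hr : r ≤ a') : plateau a' a b b' r = 0 := by
  rw [plateau, Real.smoothTransition.zero_of_nonpos, zero_mul]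
  exact div_nonpos_of_nonpos_of_nonneg (by linarith) (by linarith)

theorem plateau_of_ge (hb : b < b') {r : ℝ} (hr : b' ≤ r) : plateau a' a b b' r = 0 := by
  rw [plateau, Real.smoothTransition.zero_of_nonpos (x := (b' - r) / (b' - b)), mul_zero]
  exact div_nonpos_of_nonpos_of_nonneg (by linarith) (by linarith)

theorem plateau_eq_left (hb : b < b') {r : ℝ} (hr : r ≤ b) :
    plateau a' a b b' r = Real.smoothTransition ((r - a') / (a - a')) := by
  rw [plateau, Real.smoothTransition.one_of_one_le (x := (b' - r) / (b' - b)), mul_one]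
  rw [one_le_div (by linarith)]
  linarith

theorem plateau_eq_right (ha : a' < a) {r : ℝ} (hr : a ≤ r) :
    plateau a' a b b' r = Real.smoothTransition ((b' - r) / (b' - b)) := by
  rw [plateau, Real.smoothTransition.one_of_one_le (x := (r - a') / (a - a')), one_mul]
  rw [one_le_div (by linarith)]
  linarith

theorem plateau_eq_one (ha : a' < a) (hb : b < b') {r : ℝ} (hr : a ≤ r) (hr' : r ≤ b) :
    plateau a' a b b' r = 1 := by
  rw [plateau_eq_left hb hr', Real.smoothTransition.one_of_one_le]
  rw [one_le_div (by linarith)]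
  linarith

theorem deriv_plateau_nonneg (ha : a' < a) (hb : b < b') {r : ℝ} (hr : r < b) :
    0 ≤ deriv (plateau a' a b b') r := by
  have h : plateau a' a b b' =ᶠ[𝓝 r] fun r => Real.smoothTransition ((r - a') / (a - a')) := by
    filter_upwards [Iio_mem_nhds hr] with s hs
    exact plateau_eq_left hb (le_of_lt hs)
  rw [h.deriv_eq]
  refine Monotone.deriv_nonneg ?_
  exact fun s t hst => Real.smoothTransition.monotone (by gcongr)

theorem deriv_plateau_nonpos (ha : a' < a) (hb : b < b') {r : ℝ} (hr : a < r) :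
    deriv (plateau a' a b b') r ≤ 0 := by
  have h : plateau a' a b b' =ᶠ[𝓝 r] fun r => Real.smoothTransition ((b' - r) / (b' - b)) := by
    filter_upwards [Ioi_mem_nhds hr] with s hs
    exact plateau_eq_right ha (le_of_lt hs)
  rw [h.deriv_eq]
  refine Antitone.deriv_nonpos ?_
  exact fun s t hst => Real.smoothTransition.monotone (by gcongr)

theorem continuous_deriv_plateau : Continuous (deriv (plateau a' a b b')) :=
  contDiff_plateau.continuous_deriv (by simp)

theorem deriv_plateau_of_lt (ha : a' < a) {r : ℝ} (hr : r < a') :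
    deriv (plateau a' a b b') r = 0 := by
  have h : plateau a' a b b' =ᶠ[𝓝 r] fun _ => 0 := by
    filter_upwards [Iio_mem_nhds hr] with s hs
    exact plateau_of_le ha (le_of_lt hs)
  rw [h.deriv_eq]
  simp

theorem deriv_plateau_of_gt (hb : b < b') {r : ℝ} (hr : b' < r) :
    deriv (plateau a' a b b') r = 0 := by
  have h : plateau a' a b b' =ᶠ[𝓝 r] fun _ => 0 := by
    filter_upwards [Ioi_mem_nhds hr] with s hs
    exact plateau_of_ge hb (le_of_lt hs)
  rw [h.deriv_eq]
  simp

/-- Testing a nonincreasing function against the derivative of a plateau function measures its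
drop across the plateau. -/
theorem integral_antitone_mul_deriv_plateau {q : ℝ → ℝ} (hq : Antitone q) (h0 : 0 < a')
    (ha : a' < a) (hab : a < b) (hb : b < b') :
    q a - q b ≤ ∫ r in Set.Ioi (0 : ℝ), q r * deriv (plateau a' a b b') r ∧
      ∫ r in Set.Ioi (0 : ℝ), q r * deriv (plateau a' a b b') r ≤ q a' - q b' := by
  set p := plateau a' a b b' with hp
  set m := (a + b) / 2 with hm
  have ham : a < m := by simp only [hm]; linarith
  have hmb : m < b := by simp only [hm]; linarith
  have hpc : Continuous (deriv p) := continuous_deriv_plateau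
  have hii : ∀ s t : ℝ, IntervalIntegrable (fun r => q r * deriv p r) volume s t := fun s t =>
    (hq.intervalIntegrable).mul_continuousOn hpc.continuousOn
  have hpi : ∀ s t c : ℝ, IntervalIntegrable (fun r => c * deriv p r) volume s t := fun s t c =>
    (continuous_const.mul hpc).intervalIntegrable _ _
  have hftc : ∀ s t c : ℝ, ∫ r in s..t, c * deriv p r = c * (p t - p s) := fun s t c => by
    rw [intervalIntegral.integral_const_mul, intervalIntegral.integral_deriv_eq_sub
      (fun r _ => (contDiff_plateau.differentiable (by simp)).differentiableAt)
      (hpc.intervalIntegrable _ _)]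
  have e1 : ∫ r in Set.Ioi (0 : ℝ), q r * deriv p r = ∫ r in a'..b', q r * deriv p r := by
    rw [intervalIntegral.integral_of_le (by linarith), ← integral_Icc_eq_integral_Ioc]
    refine setIntegral_eq_of_subset_of_forall_sdiff_eq_zero measurableSet_Ioi
      (fun r hr => h0.trans_le hr.1) fun r hr => ?_
    have : deriv p r = 0 := by
      by_cases h : r < a'
      · exact deriv_plateau_of_lt ha h
      · refine deriv_plateau_of_gt hb (lt_of_not_ge fun h' => hr.2 ⟨not_lt.1 h, h'⟩)
    rw [this, mul_zero]
  have e2 : ∫ r in a'..b', q r * deriv p r =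
      (∫ r in a'..m, q r * deriv p r) + ∫ r in m..b', q r * deriv p r :=
    (intervalIntegral.integral_add_adjacent_intervals (hii _ _) (hii _ _)).symm
  have pa' : p a' = 0 := plateau_of_le ha le_rfl
  have pb' : p b' = 0 := plateau_of_ge hb le_rfl
  have pm : p m = 1 := plateau_eq_one ha hb ham.le hmb.le
  have dmid : ∀ r, a < r → r < b → deriv p r = 0 := fun r h1 h2 =>
    le_antisymm (deriv_plateau_nonpos ha hb h1) (deriv_plateau_nonneg ha hb h2)
  rw [e1, e2]
  constructor
  · have l1 : q a * (p m - p a') ≤ ∫ r in a'..m, q r * deriv p r := by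
      rw [← hftc]
      refine intervalIntegral.integral_mono_on (by linarith) (hpi _ _ _) (hii _ _) fun r hr => ?_
      rcases le_or_gt r a with h | h
      · exact mul_le_mul_of_nonneg_right (hq h) (deriv_plateau_nonneg ha hb (by linarith))
      · rw [dmid r h (by linarith [hr.2]), mul_zero, mul_zero]
    have l2 : q b * (p b' - p m) ≤ ∫ r in m..b', q r * deriv p r := by
      rw [← hftc]
      refine intervalIntegral.integral_mono_on (by linarith) (hpi _ _ _) (hii _ _) fun r hr => ?_
      rcases lt_or_ge r b with h | h
      · rw [dmid r (by linarith [hr.1]) h, mul_zero, mul_zero]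
      · exact mul_le_mul_of_nonpos_right (hq h) (deriv_plateau_nonpos ha hb (by linarith))
    rw [pm, pa'] at l1
    rw [pm, pb'] at l2
    linarith
  · have l1 : ∫ r in a'..m, q r * deriv p r ≤ q a' * (p m - p a') := by
      rw [← hftc]
      refine intervalIntegral.integral_mono_on (by linarith) (hii _ _) (hpi _ _ _) fun r hr => ?_
      exact mul_le_mul_of_nonneg_right (hq hr.1)
        (deriv_plateau_nonneg ha hb (by linarith [hr.2]))
    have l2 : ∫ r in m..b', q r * deriv p r ≤ q b' * (p b' - p m) := by
      rw [← hftc]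
      refine intervalIntegral.integral_mono_on (by linarith) (hii _ _) (hpi _ _ _) fun r hr => ?_
      exact mul_le_mul_of_nonpos_right (hq hr.2)
        (deriv_plateau_nonpos ha hb (by linarith [hr.1]))
    rw [pm, pa'] at l1
    rw [pm, pb'] at l2
    linarith

end Plateau

section Resistance

variable {n : ℕ} {ψ : ℝ → ℝ}

/-- The resistance `∫_a^b dr / |∂B_r|` of the annulus between the radii `a` and `b`. -/
noncomputable def resistance (n : ℕ) (ψ : ℝ → ℝ) (a b : ℝ) : ℝ :=
  ∫ r in a..b, 1 / sphereArea n ψ r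

theorem continuousOn_inv_sphereArea [Nontrivial (E n)] (hψ : IsModelFunction ψ) :
    ContinuousOn (fun r => 1 / sphereArea n ψ r) (Set.Ioi 0) := by
  refine continuousOn_const.div (continuousOn_const.mul ((hψ.continuousOn.mono
    Set.Ioi_subset_Ici_self).pow _)) fun r hr => (sphereArea_pos hψ hr).ne'

theorem intervalIntegrable_inv_sphereArea [Nontrivial (E n)] (hψ : IsModelFunction ψ) {a b : ℝ}
    (ha : 0 < a) (hb : 0 < b) :
    IntervalIntegrable (fun r => 1 / sphereArea n ψ r) volume a b :=
  ((continuousOn_inv_sphereArea hψ).mono fun _ hr =>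
    (lt_min ha hb).trans_le hr.1).intervalIntegrable

theorem resistance_pos [Nontrivial (E n)] (hψ : IsModelFunction ψ) {a b : ℝ}
    (ha : 0 < a) (hab : a < b) : 0 < resistance n ψ a b :=
  intervalIntegral.intervalIntegral_pos_of_pos_on
    (intervalIntegrable_inv_sphereArea hψ ha (ha.trans hab))
    (fun _ hr => one_div_pos.2 (sphereArea_pos hψ (ha.trans hr.1))) hab

/-- The resistance depends continuously on the radii. -/
theorem tendsto_resistance [Nontrivial (E n)] (hψ : IsModelFunction ψ) {a b : ℝ}
    (ha : 0 < a) (hb : 0 < b) {ι : Type*} {l : Filter ι} {s t : ι → ℝ} (hs : Tendsto s l (𝓝 a))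
    (ht : Tendsto t l (𝓝 b)) :
    Tendsto (fun i => resistance n ψ (s i) (t i)) l (𝓝 (resistance n ψ a b)) := by
  have hc : ∀ r, 0 < r → ContinuousAt (fun r => resistance n ψ 1 r) r := fun r hr => by
    have hd : HasDerivAt (fun r => resistance n ψ 1 r) (1 / sphereArea n ψ r) r :=
      intervalIntegral.integral_hasDerivAt_right
        (intervalIntegrable_inv_sphereArea hψ one_pos hr)
        ((continuousOn_inv_sphereArea hψ).stronglyMeasurableAtFilter isOpen_Ioi r hr)
        ((continuousOn_inv_sphereArea hψ).continuousAt (Ioi_mem_nhds hr))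
    exact hd.continuousAt
  have hsub : ∀ r r', 0 < r → 0 < r' →
      resistance n ψ 1 r' - resistance n ψ 1 r = resistance n ψ r r' := fun r r' hr hr' =>
    intervalIntegral.integral_interval_sub_left
      (intervalIntegrable_inv_sphereArea hψ one_pos hr')
      (intervalIntegrable_inv_sphereArea hψ one_pos hr)
  rw [← hsub a b ha hb]
  refine (((hc b hb).tendsto.comp ht).sub ((hc a ha).tendsto.comp hs)).congr' ?_
  filter_upwards [hs.eventually (lt_mem_nhds ha), ht.eventually (lt_mem_nhds hb)] with i h1 h2
  exact hsub _ _ h1 h2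

/-- A radially nonincreasing function of finite energy can drop between two radii by at most the
product of the square roots of the energy and of the resistance. -/
theorem sq_drop_le [Nontrivial (E n)] (hψ : IsModelFunction ψ) {q : ℝ → ℝ} (hq : Antitone q)
    {ω : E n → E n} (hW : HasWeakDifferentialOn Set.univ (fun x : E n => q ‖x‖) ω)
    (hfin : gradNorm ψ Set.univ ω < ∞) {a b : ℝ} (ha : 0 < a) (hab : a < b) :
    (q a - q b) ^ 2 ≤ (gradNorm ψ Set.univ ω).toReal ^ 2 * resistance n ψ a b := by
  have hlim : Tendsto (fun δ => (gradNorm ψ Set.univ ω).toReal ^ 2 *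
      resistance n ψ (a - δ) (b + δ)) (𝓝[>] 0)
      (𝓝 ((gradNorm ψ Set.univ ω).toReal ^ 2 * resistance n ψ a b)) := by
    refine (tendsto_resistance hψ ha (ha.trans hab) ?_ ?_).const_mul _
    · have : Tendsto (fun δ : ℝ => a - δ) (𝓝 0) (𝓝 (a - 0)) := by
        exact (continuous_const.sub continuous_id).tendsto 0
      rw [sub_zero] at this
      exact this.mono_left nhdsWithin_le_nhds
    · have : Tendsto (fun δ : ℝ => b + δ) (𝓝 0) (𝓝 (b + 0)) := by
        exact (continuous_const.add continuous_id).tendsto 0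
      rw [add_zero] at this
      exact this.mono_left nhdsWithin_le_nhds
  refine ge_of_tendsto hlim ?_
  filter_upwards [Ioo_mem_nhdsGT ha] with δ hδ
  have h0 : 0 < a - δ := by linarith [hδ.2]
  have ha' : a - δ < a := by linarith [hδ.1]
  have hb' : b < b + δ := by linarith [hδ.1]
  have h1 := sq_integral_mul_deriv_le hψ hW hfin (p := plateau (a - δ) a b (b + δ))
    contDiff_plateau h0 (fun r => plateau_of_le ha') (fun r => plateau_of_ge hb')
  have h2 := (integral_antitone_mul_deriv_plateau hq h0 ha' hab hb').1
  have h3 : 0 ≤ q a - q b := sub_nonneg.2 (hq hab.le)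
  refine (pow_le_pow_left₀ h3 h2 2).trans (h1.trans ?_)
  gcongr
  rw [resistance, intervalIntegral.integral_of_le (by linarith), ← integral_Icc_eq_integral_Ioc]
  rw [setIntegral_eq_of_subset_of_forall_sdiff_eq_zero (s := Set.Icc (a - δ) (b + δ))
    measurableSet_Ioi (fun r hr => h0.trans_le hr.1)]
  · have hcont : ContinuousOn (fun r => 1 / sphereArea n ψ r) (Set.Icc (a - δ) (b + δ)) :=
      (continuousOn_inv_sphereArea hψ).mono fun r hr => h0.trans_le hr.1
    have hp : ContinuousOn (fun r => plateau (a - δ) a b (b + δ) r ^ 2) (Set.Icc (a - δ) (b + δ)) :=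
      (contDiff_plateau.continuous.pow 2).continuousOn
    refine setIntegral_mono_on ?_ (hcont.integrableOn_compact isCompact_Icc) measurableSet_Icc
      fun r hr => ?_
    · refine ContinuousOn.integrableOn_compact isCompact_Icc ((hp.mul hcont).congr fun r _ => ?_)
      simp [div_eq_mul_inv]
    · have := sphereArea_pos (n := n) hψ (h0.trans_le hr.1)
      gcongr
      exact pow_le_one₀ (plateau_nonneg r) (plateau_le_one r)
  · intro r hr
    have : plateau (a - δ) a b (b + δ) r = 0 := by
      by_cases h : r < a - δ
      · exact plateau_of_le ha' h.le
      · exact plateau_of_ge hb' (le_of_lt (lt_of_not_ge fun h' => hr.2 ⟨not_lt.1 h, h'⟩))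
    simp [this]

end Resistance

/-! ### Solutions tested against functions of themselves -/

section Primitive

/-- The primitive of `k` vanishing at `0`. -/
noncomputable def primitive (k : ℝ → ℝ) (s : ℝ) : ℝ := ∫ t in (0 : ℝ)..s, k t

variable {k : ℝ → ℝ}

theorem primitive_zero : primitive k 0 = 0 := intervalIntegral.integral_same

theorem hasDerivAt_primitive (hk : Continuous k) (s : ℝ) : HasDerivAt (primitive k) (k s) s :=
  intervalIntegral.integral_hasDerivAt_right (hk.intervalIntegrable _ _)
    (hk.stronglyMeasurableAtFilter _ _) hk.continuousAt

theorem deriv_primitive (hk : Continuous k) : deriv (primitive k) = k :=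
  funext fun s => (hasDerivAt_primitive hk s).deriv

theorem contDiff_primitive (hk : ContDiff ℝ (⊤ : ℕ∞) k) : ContDiff ℝ (⊤ : ℕ∞) (primitive k) := by
  rw [contDiff_infty_iff_deriv, deriv_primitive hk.continuous]
  exact ⟨fun s => (hasDerivAt_primitive hk.continuous s).differentiableAt, hk⟩

theorem monotone_primitive (hk : Continuous k) (h0 : ∀ t, 0 ≤ k t) : Monotone (primitive k) :=
  monotone_of_deriv_nonneg (fun s => (hasDerivAt_primitive hk s).differentiableAt) fun s => by
    rw [deriv_primitive hk]; exact h0 s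

theorem primitive_sub_eq_intervalIntegral (hk : Continuous k) (s t : ℝ) :
    primitive k t - primitive k s = ∫ r in s..t, k r :=
  intervalIntegral.integral_interval_sub_left (hk.intervalIntegrable _ _)
    (hk.intervalIntegrable _ _)

theorem primitive_eq_setIntegral (h0 : ∀ t, t ≤ 0 → k t = 0) {s : ℝ} (hs : 0 ≤ s) :
    primitive k s = ∫ t in {t | t < s}, k t := by
  rw [primitive, intervalIntegral.integral_of_le hs, integral_Ioc_eq_integral_Ioo]
  symm
  exact setIntegral_eq_of_subset_of_forall_sdiff_eq_zero measurableSet_Iio (fun t ht => ht.2)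
    fun t ht => h0 t (not_lt.1 fun h => ht.2 ⟨h, ht.1⟩)

/-- Exchange of the order of integration over a measurable relation. -/
theorem integral_mul_setIntegral_comm {α : Type*} [MeasurableSpace α] {ν : Measure α} [SFinite ν]
    {g : α → ℝ} (hg : Integrable g ν) (hk : Integrable k) {T : Set (α × ℝ)}
    (hT : MeasurableSet T) :
    Integrable (fun t => k t * ∫ x in {x | (x, t) ∈ T}, g x ∂ν) ∧
      ∫ x, g x * (∫ t in {t | (x, t) ∈ T}, k t) ∂ν =
        ∫ t, k t * ∫ x in {x | (x, t) ∈ T}, g x ∂ν := by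
  have hint : Integrable (T.indicator fun z : α × ℝ => g z.1 * k z.2) (ν.prod volume) :=
    (hg.mul_prod hk).indicator hT
  have h1 : ∀ x, g x * (∫ t in {t | (x, t) ∈ T}, k t) =
      ∫ t, T.indicator (fun z : α × ℝ => g z.1 * k z.2) (x, t) := fun x => by
    have hm : MeasurableSet {t | (x, t) ∈ T} := measurable_prodMk_left hT
    rw [← integral_const_mul, ← integral_indicator hm]
    rfl
  have h2 : ∀ t, k t * (∫ x in {x | (x, t) ∈ T}, g x ∂ν) =
      ∫ x, T.indicator (fun z : α × ℝ => g z.1 * k z.2) (x, t) ∂ν := fun t => by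
    have hm : MeasurableSet {x | (x, t) ∈ T} := measurable_prodMk_right hT
    rw [← integral_const_mul, ← integral_indicator hm]
    refine integral_congr_ae (Eventually.of_forall fun x => ?_)
    change _ = T.indicator (fun z : α × ℝ => g z.1 * k z.2) (x, t)
    by_cases hx : (x, t) ∈ T
    · rw [Set.indicator_of_mem (show x ∈ {x | (x, t) ∈ T} from hx), Set.indicator_of_mem hx,
        mul_comm]
    · rw [Set.indicator_of_notMem (show x ∉ {x | (x, t) ∈ T} from hx), Set.indicator_of_notMem hx]
  simp only [h1, h2]
  exact ⟨hint.integral_prod_right, integral_integral_swap hint⟩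

end Primitive

section Solutions

variable {n : ℕ} {ψ : ℝ → ℝ} {R : ℝ}

/-- The integral of the Schwarz rearrangement over the ball of radius `r`. -/
noncomputable def mass (ψ : ℝ → ℝ) (f : E n → ℝ) (r : ℝ) : ℝ :=
  ∫ x in Metric.ball 0 r, schwarz ψ f x ∂(vol n ψ)

/-- A nonlinearity that is continuous and strictly increasing from `[0, ∞)` onto itself. -/
structure IsNonlinearity (φ : ℝ → ℝ) : Prop where
  strictMono : StrictMonoOn φ (Set.Ici 0)
  continuousOn : ContinuousOn φ (Set.Ici 0)
  zero : φ 0 = 0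
  surj : ∀ t, 0 ≤ t → ∃ s, 0 ≤ s ∧ φ s = t

theorem IsNonlinearity.nonneg {φ : ℝ → ℝ} (hφ : IsNonlinearity φ) {s : ℝ} (hs : 0 ≤ s) :
    0 ≤ φ s := by
  rw [← hφ.zero]
  exact hφ.strictMono.monotoneOn Set.self_mem_Ici hs hs

/-- `u` is a bounded nonnegative function on `B_R`, extended by zero, such that `φ(u) ∈ H¹₀(B_R)`
has differential `ω` and `-Δφ(u) + u = f` weakly in `B_R`. -/
structure IsSolution (ψ : ℝ → ℝ) (R : ℝ) (φ : ℝ → ℝ) (f u : E n → ℝ) (ω : E n → E n) : Prop where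
  bdd : BddOnBall R u
  memH10 : MemH10 ψ R (fun x => φ (u x)) ω
  weak : ∀ (w : E n → ℝ) (η : E n → E n), MemH10 ψ R w η →
    ∫ x in Metric.ball 0 R, gradInner ψ x (ω x) (η x) ∂(vol n ψ) =
      ∫ x in Metric.ball 0 R, (f x - u x) * w x ∂(vol n ψ)

theorem gradInner_smul_right (hψ : IsModelFunction ψ) (x a b : E n) (c : ℝ) :
    gradInner ψ x a (c • b) = c * gradInner ψ x a b := by
  rw [gradInner_eq hψ, gradInner_eq hψ, map_smul, inner_smul_right]

theorem gradInner_smul_smul (hψ : IsModelFunction ψ) (x a b : E n) (c : ℝ) :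
    gradInner ψ x (c • a) (c • b) = c ^ 2 * gradInner ψ x a b := by
  rw [gradInner_eq hψ, gradInner_eq hψ, map_smul, map_smul, inner_smul_right, inner_smul_left]
  simp only [conj_trivial]
  ring

theorem MemH10.sq_gradNorm_toReal [Nontrivial (E n)] (hψ : IsModelFunction ψ) {v : E n → ℝ}
    {ω : E n → E n} (hv : MemH10 ψ R v ω) :
    (gradNorm ψ (Metric.ball 0 R) ω).toReal ^ 2 =
      ∫ x in Metric.ball 0 R, gradInner ψ x (ω x) (ω x) ∂(vol n ψ) := by
  simp only [gradInner_eq hψ]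
  rw [integral_inner_eq_inner_toLp (hv.memLp_coframe hψ) (hv.memLp_coframe hψ),
    real_inner_self_eq_norm_sq, Lp.norm_toLp, gradNorm]

theorem MemH10.integrable_gradInner [Nontrivial (E n)] (hψ : IsModelFunction ψ) {v w : E n → ℝ}
    {ω η : E n → E n} (hv : MemH10 ψ R v ω) (hw : MemH10 ψ R w η) :
    IntegrableOn (fun x => gradInner ψ x (ω x) (η x)) (Metric.ball 0 R) (vol n ψ) := by
  simp only [gradInner_eq hψ]
  exact integrable_inner (hv.memLp_coframe hψ) (hw.memLp_coframe hψ)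

theorem BddOnBall.memL0 [Nontrivial (E n)] (hψ : IsModelFunction ψ) {f : E n → ℝ}
    (hf : BddOnBall R f) : MemL0 ψ f := by
  refine ⟨hf.measurable.aestronglyMeasurable, fun t ht => ?_⟩
  rw [hf.distribution_eq]
  exact (measure_mono (hf.setOf_lt_subset ht.le)).trans_lt (vol_ball_lt_top hψ R)

instance : SFinite (vol n ψ) := by
  unfold vol
  infer_instance

theorem setIntegral_ball_mul_eq {g : E n → ℝ} {v : E n → ℝ}
    (hv : ∀ x, x ∉ Metric.ball (0 : E n) R → v x = 0) :
    ∫ x in Metric.ball 0 R, g x * v x ∂(vol n ψ) = ∫ x, g x * v x ∂(vol n ψ) := by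
  exact setIntegral_eq_integral_of_forall_compl_eq_zero fun x hx => by rw [hv x hx, mul_zero]

/-- Layer-cake formula for `∫ g G(v)`. -/
theorem integral_mul_primitive_comp {g v : E n → ℝ}
    (hg : Integrable g (vol n ψ)) (hv : Measurable v) (hv0 : ∀ x, 0 ≤ v x)
    {k : ℝ → ℝ} (hk : Integrable k) (hk0 : ∀ t, t ≤ 0 → k t = 0) :
    Integrable (fun t => k t * ∫ x in {x | t < v x}, g x ∂(vol n ψ)) ∧
      ∫ x, g x * primitive k (v x) ∂(vol n ψ) =
        ∫ t, k t * ∫ x in {x | t < v x}, g x ∂(vol n ψ) := by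
  have hT : MeasurableSet {z : E n × ℝ | z.2 < v z.1} :=
    measurableSet_lt measurable_snd (hv.comp measurable_fst)
  have h := integral_mul_setIntegral_comm hg hk hT
  simp only [primitive_eq_setIntegral hk0 (hv0 _)]
  exact h

namespace IsSolution

variable {φ : ℝ → ℝ} {f u : E n → ℝ} {ω : E n → E n}

theorem bdd_comp (hφ : IsNonlinearity φ) (hs : IsSolution ψ R φ f u ω) :
    BddOnBall R (fun x => φ (u x)) :=
  hs.bdd.comp hφ.strictMono.monotoneOn hφ.continuousOn hφ.zero

theorem profile_comp (hφ : IsNonlinearity φ) (hs : IsSolution ψ R φ f u ω) (r : ℝ) :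
    profile ψ (fun x => φ (u x)) r = φ (profile ψ u r) :=
  hs.bdd.profile_comp hφ.strictMono.monotoneOn hφ.continuousOn hφ.zero r

/-- Testing the equation with `G(φ(u))`, `G' = k`. -/
theorem integral_mul_gradInner [Nontrivial (E n)] (hψ : IsModelFunction ψ)
    (hs : IsSolution ψ R φ f u ω) {k : ℝ → ℝ} (hk : ContDiff ℝ (⊤ : ℕ∞) k)
    (h0 : ∀ t, 0 ≤ k t) (h1 : ∀ t, k t ≤ 1) :
    ∫ x in Metric.ball 0 R, k (φ (u x)) * gradInner ψ x (ω x) (ω x) ∂(vol n ψ) =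
      ∫ x in Metric.ball 0 R, (f x - u x) * primitive k (φ (u x)) ∂(vol n ψ) := by
  have hm := hs.memH10.comp hψ (contDiff_primitive hk) primitive_zero
    (fun s => by rw [deriv_primitive hk.continuous]; exact h0 s)
    (fun s => by rw [deriv_primitive hk.continuous]; exact h1 s)
  rw [← hs.weak _ _ hm]
  simp only [gradInner_smul_right hψ, deriv_primitive hk.continuous]

/-- The Pólya–Szegő inequality applied to `G(φ(u))`, `G' = k`. -/
theorem exists_rearranged [Nontrivial (E n)] (hψ : IsModelFunction ψ)
    (hPS : SupportsPolyaSzego n ψ) (hφ : IsNonlinearity φ)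
    (hs : IsSolution ψ R φ f u ω) {k : ℝ → ℝ} (hk : ContDiff ℝ (⊤ : ℕ∞) k)
    (h0 : ∀ t, 0 ≤ k t) (h1 : ∀ t, k t ≤ 1) :
    ∃ ω' : E n → E n,
      MemDotH1 ψ (fun x => primitive k (φ (profile ψ u ‖x‖))) ω' ∧
      gradNorm ψ Set.univ ω' < ∞ ∧
      (gradNorm ψ Set.univ ω').toReal ^ 2 ≤
        ∫ x in Metric.ball 0 R, k (φ (u x)) ^ 2 * gradInner ψ x (ω x) (ω x) ∂(vol n ψ) := by
  have hG := contDiff_primitive hk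
  have hGm := monotone_primitive hk.continuous h0
  have hm := hs.memH10.comp hψ hG primitive_zero
    (fun s => by rw [deriv_primitive hk.continuous]; exact h0 s)
    (fun s => by rw [deriv_primitive hk.continuous]; exact h1 s)
  have hv := hs.bdd_comp hφ
  have hGv : BddOnBall R (fun x => primitive k (φ (u x))) :=
    hv.comp (G := primitive k) (hGm.monotoneOn _) hG.continuous.continuousOn primitive_zero
  have hext : zeroExtend R (fun x => primitive k (φ (u x))) =
      fun x => primitive k (φ (u x)) := by
    rw [zeroExtend, Set.indicator_eq_self]
    intro x hx
    by_contra h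
    exact hx (hGv.zero x h)
  have hdot := hm.memDotH1_zeroExtend hψ
  rw [hext] at hdot
  obtain ⟨-, ω', hω', hle⟩ := hPS _ _ hdot (hGv.memL0 hψ)
  have hsch : schwarz ψ (fun x => primitive k (φ (u x))) =
      fun x => primitive k (φ (profile ψ u ‖x‖)) := by
    funext x
    rw [schwarz_apply, hv.profile_comp (G := primitive k) (hGm.monotoneOn _)
      hG.continuous.continuousOn primitive_zero, hs.profile_comp hφ]
  rw [hsch] at hω'
  have hfin := (energy_lt_top_iff hψ).1 hω'.energy_lt_top
  refine ⟨ω', hω', hfin, ?_⟩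
  rw [energy_eq hψ, energy_eq hψ, gradNorm_univ_indicator] at hle
  have hle2 := ENNReal.toReal_mono (ENNReal.pow_ne_top (hm.gradNorm_lt_top hψ).ne) hle
  rw [ENNReal.toReal_pow, ENNReal.toReal_pow, hm.sq_gradNorm_toReal hψ] at hle2
  refine hle2.trans (le_of_eq ?_)
  simp only [gradInner_smul_smul hψ, deriv_primitive hk.continuous]

/-- The superlevel sets of a solution and of its rearrangement, and the comparison of the
right-hand side `f - u` on them. -/
theorem exists_level_radius [Nontrivial (E n)] (hψ : IsModelFunction ψ) (hR : 0 ≤ R)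
    (hφ : IsNonlinearity φ) (hf : BddOnBall R f) (hs : IsSolution ψ R φ f u ω) {t : ℝ}
    (ht : 0 ≤ t) :
    ∃ ρ, 0 ≤ ρ ∧ ρ ≤ R ∧ (∀ r, 0 ≤ r → (t < φ (profile ψ u r) ↔ r < ρ)) ∧
      ∫ x in {x | t < φ (u x)}, (f x - u x) ∂(vol n ψ) ≤ mass ψ f ρ - mass ψ u ρ := by
  obtain ⟨s, hs0, rfl⟩ := hφ.surj t ht
  obtain ⟨ρ, h1, h2, h3, h4, h5⟩ := hs.bdd.exists_level_radius hψ hR hs0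
  refine ⟨ρ, h1, h2, fun r hr => ?_, ?_⟩
  · rw [hφ.strictMono.lt_iff_lt hs0 (profile_nonneg _ _)]
    exact h4 r hr
  · have hset : {x | φ s < φ (u x)} = {x | s < u x} := by
      ext x
      exact hφ.strictMono.lt_iff_lt hs0 (hs.bdd.nonneg x)
    rw [hset, integral_sub (hf.integrable hψ).integrableOn (hs.bdd.integrable hψ).integrableOn,
      hs.bdd.setIntegral_superlevel_eq hψ hR h3]
    exact sub_le_sub_right (hf.setIntegral_le_schwarz hψ hR h3.ge) _

/-- The integrated Talenti inequality. Wherever the rearrangement of `φ(u)` drops, the drop is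
controlled by the excess of mass and by the resistance of the annulus. -/
theorem drop_le [Nontrivial (E n)] (hψ : IsModelFunction ψ)
    (hPS : SupportsPolyaSzego n ψ) (hR : 0 ≤ R) (hφ : IsNonlinearity φ) (hf : BddOnBall R f)
    (hs : IsSolution ψ R φ f u ω) {N : ℝ → ℝ} (hN : ∀ r, 0 ≤ r → mass ψ f r ≤ N r)
    {a b : ℝ} (ha : 0 < a) (hab : a < b) (hlt : φ (profile ψ u b) < φ (profile ψ u a)) {M : ℝ}
    (hM : ∀ r ∈ Set.Icc a b, N r - mass ψ u r ≤ M) :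
    φ (profile ψ u a) - φ (profile ψ u b) ≤ M * resistance n ψ a b := by
  set t₁ := φ (profile ψ u b) with ht₁
  set t₂ := φ (profile ψ u a) with ht₂
  have ht₁0 : 0 ≤ t₁ := hφ.nonneg (profile_nonneg _ _)
  have hv := hs.bdd_comp hφ
  have hfu : Integrable (fun x => f x - u x) (vol n ψ) :=
    (hf.integrable hψ).sub (hs.bdd.integrable hψ)
  have key : ∀ ε, 0 < ε → ε < (t₂ - t₁) / 2 → t₂ - t₁ - 2 * ε ≤ M * resistance n ψ a b := by
    intro ε hε hε2
    have l1 : t₁ < t₁ + ε := by linarith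
    have l2 : t₁ + ε < t₂ - ε := by linarith
    have l3 : t₂ - ε < t₂ := by linarith
    set p := plateau t₁ (t₁ + ε) (t₂ - ε) t₂ with hp
    have hpsm : ContDiff ℝ (⊤ : ℕ∞) p := contDiff_plateau
    have hp0 : ∀ t, t ≤ t₁ → p t = 0 := fun t => plateau_of_le l1
    have hp1 : ∀ t, t₂ ≤ t → p t = 0 := fun t => plateau_of_ge l3
    have hpn : ∀ t, 0 ≤ p t := plateau_nonneg
    have hpl : ∀ t, p t ≤ 1 := plateau_le_one
    have hps : Function.support p ⊆ Set.Icc t₁ t₂ := fun t ht =>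
      ⟨le_of_not_ge fun h => ht (hp0 t h), le_of_not_ge fun h => ht (hp1 t h)⟩
    have hpc : HasCompactSupport p :=
      HasCompactSupport.of_support_subset_isCompact isCompact_Icc hps
    have hpi : Integrable p := hpsm.continuous.integrable_of_hasCompactSupport hpc
    have hp2sm : ContDiff ℝ (⊤ : ℕ∞) (fun t => p t ^ 2) := hpsm.pow 2
    have hp2i : Integrable (fun t => p t ^ 2) := by
      refine hp2sm.continuous.integrable_of_hasCompactSupport
        (HasCompactSupport.of_support_subset_isCompact isCompact_Icc fun t ht => hps ?_)
      intro h
      exact ht (by simp [h])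
    obtain ⟨ω', hω', hfin, hle⟩ := hs.exists_rearranged hψ hPS hφ hpsm hpn hpl
    obtain ⟨hint, hcake⟩ := integral_mul_primitive_comp hfu hv.measurable hv.nonneg hp2i
      (fun t ht => by rw [hp0 t (ht.trans ht₁0)]; norm_num)
    rw [hs.integral_mul_gradInner hψ hp2sm (fun t => sq_nonneg _)
      (fun t => pow_le_one₀ (hpn t) (hpl t)),
      setIntegral_ball_mul_eq (fun x hx => by rw [hv.zero x hx, primitive_zero]),
      hcake] at hle
    -- On the levels between `t₁` and `t₂` the superlevel sets have radii between `a` and `b`.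
    have hA : ∫ t, p t ^ 2 * ∫ x in {x | t < φ (u x)}, (f x - u x) ∂(vol n ψ) ≤
        ∫ t, p t ^ 2 * M := by
      have hb : ∀ t, p t ^ 2 * ∫ x in {x | t < φ (u x)}, (f x - u x) ∂(vol n ψ) ≤
          p t ^ 2 * M := by
        intro t
        by_cases h1 : t₁ < t ∧ t < t₂
        · obtain ⟨ρ, g1, g2, g3, g4⟩ := hs.exists_level_radius hψ hR hφ hf (ht₁0.trans h1.1.le)
          have haρ : a < ρ := (g3 a ha.le).1 h1.2
          have hρb : ρ ≤ b := by
            by_contra! h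
            exact absurd ((g3 b (ha.trans hab).le).2 h) (not_lt.2 h1.1.le)
          refine mul_le_mul_of_nonneg_left ?_ (sq_nonneg _)
          refine g4.trans ((sub_le_sub_right (hN ρ g1) _).trans (hM ρ ⟨haρ.le, hρb⟩))
        · have : p t = 0 := by
            by_cases h2 : t₁ < t
            · exact hp1 t (not_lt.1 fun h => h1 ⟨h2, h⟩)
            · exact hp0 t (not_lt.1 h2)
          simp [this]
      exact integral_mono hint (hp2i.mul_const M) hb
    rw [integral_mul_const] at hA
    have hq : Antitone fun r => primitive p (φ (profile ψ u r)) := fun r s hrs =>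
      monotone_primitive hpsm.continuous hpn (hφ.strictMono.monotoneOn (profile_nonneg _ _)
        (profile_nonneg _ _) (hs.bdd.profile_antitone hrs))
    have hdrop := sq_drop_le hψ hq hω'.weakDifferential hfin ha hab
    have hres := resistance_pos (n := n) hψ ha hab
    have hdiff : primitive p t₂ - primitive p t₁ = ∫ t, p t := by
      rw [primitive_sub_eq_intervalIntegral hpsm.continuous,
        intervalIntegral.integral_of_le hlt.le, ← integral_Icc_eq_integral_Ioc]
      exact setIntegral_eq_integral_of_forall_compl_eq_zero fun t ht => by
        by_contra h
        exact ht (hps h)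
    change (primitive p t₂ - primitive p t₁) ^ 2 ≤ _ at hdrop
    rw [hdiff] at hdrop
    have hIle : ∫ t, p t ^ 2 ≤ ∫ t, p t :=
      integral_mono hp2i hpi fun t => by
        simpa [sq] using mul_le_of_le_one_left (hpn t) (hpl t)
    have hIge : t₂ - t₁ - 2 * ε ≤ ∫ t, p t := by
      have h1 : ∫ t in Set.Icc (t₁ + ε) (t₂ - ε), p t ≤ ∫ t, p t :=
        setIntegral_le_integral hpi (Eventually.of_forall hpn)
      rw [setIntegral_congr_fun (g := fun _ => (1 : ℝ)) measurableSet_Icc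
        (fun t ht => plateau_eq_one l1 l3 ht.1 ht.2)] at h1
      simp only [integral_const, MeasurableSet.univ, measureReal_restrict_apply, Set.univ_inter,
        Real.volume_real_Icc, smul_eq_mul, mul_one] at h1
      exact (le_trans (by linarith) (le_max_left _ _)).trans h1
    set I := ∫ t, p t
    set I₂ := ∫ t, p t ^ 2
    have hIpos : 0 < I := by linarith
    have hI₂ : 0 ≤ I₂ := integral_nonneg fun t => sq_nonneg _
    have h5 : I ^ 2 ≤ I₂ * M * resistance n ψ a b :=
      hdrop.trans (mul_le_mul_of_nonneg_right (hle.trans hA) hres.le)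
    have hMpos : 0 < M := by
      by_contra! h
      have h6 : I₂ * M * resistance n ψ a b ≤ 0 :=
        mul_nonpos_of_nonpos_of_nonneg (mul_nonpos_of_nonneg_of_nonpos hI₂ h) hres.le
      have : 0 < I ^ 2 := by positivity
      linarith
    have h7 : I ^ 2 ≤ I * (M * resistance n ψ a b) := by
      refine h5.trans ?_
      rw [mul_assoc]
      gcongr
    have h8 : I ≤ M * resistance n ψ a b := by
      rw [sq] at h7
      exact le_of_mul_le_mul_left h7 hIpos
    linarith
  refine le_of_forall_pos_lt_add fun δ hδ => ?_
  set ε := min (δ / 4) ((t₂ - t₁) / 4)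
  have hε : 0 < ε := lt_min (by linarith) (by linarith)
  have h1 := key ε hε (by
    have : ε ≤ (t₂ - t₁) / 4 := min_le_right _ _
    linarith)
  have h2 : ε ≤ δ / 4 := min_le_left _ _
  linarith

end IsSolution

end Solutions

/-! ### Boundary decay, and the equation tested with radial functions -/

section RadialSolutions

variable {n : ℕ} {ψ : ℝ → ℝ} {R : ℝ} {φ : ℝ → ℝ} {f u : E n → ℝ} {ω : E n → E n}

theorem mass_nonneg (f : E n → ℝ) (r : ℝ) : 0 ≤ mass ψ f r :=
  integral_nonneg fun _ => profile_nonneg _ _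

namespace IsSolution

/-- The rearrangement of `φ(u)` vanishes continuously at the boundary of `B_R`. -/
theorem exists_profile_le [Nontrivial (E n)] (hψ : IsModelFunction ψ)
    (hPS : SupportsPolyaSzego n ψ) (hR : 0 < R) (hφ : IsNonlinearity φ) (hf : BddOnBall R f)
    (hs : IsSolution ψ R φ f u ω) {ε : ℝ} (hε : 0 < ε) {R₀ : ℝ} (hR₀ : R₀ < R) :
    ∃ R', R₀ < R' ∧ 0 < R' ∧ R' < R ∧ φ (profile ψ u R') ≤ ε := by
  set M := ∫ x, schwarz ψ f x ∂(vol n ψ)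
  have hlim : Tendsto (fun r => M * resistance n ψ r R) (𝓝[<] R) (𝓝 0) := by
    have h := (tendsto_resistance (n := n) hψ hR hR (l := 𝓝[<] R) (s := fun r => r)
      (t := fun _ => R) nhdsWithin_le_nhds tendsto_const_nhds).const_mul M
    rwa [resistance, intervalIntegral.integral_same, mul_zero] at h
  have hev : ∀ᶠ r in 𝓝[<] R, M * resistance n ψ r R < ε := hlim.eventually (gt_mem_nhds hε)
  obtain ⟨r, h1, h2⟩ := (hev.and (Ioo_mem_nhdsLT (max_lt hR₀ hR))).exists
  have hr0 : 0 < r := (le_max_right _ _).trans_lt h2.1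
  refine ⟨r, (le_max_left _ _).trans_lt h2.1, hr0, h2.2, ?_⟩
  by_contra! hlt
  have hz : φ (profile ψ u R) = 0 := by rw [hs.bdd.profile_eq_zero le_rfl, hφ.zero]
  have h := hs.drop_le hψ hPS hR.le hφ hf (fun _ _ => le_rfl) hr0 h2.2
    (by rw [hz]; linarith) (M := M) fun s _ => by
      have e1 : mass ψ f s ≤ M := setIntegral_le_integral (hf.schwarz.integrable hψ)
        (Eventually.of_forall hf.schwarz.nonneg)
      linarith [mass_nonneg (ψ := ψ) u s]
  rw [hz] at h
  linarith

end IsSolution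

theorem gradInner_radialDir (hψ : IsModelFunction ψ) {x : E n} (hx : x ≠ 0) (a : E n) (c : ℝ) :
    gradInner ψ x a (c • radialDir x) = c * inner ℝ a (radialDir x) := by
  have h1 : inner ℝ (radialDir x) (radialDir x) = (1 : ℝ) := by
    rw [real_inner_self_eq_norm_sq, norm_radialDir hx]; norm_num
  rw [gradInner_smul_right hψ, gradInner_eq hψ, coframe_apply hx, coframe_apply hx]
  simp only [inner_add_left, inner_add_right, inner_smul_left, inner_smul_right, h1,
    conj_trivial]
  rw [real_inner_comm a (radialDir x)]
  ring

theorem primitive_sub_eq_setIntegral_Ioi {k : ℝ → ℝ} (hk : Continuous k) {b : ℝ}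
    (hb : ∀ t, b ≤ t → k t = 0) (r : ℝ) :
    primitive k b - primitive k r = ∫ t in {t | r < t}, k t := by
  rw [primitive_sub_eq_intervalIntegral hk]
  change _ = ∫ t in Set.Ioi r, k t
  rcases le_total r b with h | h
  · rw [intervalIntegral.integral_of_le h]
    exact (setIntegral_eq_of_subset_of_forall_sdiff_eq_zero measurableSet_Ioi
      Set.Ioc_subset_Ioi_self fun t ht => hb t (not_lt.1 fun h' => ht.2 ⟨ht.1, h'.le⟩)).symm
  · have h1 : ∫ t in Set.Ioi r, k t = 0 := by
      rw [setIntegral_congr_fun measurableSet_Ioi (g := fun _ => (0 : ℝ))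
        (fun t ht => hb t (h.trans (le_of_lt ht)))]
      simp
    rw [h1, intervalIntegral.integral_symm, intervalIntegral.integral_of_le h,
      setIntegral_congr_fun measurableSet_Ioc (g := fun _ => (0 : ℝ))
        (fun t ht => hb t ht.1.le)]
    simp

namespace IsSolution

/-- The counterpart of `IsSolution.drop_le` for solutions that are radially nonincreasing
themselves. -/
theorem le_drop [Nontrivial (E n)] (hψ : IsModelFunction ψ)
    (hφ : IsNonlinearity φ) (hf : BddOnBall R f)
    (hs : IsSolution ψ R φ f u ω) (hfae : schwarz ψ f =ᵐ[vol n ψ] f)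
    (huae : schwarz ψ u =ᵐ[vol n ψ] u) {a b : ℝ} (ha : 0 < a) (hab : a < b) (hbR : b < R)
    {c : ℝ} (hc : 0 ≤ c) (hle : ∀ r ∈ Set.Icc a b, c ≤ mass ψ f r - mass ψ u r) :
    c * resistance n ψ a b ≤ φ (profile ψ u a) - φ (profile ψ u b) := by
  have hb0 : 0 < b := ha.trans hab
  have hκ := unitSphereArea_pos (n := n)
  have hfu : Integrable (fun x => f x - u x) (vol n ψ) :=
    (hf.integrable hψ).sub (hs.bdd.integrable hψ)
  have key : ∀ δ, 0 < δ → δ < (b - a) / 2 →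
      c * resistance n ψ (a + δ) (b - δ) ≤ φ (profile ψ u a) - φ (profile ψ u b) := by
    intro δ hδ hδ2
    have l1 : a < a + δ := by linarith
    have l2 : a + δ < b - δ := by linarith
    have l3 : b - δ < b := by linarith
    set p := plateau a (a + δ) (b - δ) b with hp
    have hpsm : ContDiff ℝ (⊤ : ℕ∞) p := contDiff_plateau
    have hp0 : ∀ t, t ≤ a → p t = 0 := fun t => plateau_of_le l1
    have hp1 : ∀ t, b ≤ t → p t = 0 := fun t => plateau_of_ge l3
    set k : ℝ → ℝ := fun r => (unitSphereArea n)⁻¹ * (p r / ψ r ^ (n - 1)) with hk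
    have hkS : ∀ r, k r = p r * (1 / sphereArea n ψ r) := fun r => by
      simp only [hk, sphereArea, mul_inv, div_eq_mul_inv]
      ring
    have hksm : ContDiff ℝ (⊤ : ℕ∞) k := contDiff_const.mul (contDiff_div_pow hψ hpsm ha hp0 _)
    have hk0 : ∀ t, t ≤ a → k t = 0 := fun t ht => by simp [hk, hp0 t ht]
    have hk1 : ∀ t, b ≤ t → k t = 0 := fun t ht => by simp [hk, hp1 t ht]
    have hkn : ∀ t, 0 ≤ k t := fun t => by
      rcases le_or_gt t a with h | h
      · rw [hk0 t h]
      · rw [hkS]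
        exact mul_nonneg (plateau_nonneg t) (one_div_nonneg.2 (sphereArea_pos hψ (ha.trans h)).le)
    have hks : Function.support k ⊆ Set.Icc a b := fun t ht =>
      ⟨le_of_not_ge fun h => ht (hk0 t h), le_of_not_ge fun h => ht (hk1 t h)⟩
    have hki : Integrable k := hksm.continuous.integrable_of_hasCompactSupport
      (HasCompactSupport.of_support_subset_isCompact isCompact_Icc hks)
    -- The radial test function whose derivative is `-p / |∂B_r|`.
    set q : ℝ → ℝ := fun r => primitive k b - primitive k r with hq
    have hqsm : ContDiff ℝ (⊤ : ℕ∞) q := contDiff_const.sub (contDiff_primitive hksm)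
    have hq' : ∀ r, deriv q r = - k r := fun r => by
      simp only [hq]
      rw [deriv_const_sub, deriv_primitive hksm.continuous]
    have hqI := primitive_sub_eq_setIntegral_Ioi hksm.continuous hk1
    have hq1 : ∀ r, b ≤ r → q r = 0 := fun r hr => by
      simp only [hq, hqI]
      change ∫ t in Set.Ioi r, k t = 0
      rw [setIntegral_congr_fun measurableSet_Ioi (g := fun _ => (0 : ℝ))
        (fun t ht => hk1 t (hr.trans (le_of_lt ht)))]
      simp
    have hq0 : ∀ r, r ≤ a → q r = q a := fun r hr => by
      have : primitive k a - primitive k r = 0 := by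
        rw [primitive_sub_eq_intervalIntegral hksm.continuous, intervalIntegral.integral_of_le hr,
          setIntegral_congr_fun measurableSet_Ioc (g := fun _ => (0 : ℝ))
            (fun t ht => hk0 t ht.2)]
        simp
      simp only [hq]
      linarith
    have hQsm : ContDiff ℝ (⊤ : ℕ∞) (fun x : E n => q ‖x‖) := contDiff_comp_norm hqsm ha hq0
    have hQ0 : ∀ x, x ∉ Metric.closedBall (0 : E n) b → q ‖x‖ = 0 := fun x hx =>
      hq1 _ (by simpa using (not_le.1 (fun h => hx (mem_closedBall_zero_iff.2 h))).le)
    have hQc : HasCompactSupport (fun x : E n => q ‖x‖) :=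
      HasCompactSupport.intro' (isCompact_closedBall _ _) Metric.isClosed_closedBall hQ0
    have hbsub : Metric.closedBall (0 : E n) b ⊆ Metric.ball 0 R :=
      Metric.closedBall_subset_ball hbR
    have hQs : tsupport (fun x : E n => q ‖x‖) ⊆ Metric.ball 0 R :=
      (closure_minimal (fun x hx => by
        by_contra hxs
        exact hx (hQ0 x hxs)) Metric.isClosed_closedBall).trans hbsub
    have hw := hs.weak _ _ (MemH10.of_smooth hψ hQsm hQc hQs)
    have hB : MeasurableSet (Metric.ball (0 : E n) R) := Metric.isOpen_ball.measurableSet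
    have hlhs : ∫ x in Metric.ball 0 R,
        gradInner ψ x (ω x) (gradient (fun x : E n => q ‖x‖) x) ∂(vol n ψ) =
        ∫ r in Set.Ioi (0 : ℝ), φ (profile ψ u r) * deriv p r := by
      have e1 : ∫ x in Metric.ball 0 R,
          gradInner ψ x (ω x) (gradient (fun x : E n => q ‖x‖) x) ∂(vol n ψ) =
          ∫ x in Metric.ball 0 R, -(unitSphereArea n)⁻¹ *
            (inner ℝ (ω x) (radialDir x) * (p ‖x‖ / ψ ‖x‖ ^ (n - 1))) ∂(vol n ψ) := by
        refine integral_congr_ae ?_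
        filter_upwards [ae_restrict_of_ae vol_ae_ne_zero] with x hx
        rw [gradient_comp_norm (hqsm.differentiable (by simp)) hx, gradInner_radialDir hψ hx, hq']
        simp only [hk]
        ring
      rw [e1, integral_const_mul, ← integral_radial_vol hψ hB, neg_mul, ← mul_neg,
        ← hs.memH10.weakDifferential.integral_radial hpsm ha hp0 hp1 hbsub]
      have e2 : ∫ x in Metric.ball (0 : E n) R, φ (u x) * (deriv p ‖x‖ / ‖x‖ ^ (n - 1)) =
          ∫ x in Metric.ball (0 : E n) R, (φ (profile ψ u ‖x‖) * deriv p ‖x‖) / ‖x‖ ^ (n - 1) := by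
        refine integral_congr_ae ?_
        filter_upwards [ae_restrict_of_ae ((absolutelyContinuous_vol hψ).ae_le huae)] with x hx
        rw [← hx, schwarz_apply, mul_div_assoc]
      rw [e2, setIntegral_eq_integral_of_forall_compl_eq_zero,
        integral_radial_div (fun r => φ (profile ψ u r) * deriv p r), ← mul_assoc,
        inv_mul_cancel₀ hκ.ne', one_mul]
      intro x hx
      have hxR : R ≤ ‖x‖ := by simpa using hx
      have : deriv p ‖x‖ = 0 := deriv_plateau_of_gt l3 (hbR.trans_le hxR)
      simp [this]
    have hrhs : ∫ x in Metric.ball 0 R, (f x - u x) * q ‖x‖ ∂(vol n ψ) =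
        ∫ t, k t * (mass ψ f t - mass ψ u t) := by
      rw [setIntegral_ball_mul_eq fun x hx => hQ0 x fun h => hx (hbsub h)]
      have hT : MeasurableSet {z : E n × ℝ | ‖z.1‖ < z.2} :=
        measurableSet_lt (measurable_norm.comp measurable_fst) measurable_snd
      simp only [hq, hqI]
      refine (integral_mul_setIntegral_comm hfu hki hT).2.trans ?_
      refine integral_congr_ae (Eventually.of_forall fun t => ?_)
      have hset : {x : E n | (x, t) ∈ {z : E n × ℝ | ‖z.1‖ < z.2}} = Metric.ball 0 t := by
        ext x
        simp
      simp only [hset]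
      rw [integral_sub (hf.integrable hψ).integrableOn (hs.bdd.integrable hψ).integrableOn, mass,
        mass, integral_congr_ae (ae_restrict_of_ae hfae),
        integral_congr_ae (ae_restrict_of_ae huae)]
    rw [hlhs, hrhs] at hw
    have hanti : Antitone fun r => φ (profile ψ u r) := fun r s hrs =>
      hφ.strictMono.monotoneOn (profile_nonneg _ _) (profile_nonneg _ _)
        (hs.bdd.profile_antitone hrs)
    have hup := (integral_antitone_mul_deriv_plateau hanti ha l1 l2 l3).2
    rw [hw] at hup
    refine le_trans ?_ hup
    have hcont : Continuous fun t => k t * (mass ψ f t - mass ψ u t) :=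
      hksm.continuous.mul ((continuous_setIntegral_ball fun r =>
        (hf.schwarz.integrable hψ).integrableOn).sub (continuous_setIntegral_ball fun r =>
        (hs.bdd.schwarz.integrable hψ).integrableOn))
    have hint : Integrable fun t => k t * (mass ψ f t - mass ψ u t) :=
      hcont.integrable_of_hasCompactSupport
        (HasCompactSupport.of_support_subset_isCompact isCompact_Icc fun t ht => hks fun h =>
          ht (by simp [h]))
    have h1 : ∫ t, c * k t ≤ ∫ t, k t * (mass ψ f t - mass ψ u t) := by
      refine integral_mono (hki.const_mul c) hint fun t => ?_
      change c * k t ≤ k t * (mass ψ f t - mass ψ u t)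
      by_cases ht : t ∈ Set.Icc a b
      · rw [mul_comm]
        exact mul_le_mul_of_nonneg_left (hle t ht) (hkn t)
      · have : k t = 0 := by
          by_contra h
          exact ht (hks h)
        simp [this]
    refine le_trans ?_ h1
    rw [integral_const_mul]
    refine mul_le_mul_of_nonneg_left ?_ hc
    refine le_trans (le_of_eq ?_) (setIntegral_le_integral (s := Set.Icc (a + δ) (b - δ)) hki
      (Eventually.of_forall hkn))
    rw [resistance, intervalIntegral.integral_of_le l2.le, ← integral_Icc_eq_integral_Ioc]
    refine setIntegral_congr_fun measurableSet_Icc fun t ht => ?_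
    simp only [hkS]
    rw [show p t = 1 from plateau_eq_one l1 l3 ht.1 ht.2, one_mul]
  have hlim : Tendsto (fun δ => c * resistance n ψ (a + δ) (b - δ)) (𝓝[>] 0)
      (𝓝 (c * resistance n ψ a b)) := by
    refine (tendsto_resistance hψ ha hb0 ?_ ?_).const_mul _
    · have : Tendsto (fun δ : ℝ => a + δ) (𝓝 0) (𝓝 (a + 0)) :=
        (continuous_const.add continuous_id).tendsto 0
      rw [add_zero] at this
      exact this.mono_left nhdsWithin_le_nhds
    · have : Tendsto (fun δ : ℝ => b - δ) (𝓝 0) (𝓝 (b - 0)) :=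
        (continuous_const.sub continuous_id).tendsto 0
      rw [sub_zero] at this
      exact this.mono_left nhdsWithin_le_nhds
  refine le_of_tendsto hlim ?_
  filter_upwards [Ioo_mem_nhdsGT (show (0 : ℝ) < (b - a) / 2 by linarith)] with δ hδ
  exact key δ hδ.1 hδ.2

end IsSolution

end RadialSolutions

/-! ### Solutions with radially nonincreasing data are radially nonincreasing -/

section Rearranged

variable {n : ℕ} {ψ : ℝ → ℝ} {R : ℝ} {φ : ℝ → ℝ} {f u : E n → ℝ} {ω : E n → E n}

theorem primitive_eq_zero_of_le {k : ℝ → ℝ} {a : ℝ} (ha : 0 ≤ a) (hk : ∀ t, t ≤ a → k t = 0)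
    {s : ℝ} (hs0 : 0 ≤ s) (hs : s ≤ a) : primitive k s = 0 := by
  rw [primitive_eq_setIntegral (fun t ht => hk t (ht.trans ha)) hs0]
  change ∫ t in Set.Iio s, k t = 0
  rw [setIntegral_congr_fun (g := fun _ => (0 : ℝ)) measurableSet_Iio
    (fun t ht => hk t ((le_of_lt ht).trans hs))]
  simp

theorem primitive_le_self {k : ℝ → ℝ} (hk : Continuous k) (h1 : ∀ t, k t ≤ 1) {s : ℝ}
    (hs : 0 ≤ s) : primitive k s ≤ s := by
  have h := intervalIntegral.integral_mono_on hs (hk.intervalIntegrable (μ := volume) 0 s)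
    (continuous_const.intervalIntegrable (μ := volume) 0 s) fun t _ => h1 t
  simpa [primitive] using h

theorem sub_le_primitive {k : ℝ → ℝ} (hk : Continuous k) (h0 : ∀ t, 0 ≤ k t) {a b : ℝ}
    (ha : 0 ≤ a) (h1 : ∀ t, a ≤ t → t ≤ b → k t = 1) {s : ℝ} (hs : 0 ≤ s) (hsb : s ≤ b) :
    s - a ≤ primitive k s := by
  have hm := monotone_primitive hk h0
  rcases le_total s a with h | h
  · have := hm hs
    rw [primitive_zero] at this
    linarith
  · have h2 := hm ha
    rw [primitive_zero] at h2
    have h3 := primitive_sub_eq_intervalIntegral hk a s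
    rw [intervalIntegral.integral_congr (g := fun _ => (1 : ℝ)) fun t ht => by
      rw [Set.uIcc_of_le h] at ht
      exact h1 t ht.1 (ht.2.trans hsb)] at h3
    simp only [intervalIntegral.integral_const, smul_eq_mul, mul_one] at h3
    linarith

namespace IsSolution

theorem bdd_comp_profile (hφ : IsNonlinearity φ)
    (hs : IsSolution ψ R φ f u ω) : BddOnBall R (fun x : E n => φ (profile ψ u ‖x‖)) :=
  (hs.bdd.schwarz (ψ := ψ)).comp hφ.strictMono.monotoneOn hφ.continuousOn hφ.zero

/-- Rearranging `φ(u)` increases the right-hand side of the equation tested with functions of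
`φ(u)` if the datum is its own rearrangement. -/
theorem integral_mul_primitive_le [Nontrivial (E n)] (hψ : IsModelFunction ψ) (hR : 0 ≤ R)
    (hφ : IsNonlinearity φ) (hf : BddOnBall R f) (hs : IsSolution ψ R φ f u ω)
    (hfae : schwarz ψ f =ᵐ[vol n ψ] f) {k : ℝ → ℝ} (hk : Integrable k) (h0 : ∀ t, 0 ≤ k t)
    (hk0 : ∀ t, t ≤ 0 → k t = 0) :
    ∫ x, (f x - u x) * primitive k (φ (u x)) ∂(vol n ψ) ≤
      ∫ x, (f x - u x) * primitive k (φ (profile ψ u ‖x‖)) ∂(vol n ψ) := by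
  have hfu : Integrable (fun x => f x - u x) (vol n ψ) :=
    (hf.integrable hψ).sub (hs.bdd.integrable hψ)
  have hv := hs.bdd_comp hφ
  have hV := hs.bdd_comp_profile hφ
  obtain ⟨i1, e1⟩ := integral_mul_primitive_comp hfu hv.measurable hv.nonneg hk hk0
  obtain ⟨i2, e2⟩ := integral_mul_primitive_comp hfu hV.measurable hV.nonneg hk hk0
  rw [e1, e2]
  refine integral_mono i1 i2 fun t => ?_
  rcases le_or_gt t 0 with ht | ht
  · simp [hk0 t ht]
  · refine mul_le_mul_of_nonneg_left ?_ (h0 t)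
    obtain ⟨ρ, -, -, h3, h4⟩ := hs.exists_level_radius hψ hR hφ hf ht.le
    have hset : {x : E n | t < φ (profile ψ u ‖x‖)} = Metric.ball 0 ρ := by
      ext x
      rw [Set.mem_ofPred_eq, h3 _ (norm_nonneg x), mem_ball_zero_iff]
    have hsub : ∫ x in Metric.ball 0 ρ, (f x - u x) ∂(vol n ψ) =
        (∫ x in Metric.ball 0 ρ, f x ∂(vol n ψ)) - ∫ x in Metric.ball 0 ρ, u x ∂(vol n ψ) :=
      integral_sub (hf.integrable hψ).integrableOn (hs.bdd.integrable hψ).integrableOn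
    rw [hset, hsub]
    refine h4.trans (sub_le_sub (le_of_eq ?_) (hs.bdd.setIntegral_le_schwarz hψ hR le_rfl))
    exact integral_congr_ae (ae_restrict_of_ae hfae)

/-- An almost rearranged competitor: some function with values within `2 ε` of the rearrangement
of `φ(u)` is close to `φ(u)` in energy. -/
theorem exists_competitor [Nontrivial (E n)] (hψ : IsModelFunction ψ)
    (hPS : SupportsPolyaSzego n ψ) (hR : 0 < R) (hφ : IsNonlinearity φ) (hf : BddOnBall R f)
    (hs : IsSolution ψ R φ f u ω) (hfae : schwarz ψ f =ᵐ[vol n ψ] f) {ε : ℝ} (hε : 0 < ε)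
    (hε2 : ε < 1 / 2) :
    ∃ (W : E n → ℝ) (ω' : E n → E n), MemH10 ψ R W ω' ∧
      (∀ x, |φ (profile ψ u ‖x‖) - W x| ≤ 2 * ε) ∧
      (gradNorm ψ (Metric.ball 0 R) (fun x => ω' x - ω x)).toReal ^ 2 ≤
        2 * ε * ∫ x, |f x - u x| ∂(vol n ψ) := by
  have hfu : Integrable (fun x => f x - u x) (vol n ψ) :=
    (hf.integrable hψ).sub (hs.bdd.integrable hψ)
  have hv := hs.bdd_comp hφ
  have hV := hs.bdd_comp_profile hφ
  obtain ⟨C, hC⟩ := hv.bdd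
  have hC0 : 0 ≤ C := (hv.nonneg 0).trans (hC 0)
  have hVC : ∀ x : E n, φ (profile ψ u ‖x‖) ≤ C := fun x => by
    rw [← hs.profile_comp hφ]
    exact hv.profile_le hC0 hC _
  have l1 : ε < 2 * ε := by linarith
  have l3 : C + 1 < C + 2 := by linarith
  set k := plateau ε (2 * ε) (C + 1) (C + 2) with hk
  have hksm : ContDiff ℝ (⊤ : ℕ∞) k := contDiff_plateau
  have hkn : ∀ t, 0 ≤ k t := plateau_nonneg
  have hkl : ∀ t, k t ≤ 1 := plateau_le_one
  have hk0 : ∀ t, t ≤ ε → k t = 0 := fun t => plateau_of_le l1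
  have hk1 : ∀ t, C + 2 ≤ t → k t = 0 := fun t => plateau_of_ge l3
  have hkp : ∀ t, 2 * ε ≤ t → t ≤ C + 1 → k t = 1 := fun t => plateau_eq_one l1 l3
  have hki : Integrable k := hksm.continuous.integrable_of_hasCompactSupport
    (HasCompactSupport.of_support_subset_isCompact (isCompact_Icc (a := ε) (b := C + 2)) fun t ht =>
      ⟨le_of_not_ge fun h => ht (hk0 t h), le_of_not_ge fun h => ht (hk1 t h)⟩)
  have hclose : ∀ s, 0 ≤ s → s ≤ C → 0 ≤ s - primitive k s ∧ s - primitive k s ≤ 2 * ε :=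
    fun s h0 h1 => ⟨sub_nonneg.2 (primitive_le_self hksm.continuous hkl h0), by
      have := sub_le_primitive hksm.continuous hkn (by linarith) hkp h0 (by linarith)
      linarith⟩
  -- The truncation at level `ε` makes the rearranged function vanish near the boundary, hence
  -- admissible as a test function.
  obtain ⟨R', -, hR', hR'R, hsmall⟩ := hs.exists_profile_le hψ hPS hR hφ hf hε hR
  obtain ⟨ω', hω', hfin, hle⟩ := hs.exists_rearranged hψ hPS hφ hksm hkn hkl
  have hW : MemH10 ψ R (fun x => primitive k (φ (profile ψ u ‖x‖))) ω' := by
    refine hω'.memH10 hψ hR' hR'R fun x hx => ?_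
    refine primitive_eq_zero_of_le hε.le hk0 (hV.nonneg x) (le_trans ?_ hsmall)
    exact hφ.strictMono.monotoneOn (profile_nonneg _ _) (profile_nonneg _ _)
      (hs.bdd.profile_antitone (by simpa using hx))
  refine ⟨_, ω', hW, fun x => ?_, ?_⟩
  · obtain ⟨h1, h2⟩ := hclose _ (hV.nonneg x) (hVC x)
    rwa [abs_of_nonneg h1]
  have hvv := hs.memH10.integrable_gradInner hψ hs.memH10
  have hvW := hs.memH10.integrable_gradInner hψ hW
  have hWW := hW.integrable_gradInner hψ hW
  -- Expanding the square, all mixed terms are given by the weak equation.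
  have hexp : ∫ x in Metric.ball 0 R, gradInner ψ x (ω' x - ω x) (ω' x - ω x) ∂(vol n ψ) =
      (∫ x in Metric.ball 0 R, gradInner ψ x (ω' x) (ω' x) ∂(vol n ψ)) -
      2 * (∫ x in Metric.ball 0 R, gradInner ψ x (ω x) (ω' x) ∂(vol n ψ)) +
      ∫ x in Metric.ball 0 R, gradInner ψ x (ω x) (ω x) ∂(vol n ψ) := by
    have h := integral_add (hWW.sub (hvW.const_mul 2)) hvv
    have h' := integral_sub hWW (hvW.const_mul 2)
    rw [integral_const_mul] at h'
    rw [← h']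
    refine Eq.trans ?_ h
    refine integral_congr_ae (Eventually.of_forall fun x => ?_)
    simp only [Pi.sub_apply, gradInner_eq hψ, map_sub, inner_sub_left, inner_sub_right]
    rw [real_inner_comm (coframe ψ x (ω x)) (coframe ψ x (ω' x))]
    ring
  rw [(hW.sub hψ hs.memH10).sq_gradNorm_toReal hψ, hexp, ← hW.sq_gradNorm_toReal hψ,
    hs.weak _ _ hW, hs.weak _ _ hs.memH10]
  have hmono : (gradNorm ψ (Metric.ball 0 R) ω').toReal ^ 2 ≤
      (gradNorm ψ Set.univ ω').toReal ^ 2 := by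
    refine pow_le_pow_left₀ ENNReal.toReal_nonneg (ENNReal.toReal_mono hfin.ne ?_) 2
    exact eLpNorm_mono_measure _ (Measure.restrict_mono (Set.subset_univ _) le_rfl)
  have hsq : ∫ x in Metric.ball 0 R, k (φ (u x)) ^ 2 * gradInner ψ x (ω x) (ω x) ∂(vol n ψ) ≤
      ∫ x in Metric.ball 0 R, k (φ (u x)) * gradInner ψ x (ω x) (ω x) ∂(vol n ψ) := by
    have hnn : ∀ x, 0 ≤ gradInner ψ x (ω x) (ω x) := fun x => by
      rw [gradInner_eq hψ]
      exact real_inner_self_nonneg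
    refine integral_mono_of_nonneg
      (Eventually.of_forall fun x => mul_nonneg (sq_nonneg _) (hnn x))
      (hvv.bdd_mul (c := 1) (hksm.continuous.measurable.comp hv.measurable).aestronglyMeasurable
        (Eventually.of_forall fun x => ?_)) (Eventually.of_forall fun x => ?_)
    · rw [Real.norm_of_nonneg (hkn _)]
      exact hkl _
    · refine mul_le_mul_of_nonneg_right ?_ (hnn x)
      rw [sq]
      exact mul_le_of_le_one_left (hkn _) (hkl _)
  rw [hs.integral_mul_gradInner hψ hksm hkn hkl,
    setIntegral_ball_mul_eq (v := fun x => primitive k (φ (u x)))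
      (fun x hx => by rw [hv.zero x hx, primitive_zero])] at hsq
  rw [setIntegral_ball_mul_eq (v := fun x => primitive k (φ (profile ψ u ‖x‖)))
      (fun x hx => by rw [hV.zero x hx, primitive_zero]),
    setIntegral_ball_mul_eq (v := fun x => φ (u x)) (fun x hx => hv.zero x hx)]
  have hHL := hs.integral_mul_primitive_le hψ hR.le hφ hf hfae hki hkn
    fun t ht => hk0 t (ht.trans hε.le)
  have hvi : Integrable (fun x => (f x - u x) * φ (u x)) (vol n ψ) :=
    hfu.mul_bdd (c := C) hv.measurable.aestronglyMeasurable
      (Eventually.of_forall fun x => by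
        rw [Real.norm_of_nonneg (hv.nonneg x)]
        exact hC x)
  have hGi : Integrable (fun x => (f x - u x) * primitive k (φ (u x))) (vol n ψ) :=
    hfu.mul_bdd (c := C)
      ((contDiff_primitive hksm).continuous.measurable.comp hv.measurable).aestronglyMeasurable
      (Eventually.of_forall fun x => by
        have h1 := monotone_primitive hksm.continuous hkn (hv.nonneg x)
        rw [primitive_zero] at h1
        rw [Real.norm_of_nonneg h1]
        linarith [(hclose _ (hv.nonneg x) (hC x)).1, hC x])
  have hfinal : (∫ x, (f x - u x) * φ (u x) ∂(vol n ψ)) -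
      ∫ x, (f x - u x) * primitive k (φ (u x)) ∂(vol n ψ) ≤
      2 * ε * ∫ x, |f x - u x| ∂(vol n ψ) := by
    rw [← integral_sub hvi hGi, ← integral_const_mul]
    refine integral_mono (hvi.sub hGi) (hfu.abs.const_mul _) fun x => ?_
    obtain ⟨h1, h2⟩ := hclose _ (hv.nonneg x) (hC x)
    change (f x - u x) * φ (u x) - (f x - u x) * primitive k (φ (u x)) ≤ 2 * ε * |f x - u x|
    rw [← mul_sub, mul_comm]
    exact (mul_le_mul_of_nonneg_left (le_abs_self _) h1).trans
      (mul_le_mul_of_nonneg_right h2 (abs_nonneg _))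
  linarith

/-- The solution with a rearranged datum is its own rearrangement: by the Pólya–Szegő inequality,
the rearrangement of `φ(u)` does not exceed it in the functional `½ ∫ |∇w|² - ∫ (f - u) w`, with `u`
fixed, of which `φ(u)` is the unique minimizer. -/
theorem schwarz_ae_eq [Nontrivial (E n)] (hψ : IsModelFunction ψ)
    (hPS : SupportsPolyaSzego n ψ) (hR : 0 < R) (hφ : IsNonlinearity φ) (hf : BddOnBall R f)
    (hs : IsSolution ψ R φ f u ω) (hfae : schwarz ψ f =ᵐ[vol n ψ] f) :
    schwarz ψ u =ᵐ[vol n ψ] u := by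
  have := isFiniteMeasure_vol_restrict_ball (n := n) hψ R
  have hv := hs.bdd_comp hφ
  have hV := hs.bdd_comp_profile hφ
  set ν := (vol n ψ).restrict (Metric.ball 0 R)
  set I := ∫ x, |f x - u x| ∂(vol n ψ)
  obtain ⟨C, hC, hpoinc⟩ := exists_poincare (n := n) hψ hR
  have hVv : Measurable fun x : E n => φ (profile ψ u ‖x‖) - φ (u x) :=
    hV.measurable.sub hv.measurable
  have hbound : ∀ᶠ ε in 𝓝[>] (0 : ℝ), eLpNorm (fun x => φ (profile ψ u ‖x‖) - φ (u x)) 2 ν ≤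
      ν Set.univ ^ (2 : ℝ≥0∞).toReal⁻¹ * ENNReal.ofReal (2 * ε) +
        C * ENNReal.ofReal (√(2 * ε * I)) := by
    filter_upwards [Ioo_mem_nhdsGT (show (0 : ℝ) < 1 / 2 by norm_num)] with ε hε
    obtain ⟨W, ω', hW, hcl, hen⟩ := hs.exists_competitor hψ hPS hR hφ hf hfae hε.1 hε.2
    have hD := hW.sub hψ hs.memH10
    have hsum : (fun x => φ (profile ψ u ‖x‖) - φ (u x)) =
        (fun x => φ (profile ψ u ‖x‖) - W x) + fun x => W x - φ (u x) := by
      funext x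
      simp
    rw [hsum]
    refine (eLpNorm_add_le (hV.measurable.aestronglyMeasurable.sub hW.memLp.1) hD.memLp.1
      (by norm_num)).trans (add_le_add ?_ ?_)
    · exact eLpNorm_le_of_ae_bound (Eventually.of_forall fun x => hcl x)
    · refine (hpoinc _ _ hD).trans (mul_le_mul_right ?_ _)
      rw [← ENNReal.ofReal_toReal (hD.gradNorm_lt_top hψ).ne]
      exact ENNReal.ofReal_le_ofReal (Real.le_sqrt_of_sq_le hen)
  have hlim : Tendsto (fun ε : ℝ => ν Set.univ ^ (2 : ℝ≥0∞).toReal⁻¹ * ENNReal.ofReal (2 * ε) +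
      C * ENNReal.ofReal (√(2 * ε * I))) (𝓝[>] 0) (𝓝 0) := by
    have hνtop : ν Set.univ ^ (2 : ℝ≥0∞).toReal⁻¹ ≠ ∞ :=
      ENNReal.rpow_ne_top_of_nonneg (by positivity) (measure_ne_top _ _)
    have h1 : Tendsto (fun ε : ℝ => ENNReal.ofReal (2 * ε)) (𝓝[>] 0) (𝓝 0) := by
      have : Continuous fun ε : ℝ => ENNReal.ofReal (2 * ε) :=
        ENNReal.continuous_ofReal.comp (by fun_prop)
      simpa using (this.tendsto 0).mono_left nhdsWithin_le_nhds
    have h2 : Tendsto (fun ε : ℝ => ENNReal.ofReal (√(2 * ε * I))) (𝓝[>] 0) (𝓝 0) := by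
      have : Continuous fun ε : ℝ => ENNReal.ofReal (√(2 * ε * I)) :=
        ENNReal.continuous_ofReal.comp (by fun_prop)
      simpa using (this.tendsto 0).mono_left nhdsWithin_le_nhds
    simpa using (ENNReal.Tendsto.const_mul h1 (Or.inr hνtop)).add
      (ENNReal.Tendsto.const_mul h2 (Or.inr hC))
  have hzero : eLpNorm (fun x => φ (profile ψ u ‖x‖) - φ (u x)) 2 ν = 0 :=
    le_antisymm (ge_of_tendsto hlim hbound) zero_le
  rw [eLpNorm_eq_zero_iff hVv.aestronglyMeasurable (by norm_num)] at hzero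
  rw [Filter.EventuallyEq, ae_restrict_iff' Metric.isOpen_ball.measurableSet] at hzero
  filter_upwards [hzero] with x hx
  by_cases hxR : x ∈ Metric.ball (0 : E n) R
  · exact hφ.strictMono.injOn (profile_nonneg _ _) (hs.bdd.nonneg x) (sub_eq_zero.1 (hx hxR))
  · rw [hs.bdd.zero x hxR, hs.bdd.schwarz.zero x hxR]

end IsSolution

end Rearranged

/-! ### Comparison of masses -/

section Comparison

variable {n : ℕ} {ψ : ℝ → ℝ} {R : ℝ} {φ : ℝ → ℝ}

/-- A function that is locally nondecreasing on a compact interval is nondecreasing. -/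
theorem le_of_locally_monotone {w : ℝ → ℝ} {r s : ℝ} (hrs : r ≤ s)
    (h : ∀ x ∈ Set.Icc r s, ∃ U : Set ℝ, IsOpen U ∧ x ∈ U ∧
      ∀ y ∈ U ∩ Set.Icc r s, ∀ z ∈ U ∩ Set.Icc r s, y ≤ z → w y ≤ w z) : w r ≤ w s := by
  choose U hU hxU hmono using h
  obtain ⟨t, ht0, htm, ⟨m, hm⟩, ht⟩ := exists_monotone_Icc_subset_open_cover_Icc hrs
    (c := fun x : Set.Icc r s => Subtype.val ⁻¹' U x.1 x.2)
    (fun x => (hU x.1 x.2).preimage continuous_subtype_val)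
    (fun x _ => Set.mem_iUnion.2 ⟨x, hxU x.1 x.2⟩)
  have hstep : ∀ k, w r ≤ w (t k) := by
    intro k
    induction k with
    | zero => rw [ht0]
    | succ k ih =>
      obtain ⟨i, hi⟩ := ht k
      have hle := htm (Nat.le_succ k)
      exact ih.trans (hmono i.1 i.2 _ ⟨hi ⟨le_rfl, hle⟩, (t k).2⟩ _
        ⟨hi ⟨hle, le_rfl⟩, (t (k + 1)).2⟩ hle)
  have := hstep m
  rwa [hm m le_rfl] at this

theorem continuous_mass [Nontrivial (E n)] (hψ : IsModelFunction ψ) {f : E n → ℝ}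
    (hf : BddOnBall R f) : Continuous (mass ψ f) :=
  continuous_setIntegral_ball fun _ => (hf.schwarz.integrable hψ).integrableOn

theorem mass_zero (f : E n → ℝ) : mass ψ f 0 = 0 := by
  rw [mass, Metric.ball_zero, setIntegral_empty]

theorem mass_eq_of_le {f : E n → ℝ} (hf : BddOnBall R f) {r : ℝ}
    (hr : R ≤ r) : mass ψ f r = mass ψ f R := by
  refine (setIntegral_eq_of_subset_of_forall_sdiff_eq_zero Metric.isOpen_ball.measurableSet
    (Metric.ball_subset_ball hr) fun x hx => hf.schwarz.zero x hx.2)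

/-- Masses grow at comparable rates where profiles are comparable. -/
theorem mass_sub_le_mass_sub [Nontrivial (E n)] (hψ : IsModelFunction ψ) {f g : E n → ℝ}
    (hf : BddOnBall R f) (hg : BddOnBall R g) {r s : ℝ} (hrs : r ≤ s)
    (h : ∀ t, r < t → t < s → profile ψ f t ≤ profile ψ g t) :
    mass ψ f s - mass ψ f r ≤ mass ψ g s - mass ψ g r := by
  have hB : ∀ ρ, MeasurableSet (Metric.ball (0 : E n) ρ) := fun ρ =>
    Metric.isOpen_ball.measurableSet
  have hd : ∀ {q : E n → ℝ}, BddOnBall R q → mass ψ q s - mass ψ q r =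
      ∫ x in Metric.ball 0 s \ Metric.ball 0 r, schwarz ψ q x ∂(vol n ψ) := fun hq =>
    (setIntegral_sdiff (hB r) (hq.schwarz.integrable hψ).integrableOn
      (Metric.ball_subset_ball hrs)).symm
  rw [hd hf, hd hg]
  refine setIntegral_mono_on_ae (hf.schwarz.integrable hψ).integrableOn
    (hg.schwarz.integrable hψ).integrableOn ((hB s).diff (hB r)) ?_
  filter_upwards [measure_eq_zero_iff_ae_notMem.1 (vol_sphere (n := n) (ψ := ψ) r)] with x hx hxs
  refine h _ (lt_of_le_of_ne (by simpa using hxs.2) fun h' => hx (by simp [h'])) (by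
    simpa using hxs.1)

variable {f g u v : E n → ℝ} {ω η : E n → E n}

/-- While the rearrangement of `u` carries more mass than that of `v`, the former descends more
slowly than the latter: the drop of `φ(u^⋆)` is at most `(∫ g - ∫ u)` times the resistance, the
drop of `φ(v^⋆)` at least `(∫ g - ∫ v)` times the resistance. -/
theorem IsSolution.sub_le_sub_of_mass_lt [Nontrivial (E n)] (hψ : IsModelFunction ψ)
    (hPS : SupportsPolyaSzego n ψ) (hR : 0 < R) (hφ : IsNonlinearity φ) (hf : BddOnBall R f)
    (hg : BddOnBall R g) (hu : IsSolution ψ R φ f u ω) (hv : IsSolution ψ R φ g v η)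
    (hfg : ∀ r, 0 ≤ r → mass ψ f r ≤ mass ψ g r) (hgae : schwarz ψ g =ᵐ[vol n ψ] g)
    (hvae : schwarz ψ v =ᵐ[vol n ψ] v) {r s : ℝ} (hr : 0 < r) (hrs : r ≤ s) (hsR : s < R)
    (hlt : ∀ t ∈ Set.Icc r s, mass ψ v t < mass ψ u t) :
    φ (profile ψ u r) - φ (profile ψ v r) ≤ φ (profile ψ u s) - φ (profile ψ v s) := by
  have hanti : ∀ {q : E n → ℝ}, BddOnBall R q → ∀ y z, y ≤ z →
      φ (profile ψ q z) ≤ φ (profile ψ q y) := fun hq y z hyz =>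
    hφ.strictMono.monotoneOn (profile_nonneg _ _) (profile_nonneg _ _) (hq.profile_antitone hyz)
  refine le_of_locally_monotone (w := fun t => φ (profile ψ u t) - φ (profile ψ v t)) hrs
    fun x hx => ?_
  -- A constant separating the two excesses near `x`.
  obtain ⟨M, hM1, hM2⟩ := exists_between (sub_lt_sub_left (hlt x hx) (mass ψ g x))
  have hev : ∀ᶠ t in 𝓝 x, mass ψ g t - mass ψ u t < M ∧ M < mass ψ g t - mass ψ v t :=
    ((((continuous_mass hψ hg).sub (continuous_mass hψ hu.bdd)).tendsto x).eventually
      (gt_mem_nhds hM1)).and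
    ((((continuous_mass hψ hg).sub (continuous_mass hψ hv.bdd)).tendsto x).eventually
      (lt_mem_nhds hM2))
  obtain ⟨δ, hδ, hball⟩ := Metric.eventually_nhds_iff_ball.1 hev
  refine ⟨Metric.ball x δ, Metric.isOpen_ball, Metric.mem_ball_self hδ, fun y hy z hz hyz => ?_⟩
  rcases hyz.eq_or_lt with rfl | hyz
  · exact le_rfl
  have hsub : ∀ t ∈ Set.Icc y z, t ∈ Metric.ball x δ := fun t ht => by
    rw [Real.ball_eq_Ioo] at hy hz ⊢
    exact ⟨hy.1.1.trans_le ht.1, ht.2.trans_lt hz.1.2⟩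
  have hy0 : 0 < y := hr.trans_le hy.2.1
  have hz_drop := hanti hu.bdd y z hyz.le
  have hz_drop' := hanti hv.bdd y z hyz.le
  rcases hz_drop.eq_or_lt with h | h
  · linarith
  · have h1 := hu.drop_le hψ hPS hR.le hφ hf hfg hy0 hyz h
      (M := M) fun t ht => (hball t (hsub t ht)).1.le
    have hMpos : 0 ≤ M := by
      by_contra! hM
      have := mul_neg_of_neg_of_pos hM (resistance_pos (n := n) hψ hy0 hyz)
      linarith
    have h2 := hv.le_drop hψ hφ hg hgae hvae hy0 hyz (hz.2.2.trans_lt hsR) hMpos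
      fun t ht => (hball t (hsub t ht)).2.le
    linarith

/-- The concentration comparison for two solutions, the second of which has a rearranged datum. -/
theorem IsSolution.mass_le_mass [Nontrivial (E n)] (hψ : IsModelFunction ψ)
    (hPS : SupportsPolyaSzego n ψ) (hR : 0 < R) (hφ : IsNonlinearity φ) (hf : BddOnBall R f)
    (hg : BddOnBall R g) (hu : IsSolution ψ R φ f u ω) (hv : IsSolution ψ R φ g v η)
    (hfg : ∀ r, 0 ≤ r → mass ψ f r ≤ mass ψ g r) (hgae : schwarz ψ g =ᵐ[vol n ψ] g)
    {r : ℝ} (hr : 0 ≤ r) : mass ψ u r ≤ mass ψ v r := by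
  have hvae := hv.schwarz_ae_eq hψ hPS hR hφ hg hgae
  have hcu := continuous_mass hψ hu.bdd
  have hcv := continuous_mass hψ hv.bdd
  wlog hrR : r ≤ R generalizing r
  · rw [mass_eq_of_le hu.bdd (not_le.1 hrR).le, mass_eq_of_le hv.bdd (not_le.1 hrR).le]
    exact this hR.le le_rfl
  by_contra! hlt
  -- The last radius below `r` at which the masses are ordered.
  obtain ⟨a, ⟨⟨ha0, har⟩, hamass⟩, hamax⟩ :=
    (isCompact_Icc.inter_right (isClosed_le hcu hcv)).exists_isGreatest
      (s := Set.Icc 0 r ∩ {t | mass ψ u t ≤ mass ψ v t})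
      ⟨0, ⟨le_rfl, hr⟩, by rw [Set.mem_ofPred_eq, mass_zero, mass_zero]⟩
  rw [Set.mem_ofPred_eq] at hamass
  have har' : a < r := har.lt_of_ne fun h => by
    rw [h] at hamass
    exact hlt.not_ge hamass
  have hpos : ∀ t, a < t → t ≤ r → mass ψ v t < mass ψ u t := fun t h1 h2 => by
    by_contra! h
    exact h1.not_ge (hamax ⟨⟨ha0.trans h1.le, h2⟩, h⟩)
  have hle_iff : ∀ t, φ (profile ψ u t) ≤ φ (profile ψ v t) ↔ profile ψ u t ≤ profile ψ v t :=
    fun t => hφ.strictMono.le_iff_le (profile_nonneg _ _) (profile_nonneg _ _)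
  by_cases hcase : ∃ c, a < c ∧ c < r ∧ φ (profile ψ v c) < φ (profile ψ u c)
  · obtain ⟨c, hac, hcr, hc⟩ := hcase
    have hc0 : 0 < c := ha0.trans_lt hac
    have hcR : c < R := hcr.trans_le hrR
    have hmono : ∀ s, c ≤ s → s < R → (∀ t ∈ Set.Icc c s, mass ψ v t < mass ψ u t) →
        φ (profile ψ u c) - φ (profile ψ v c) ≤ φ (profile ψ u s) - φ (profile ψ v s) :=
      fun s h1 h2 h3 => hu.sub_le_sub_of_mass_lt hψ hPS hR hφ hf hg hv hfg hgae hvae hc0 h1 h2 h3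
    -- Past `c` the excess of mass only grows, up to the boundary.
    have hall : ∀ t ∈ Set.Icc c R, mass ψ v t < mass ψ u t := by
      by_contra! hex
      obtain ⟨t, ht, htm⟩ := hex
      obtain ⟨b, ⟨⟨hcb, hbR⟩, hbmass⟩, hbmin⟩ :=
        (isCompact_Icc.inter_right (isClosed_le hcu hcv)).exists_isLeast
          (s := Set.Icc c R ∩ {t | mass ψ u t ≤ mass ψ v t}) ⟨t, ht, htm⟩
      rw [Set.mem_ofPred_eq] at hbmass
      have hbefore : ∀ s, c ≤ s → s < b → mass ψ v s < mass ψ u s := fun s h1 h2 => by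
        by_contra! h
        exact h2.not_ge (hbmin ⟨⟨h1, h2.le.trans hbR⟩, h⟩)
      have h1 := mass_sub_le_mass_sub hψ hv.bdd hu.bdd hcb fun s h2 h3 => by
        rw [← hφ.strictMono.le_iff_le (profile_nonneg _ _) (profile_nonneg _ _)]
        have := hmono s h2.le (h3.trans_le hbR) fun t ht => hbefore t ht.1 (ht.2.trans_lt h3)
        linarith
      linarith [hpos c hac hcr.le]
    -- But the rearrangement of `φ(u)` tends to `0` at the boundary.
    obtain ⟨R', h1, -, h2, h3⟩ := hu.exists_profile_le hψ hPS hR hφ hf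
      (half_pos (sub_pos.2 hc)) hcR
    have h4 := hmono R' h1.le h2 fun t ht => hall t ⟨ht.1, ht.2.trans h2.le⟩
    have h5 : 0 ≤ φ (profile ψ v R') := hφ.nonneg (profile_nonneg _ _)
    linarith
  · push Not at hcase
    have := mass_sub_le_mass_sub hψ hu.bdd hv.bdd har fun t h1 h2 => (hle_iff t).1 (hcase t h1 h2)
    linarith

end Comparison

/-! ### Measurable representatives -/

section Representatives

variable {n : ℕ} {ψ : ℝ → ℝ} {R : ℝ} {φ : ℝ → ℝ}

theorem exists_bddOnBall {q : E n → ℝ}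
    (hq : AEMeasurable q ((vol n ψ).restrict (Metric.ball 0 R)))
    (h0 : ∀ᵐ x ∂((vol n ψ).restrict (Metric.ball 0 R)), 0 ≤ q x) {C : ℝ}
    (hC : ∀ᵐ x ∂((vol n ψ).restrict (Metric.ball 0 R)), q x ≤ C) :
    ∃ q₀ : E n → ℝ, BddOnBall R q₀ ∧ zeroExtend R q =ᵐ[vol n ψ] q₀ := by
  have hB : MeasurableSet (Metric.ball (0 : E n) R) := Metric.isOpen_ball.measurableSet
  refine ⟨(Metric.ball 0 R).indicator fun x => max 0 (min (hq.mk q x) C),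
    ⟨?_, fun x => ?_, ⟨max 0 C, fun x => ?_⟩, fun x hx => Set.indicator_of_notMem hx _⟩, ?_⟩
  · exact (measurable_const.max (hq.measurable_mk.min measurable_const)).indicator hB
  · exact Set.indicator_nonneg (fun x _ => le_max_left _ _) x
  · refine Set.indicator_le' (fun x _ => max_le_max le_rfl (min_le_right _ _))
      (fun x _ => le_max_left _ _) x
  · have hmk := hq.ae_eq_mk
    rw [Filter.EventuallyEq, ae_restrict_iff' hB] at hmk
    rw [ae_restrict_iff' hB] at h0 hC
    filter_upwards [hmk, h0, hC] with x h1 h2 h3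
    by_cases hx : x ∈ Metric.ball (0 : E n) R
    · rw [zeroExtend, Set.indicator_of_mem hx, Set.indicator_of_mem hx, ← h1 hx,
        min_eq_left (h3 hx), max_eq_right (h2 hx)]
    · rw [zeroExtend, Set.indicator_of_notMem hx, Set.indicator_of_notMem hx]

theorem exists_bddOnBall_of_memLp {q : E n → ℝ}
    (hq : MemLp q ∞ ((vol n ψ).restrict (Metric.ball 0 R)))
    (h0 : ∀ᵐ x ∂((vol n ψ).restrict (Metric.ball 0 R)), 0 ≤ q x) :
    ∃ q₀ : E n → ℝ, BddOnBall R q₀ ∧ zeroExtend R q =ᵐ[vol n ψ] q₀ := by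
  refine exists_bddOnBall hq.1.aemeasurable h0
    (C := (eLpNormEssSup q ((vol n ψ).restrict (Metric.ball 0 R))).toReal) ?_
  have h1 := hq.2
  rw [eLpNorm_exponent_top] at h1
  filter_upwards [enorm_ae_le_eLpNormEssSup q ((vol n ψ).restrict (Metric.ball 0 R))] with x hx
  have := ENNReal.toReal_mono h1.ne hx
  rw [toReal_enorm] at this
  exact (le_abs_self _).trans this

theorem ae_restrict_eq_of_zeroExtend {q q₀ : E n → ℝ} (h : zeroExtend R q =ᵐ[vol n ψ] q₀) :
    q =ᵐ[(vol n ψ).restrict (Metric.ball 0 R)] q₀ := by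
  rw [Filter.EventuallyEq, ae_restrict_iff' Metric.isOpen_ball.measurableSet]
  filter_upwards [h] with x hx hxR
  rw [← hx, zeroExtend, Set.indicator_of_mem hxR]

theorem isNonlinearity_of_deriv_pos (hbij : Set.BijOn φ (Set.Ici 0) (Set.Ici 0))
    (hsmooth : ContDiffOn ℝ 1 φ (Set.Ici 0)) (hzero : φ 0 = 0)
    (hderiv : ∀ s : ℝ, 0 ≤ s → 0 < derivWithin φ (Set.Ici 0) s) : IsNonlinearity φ where
  strictMono := strictMonoOn_of_deriv_pos (convex_Ici 0) hsmooth.continuousOn fun x hx => by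
    rw [interior_Ici] at hx
    rw [← derivWithin_of_mem_nhds (Ici_mem_nhds hx)]
    exact hderiv x (le_of_lt hx)
  continuousOn := hsmooth.continuousOn
  zero := hzero
  surj t ht := by
    obtain ⟨s, hs, hst⟩ := hbij.surjOn ht
    exact ⟨s, hs, hst⟩

theorem invFunOn_apply (hbij : Set.BijOn φ (Set.Ici 0) (Set.Ici 0)) {s : ℝ} (hs : 0 ≤ s) :
    Function.invFunOn φ (Set.Ici 0) (φ s) = s :=
  hbij.invOn_invFunOn.1 hs

/-- A weak solution has a bounded measurable representative, which solves the equation with any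
representative of the datum. -/
theorem IsFilteredWeakSolution.exists_isSolution [Nontrivial (E n)] (hψ : IsModelFunction ψ)
    (hφ : IsNonlinearity φ) (hbij : Set.BijOn φ (Set.Ici 0) (Set.Ici 0)) {f f₀ u : E n → ℝ}
    (hf : BddOnBall R f₀) (hff : zeroExtend R f =ᵐ[vol n ψ] f₀)
    (hu : IsFilteredWeakSolution ψ R φ f u) :
    ∃ (u₀ : E n → ℝ) (ω : E n → E n), zeroExtend R u =ᵐ[vol n ψ] u₀ ∧ IsSolution ψ R φ f₀ u₀ ω := by
  have := isFiniteMeasure_vol_restrict_ball (n := n) hψ R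
  obtain ⟨hu0, hv0, hvL, ω, hω, hweak⟩ := hu
  set β := Function.invFunOn φ (Set.Ici 0)
  -- The inverse of `φ`, extended to a monotone function on `ℝ`.
  have hβ : Monotone fun t => β (max t 0) := fun s t hst => by
    have hs := hbij.invOn_invFunOn.2 (le_max_right s 0 : max s 0 ∈ Set.Ici 0)
    have ht := hbij.invOn_invFunOn.2 (le_max_right t 0 : max t 0 ∈ Set.Ici 0)
    refine (hφ.strictMono.le_iff_le
      (hbij.surjOn.mapsTo_invFunOn (le_max_right s 0 : max s 0 ∈ Set.Ici 0))
      (hbij.surjOn.mapsTo_invFunOn (le_max_right t 0 : max t 0 ∈ Set.Ici 0))).1 ?_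
    exact (hs.trans_le (max_le_max hst le_rfl)).trans_eq ht.symm
  have hβu : ∀ s, 0 ≤ s → β (max (φ s) 0) = s := fun s hs => by
    rw [max_eq_left (hφ.nonneg hs)]
    exact invFunOn_apply hbij hs
  have hum : AEMeasurable u ((vol n ψ).restrict (Metric.ball 0 R)) := by
    refine (hβ.measurable.comp_aemeasurable hvL.1.aemeasurable).congr ?_
    filter_upwards [hu0] with x hx
    exact hβu _ hx
  obtain ⟨v₀, hv₀, hvv⟩ := exists_bddOnBall_of_memLp hvL hv0
  obtain ⟨C, hC⟩ := hv₀.bdd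
  obtain ⟨u₀, hu₀, huu⟩ := exists_bddOnBall hum hu0 (C := β (max C 0)) (by
    filter_upwards [hu0, ae_restrict_eq_of_zeroExtend hvv] with x h1 h2
    rw [← hβu _ h1]
    exact hβ (h2.trans_le (hC x)))
  have hu' := ae_restrict_eq_of_zeroExtend huu
  have hf' := ae_restrict_eq_of_zeroExtend hff
  refine ⟨u₀, ω, huu, hu₀, hω.congr hψ ?_, fun w η hw => ?_⟩
  · filter_upwards [hu'] with x hx
    rw [hx]
  · have hwi : Integrable w ((vol n ψ).restrict (Metric.ball 0 R)) :=
      hw.memLp.integrable (by norm_num)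
    have hmul : ∀ {q : E n → ℝ}, BddOnBall R q →
        Integrable (fun x => q x * w x) ((vol n ψ).restrict (Metric.ball 0 R)) := fun hq => by
      obtain ⟨D, hD⟩ := hq.bdd
      refine hwi.bdd_mul (c := D) hq.measurable.aestronglyMeasurable
        (Eventually.of_forall fun x => ?_)
      rw [Real.norm_of_nonneg (hq.nonneg x)]
      exact hD x
    have e1 : ∫ x in Metric.ball 0 R, β (φ (u x)) * w x ∂(vol n ψ) =
        ∫ x in Metric.ball 0 R, u₀ x * w x ∂(vol n ψ) := by
      refine integral_congr_ae ?_
      filter_upwards [hu0, hu'] with x h1 h2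
      rw [← h2, show β (φ (u x)) = u x from invFunOn_apply hbij h1]
    have e2 : ∫ x in Metric.ball 0 R, f x * w x ∂(vol n ψ) =
        ∫ x in Metric.ball 0 R, f₀ x * w x ∂(vol n ψ) := by
      refine integral_congr_ae ?_
      filter_upwards [hf'] with x h
      rw [h]
    have h := hweak w η hw
    rw [e1, e2] at h
    rw [eq_sub_of_add_eq h, ← integral_sub (hmul hf) (hmul hu₀)]
    simp only [sub_mul]

end Representatives

end ModelManifold

theorem proposition5p3 (n : ℕ) (hn : 2 ≤ n) (ψ : ℝ → ℝ)
    (hψ : ModelManifold.IsModelFunction ψ)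
    (hPS : ModelManifold.SupportsPolyaSzego n ψ)
    (R : ℝ) (hR : 0 < R)
    (φ : ℝ → ℝ) (hφ_bij : Set.BijOn φ (Set.Ici 0) (Set.Ici 0))
    (hφ_smooth : ContDiffOn ℝ 1 φ (Set.Ici 0)) (hφ_zero : φ 0 = 0)
    (hφ_deriv : ∀ s : ℝ, 0 ≤ s → 0 < derivWithin φ (Set.Ici 0) s)
    (f fbar u ubar : ModelManifold.E n → ℝ)
    (hf : MemLp f ∞ ((ModelManifold.vol n ψ).restrict (Metric.ball 0 R)))
    (hf_nonneg : ∀ᵐ x ∂((ModelManifold.vol n ψ).restrict (Metric.ball 0 R)), 0 ≤ f x)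
    (hfbar : MemLp fbar ∞ ((ModelManifold.vol n ψ).restrict (Metric.ball 0 R)))
    (hfbar_nonneg : ∀ᵐ x ∂((ModelManifold.vol n ψ).restrict (Metric.ball 0 R)), 0 ≤ fbar x)
    (hfbar_rad : ModelManifold.IsRadiallyNonincreasing ψ R fbar)
    (hprec : ModelManifold.LessConcentrated ψ
      (ModelManifold.schwarz ψ (ModelManifold.zeroExtend R f))
      (ModelManifold.zeroExtend R fbar))
    (hu : ModelManifold.IsFilteredWeakSolution ψ R φ f u)
    (hubar : ModelManifold.IsFilteredWeakSolution ψ R φ fbar ubar) :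
    ModelManifold.LessConcentrated ψ
      (ModelManifold.schwarz ψ (ModelManifold.zeroExtend R u))
      (ModelManifold.zeroExtend R ubar) := by
  have : Nontrivial (Fin n) := Fin.nontrivial_iff_two_le.2 hn
  have : Nonempty (Fin n) := inferInstance
  have : Nontrivial (ModelManifold.E n) := by
    unfold ModelManifold.E
    infer_instance
  have hφ := ModelManifold.isNonlinearity_of_deriv_pos hφ_bij hφ_smooth hφ_zero hφ_deriv
  obtain ⟨f₀, hf₀, hff⟩ := ModelManifold.exists_bddOnBall_of_memLp hf hf_nonneg
  obtain ⟨g₀, hg₀, hgg⟩ := ModelManifold.exists_bddOnBall_of_memLp hfbar hfbar_nonneg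
  obtain ⟨u₀, ω, huu, hus⟩ := hu.exists_isSolution hψ hφ hφ_bij hf₀ hff
  obtain ⟨v₀, η, hvv, hvs⟩ := hubar.exists_isSolution hψ hφ hφ_bij hg₀ hgg
  have hgrad : ModelManifold.IsRadiallyNonincreasing ψ R g₀ := by
    obtain ⟨h, hanti, hae⟩ := hfbar_rad
    refine ⟨h, hanti, ?_⟩
    filter_upwards [hae, ModelManifold.ae_restrict_eq_of_zeroExtend hgg] with x h1 h2
    rw [← h2, h1]
  have hmass : ∀ r, 0 ≤ r → ModelManifold.mass ψ f₀ r ≤ ModelManifold.mass ψ g₀ r := fun r hr => by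
    rcases hr.eq_or_lt with rfl | hr
    · rw [ModelManifold.mass_zero, ModelManifold.mass_zero]
    · have h := hprec.2.2 r hr
      rw [ModelManifold.schwarz_congr_ae hff, ModelManifold.schwarz_congr_ae hgg,
        hf₀.schwarz_schwarz hψ hR.le] at h
      exact h
  refine ⟨?_, (hvs.bdd.integrable hψ).congr hvv.symm, fun r hr => ?_⟩
  · rw [ModelManifold.schwarz_congr_ae huu]
    exact hus.bdd.schwarz.integrable hψ
  · rw [ModelManifold.schwarz_congr_ae huu, ModelManifold.schwarz_congr_ae hvv,
      hus.bdd.schwarz_schwarz hψ hR.le]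
    exact hus.mass_le_mass hψ hPS hR hφ hf₀ hg₀ hvs hmass (hg₀.schwarz_ae_eq hψ hgrad) hr.le
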